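/- **Setting.** A multi-tape Turing machine $M=(K,Q,\Sigma,\Gamma,\delta,\sqcup,q_{\rm init},q_{\rm halt})$ has $K\ge 1$ tapes infinite to the right, finite sets $Q,\ \Sigma\subset\Gamma$, a blank $\sqcup\in\Gamma\setminus\Sigma$, states $q_{\rm halt}\ne q_{\rm init}$, and $\delta:Q\times\Gamma^K\to Q\times\Gamma^K\times\{L,S,R\}^K$; all heads start in cell $0$, a left move in cell $0$ does nothing, and the input is on tape 1. If $M$ halts on $w\in\Sigma^*$, $t_M(w)$ is the first time at which the state is $q_{\rm halt}$, and if tape 1 then contains $u\sqcup\sqcup\cdots$ with $u\in\Sigma^*$, then $f_M(w):=u$. A hardmax transformer decoder with dimensions $d,d_{\rm ff},d_k,d_v$, $H$ heads per layer, depth $L$ and finite vocabulary $\mathcal V$ maps tokens $\tau_0,\dots,\tau_{n-1}$ ($n\ge1$) to $\arg\max_{\tau\in\mathcal V}\langle{\rm unemb}_\tau,x^{(L)}_{n-1}\rangle$, where $x_i^{(0)}={\rm emb}_{\tau_i}+{\rm posemb}(i)$, ${\rm posemb}(i)$ has the lowest $d_{\rm pos}$ bits of $i$ (coded by $\pm1$)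 in $d_{\rm pos}$ fixed coordinates and zeros elsewhere, and $$x^{(\ell-0.5)}_i=x^{(\ell-1)}_i+\sum_{h=1}^H z_i^{(\ell,h)},\qquad x^{(\ell)}_i=x^{(\ell-0.5)}_i+W_2\,{\rm ReLU}(W_1x^{(\ell-0.5)}_i+b).$$ Here $z_i^{(\ell,h)}=W_O\,\frac1{|J_i|}\sum_{j\in J_i}W_Vx_j^{(\ell-1)}$, and $J_i$ is the set of all $j\le i$ that maximize the score $\frac1{\sqrt{d_k}}\langle W_Qx_i^{(\ell-1)},W_Kx_j^{(\ell-1)}\rangle$. It has *ternary weights* if all parameters except the biases $b$ have entries in $\{-1,0,1\}$, and *ternary activations* on a token sequence if, at all positions and in all layers, all representations $x^{(\ell)},x^{(\ell-0.5)}$, queries, keys, values, head outputs $z^{(\ell,h)}$ and their sums over $h$, and hidden activations after ReLU have entries in $\{-1,0,1\}$. Let $\mathcal V_M=\{\texttt{<inp>},\texttt{</inp>},\texttt{<outp>},\texttt{</outp>},\texttt{<p>},\texttt{</p>}\}\sqcup (Q\times\Gamma^K\times\{L,S,R\}^K)\sqcup\{-1,1\}^K\sqcup\Sigma$. A transformer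 $T$ with vocabulary $\mathcal V_M$ *computes $u$ from $w$ with chain of thought, with generated sequence $\tau$*, if autoregressive generation from $\texttt{<inp>}\,w\,\texttt{</inp>}$, stopped at the first generated $\texttt{</outp>}$, yields $\tau$ (input tokens included), $\tau$ begins with $\texttt{<inp>}\,w\,\texttt{</inp>}$ and thereafter ends with $\texttt{<outp>}\,u\,\texttt{</outp>}$, and $\texttt{<outp>}$ occurs exactly once in $\tau$; at each generated token the argmax must be unique. For $r\ge2$ let ${\rm toks}(M,w,r)$ be the sequence consisting of $\texttt{<inp>}\,w\,\texttt{</inp>}$; then, for $t=1,\dots,t_M(w)$, the token (state entered, symbols written, head movements) of step $t$, followed, if $r\mid t$ and $t\ne t_M(w)$, by $\texttt{<p>}$, the $r$ tokens in $\{-1,1\}^K$ which list the bits (least significant first) of the $K$ head positions after step $t$, and $\texttt{</p>}$; then $\texttt{<outp>}\,f_M(w)\,\texttt{</outp>}$. **Theorem.** (1) Let $M$ be a multi-tape Turing machine, let $r\ge 2$ be even, and put $d_Q=\lceil\log_2|Q|\rceil$, $d_\Gamma=\lceil\log_2|\Gamma|\rceil$. There is a hardmax transformer $T$ with vocabulary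 $\mathcal V_M$, ternary weights, $d_{\rm pos}=r$, depth $L=\frac{5r}2+8$, $H=3K$ heads per layer and $$d_k=4r-1,\qquad d_v=\max\{r,d_Q,d_\Gamma\},\qquad d_{\rm ff}=\max\{18r+2,\;14Kr+2r,\;|Q||\Gamma|^K+1\},$$ $$d=6Kr+6r+3d_Q+(3K+1)d_\Gamma+10K+21,$$ such that for every $w\in\Sigma^*$ on which $M$ halts with output $f_M(w)\in\Sigma^*$ and $|{\rm toks}(M,w,r)|\le2^r$, $T$ computes $f_M(w)$ from $w$ with chain of thought, with generated sequence ${\rm toks}(M,w,r)$, and with ternary activations on all token sequences on which it is evaluated during the generation. (2) There is an absolute constant $C$, and for every multi-tape Turing machine $M$ a constant $C_M$, such that for every integer $\hat t\ge1$ there is a hardmax transformer $T$ with vocabulary $\mathcal V_M$, ternary weights, $H\le C_M$ heads per layer, and $$L,\,d_k\le C\log(\hat t+1),\qquad d,\,d_v,\,d_{\rm ff}\le C_M\log(\hat t+1),$$ such that for every $w\in\Sigma^*$ with $|w|\le\hat t$ on which $M$ halts with $t_M(w)\le\hat t$ and output $f_M(w)\in\Sigma^*$, $T$ computes $f_M(w)$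 from $w$ with chain of thought, with a generated sequence of at most $C\,(t_M(w)+|w|)$ tokens, and with ternary activations on all token sequences on which it is evaluated during the generation. -/

import Mathlib

open scoped Matrix

/-! ## Multi-tape Turing machines -/

/-- Head movements: left, stay, right. -/
inductive HeadMove where
  | left
  | stay
  | right

/-- A deterministic multi-tape Turing machine with `K ≥ 1` one-sided infinite tapes, state set `Q`,
input alphabet `S` and tape alphabet `G`. The inclusion of the input alphabet into the tape alphabet
is the injection `incl`, whose range misses the blank symbol. -/
structure TuringMachine (K : ℕ) (Q S G : Type*) where
  K_pos : 0 < K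
  incl : S ↪ G
  blank : G
  blank_ne : ∀ a : S, incl a ≠ blank
  qinit : Q
  qhalt : Q
  qhalt_ne : qhalt ≠ qinit
  δ : Q → (Fin K → G) → Q × (Fin K → G) × (Fin K → HeadMove)

/-- A configuration: state, tape contents, head positions. -/
structure TMConfig (K : ℕ) (Q G : Type*) where
  state : Q
  tape : Fin K → ℕ → G
  head : Fin K → ℕ

/-- New head position; a left move in cell `0` stays in cell `0` (truncated subtraction). -/
def HeadMove.apply : HeadMove → ℕ → ℕ
  | .left, n => n - 1
  | .stay, n => n
  | .right, n => n + 1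

namespace TuringMachine

variable {K : ℕ} {Q S G : Type*} (M : TuringMachine K Q S G)

/-- The tape content `w₀ w₁ … w_{n-1} ⊔ ⊔ …`. -/
def wordTape (w : List S) (i : ℕ) : G := (w[i]?.map M.incl).getD M.blank

/-- Initial configuration: the input is on the first tape, all other tapes are blank. -/
def initConfig (w : List S) : TMConfig K Q G where
  state := M.qinit
  tape k := if (k : ℕ) = 0 then M.wordTape w else fun _ => M.blank
  head _ := 0

/-- The value of the transition function in a configuration: new state, symbols written, moves. -/
def action (c : TMConfig K Q G) : Q × (Fin K → G) × (Fin K → HeadMove) :=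
  M.δ c.state (fun k => c.tape k (c.head k))

/-- One step. -/
def step (c : TMConfig K Q G) : TMConfig K Q G where
  state := (M.action c).1
  tape k := Function.update (c.tape k) (c.head k) ((M.action c).2.1 k)
  head k := ((M.action c).2.2 k).apply (c.head k)

/-- The configuration after `t` steps on input `w`. -/
def run (w : List S) : ℕ → TMConfig K Q G
  | 0 => M.initConfig w
  | t + 1 => M.step (run w t)

/-- `M` halts on input `w`, with running time `t_M(w) = t` (the first time at which the halting
state is reached) and output `f_M(w) = u`, a word over the input alphabet. -/
def Computes (w : List S) (t : ℕ) (u : List S) : Prop :=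
  IsLeast {s : ℕ | (M.run w s).state = M.qhalt} t ∧
    (M.run w t).tape ⟨0, M.K_pos⟩ = M.wordTape u

end TuringMachine

/-! ## Hardmax transformer decoders -/

/-- The bit of index `s` of the number `i` (least significant bit first), with `1` for a set bit and
`-1` for an unset one. The two-element set `{-1, 1}` is the type `ℤˣ`. -/
def signBit (s i : ℕ) : ℤˣ := if i / 2 ^ s % 2 = 1 then 1 else -1

/-- Parameters of an attention head: query, key, value and output projections. -/
structure AttentionHead (d dk dv : ℕ) where
  WQ : Matrix (Fin dk) (Fin d) ℝ
  WK : Matrix (Fin dk) (Fin d) ℝ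
  WV : Matrix (Fin dv) (Fin d) ℝ
  WO : Matrix (Fin d) (Fin dv) ℝ

/-- Parameters of a one-hidden-layer ReLU network: up projection, bias, down projection. -/
structure ReLUNet (d dff : ℕ) where
  W1 : Matrix (Fin dff) (Fin d) ℝ
  b : Fin dff → ℝ
  W2 : Matrix (Fin d) (Fin dff) ℝ

/-- Parameters of a transformer layer with `H` heads. -/
structure TransformerLayer (d dff dk dv H : ℕ) where
  head : Fin H → AttentionHead d dk dv
  mlp : ReLUNet d dff

/-- Parameters of a transformer decoder with dimension `d`, feed-forward dimension `dff`, key-query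
dimension `dk`, value dimension `dv`, `H` heads per layer, depth `L` and vocabulary `V`, together
with the `dpos` coordinates into which the binary positional embedding is written. -/
structure Transformer (d dff dk dv H L dpos : ℕ) (V : Type*) where
  layer : Fin L → TransformerLayer d dff dk dv H
  emb : V → Fin d → ℝ
  unemb : V → Fin d → ℝ
  posCoord : Fin dpos ↪ Fin d

namespace AttentionHead

variable {d dk dv n : ℕ} (A : AttentionHead d dk dv) (x : Fin n → Fin d → ℝ)

def query (i : Fin n) : Fin dk → ℝ := A.WQ *ᵥ x i

def key (i : Fin n) : Fin dk → ℝ := A.WK *ᵥ x i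

def value (i : Fin n) : Fin dv → ℝ := A.WV *ᵥ x i

/-- Attention score of position `i` for position `j`. -/
noncomputable def score (i j : Fin n) : ℝ := 1 / Real.sqrt dk * (A.query x i ⬝ᵥ A.key x j)

open Classical in
/-- The positions `j ≤ i` at which the score of `i` is maximal. -/
noncomputable def argmaxSet (i : Fin n) : Finset (Fin n) :=
  {j ∈ Finset.Iic i | ∀ l ≤ i, A.score x i l ≤ A.score x i j}

open Classical in
/-- Averaging hardmax attention weights. -/
noncomputable def weight (i j : Fin n) : ℝ :=
  if j ∈ A.argmaxSet x i then 1 / ((A.argmaxSet x i).card : ℝ) else 0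

/-- Output of the (causal) attention head at position `i`. -/
noncomputable def out (i : Fin n) : Fin d → ℝ :=
  A.WO *ᵥ ∑ j ∈ Finset.Iic i, A.weight x i j • A.value x j

end AttentionHead

namespace ReLUNet

variable {d dff : ℕ} (f : ReLUNet d dff)

/-- Hidden activations after ReLU. -/
noncomputable def hidden (y : Fin d → ℝ) : Fin dff → ℝ := fun a => max 0 ((f.W1 *ᵥ y + f.b) a)

noncomputable def out (y : Fin d → ℝ) : Fin d → ℝ := f.W2 *ᵥ f.hidden y

end ReLUNet

namespace TransformerLayer

variable {d dff dk dv H n : ℕ} (B : TransformerLayer d dff dk dv H) (x : Fin n → Fin d → ℝ)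

/-- Sum of the outputs of all attention heads. -/
noncomputable def attn (i : Fin n) : Fin d → ℝ := ∑ h, (B.head h).out x i

/-- Representations after the attention block, including the residual connection. -/
noncomputable def mid (i : Fin n) : Fin d → ℝ := x i + B.attn x i

/-- Representations after the whole layer. -/
noncomputable def out (i : Fin n) : Fin d → ℝ := B.mid x i + B.mlp.out (B.mid x i)

end TransformerLayer

/-- Membership in `{-1, 0, 1}`. -/
def IsTernary (a : ℝ) : Prop := a = -1 ∨ a = 0 ∨ a = 1

namespace Transformer

variable {d dff dk dv H L dpos : ℕ} {V : Type*} (T : Transformer d dff dk dv H L dpos V)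

/-- Binary positional embedding: the `dpos` lowest bits of `i` in the coordinates `posCoord`, zeros
elsewhere. -/
noncomputable def posemb (i : ℕ) : Fin d → ℝ :=
  Function.extend T.posCoord (fun s : Fin dpos => (((signBit s i : ℤˣ) : ℤ) : ℝ)) 0

/-- The representations after `ℓ` layers (for `ℓ ≤ L`) on the token sequence `τ`. -/
noncomputable def rep (τ : List V) : ℕ → Fin τ.length → Fin d → ℝ
  | 0 => fun i => T.emb (τ.get i) + T.posemb i
  | ℓ + 1 => if h : ℓ < L then (T.layer ⟨ℓ, h⟩).out (rep τ ℓ) else rep τ ℓ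

/-- Output score of the token `v` at the last position of the nonempty sequence `τ`. -/
noncomputable def score (τ : List V) (hτ : τ ≠ []) (v : V) : ℝ :=
  T.unemb v ⬝ᵥ T.rep τ L ⟨τ.length - 1, Nat.sub_one_lt (by simpa using hτ)⟩

/-- `v` is the output of the transformer on the nonempty sequence `τ`: it is the only maximizer of
the output score, so that it is the `argmax` however ties are broken. -/
def Outputs (τ : List V) (v : V) : Prop :=
  ∃ hτ : τ ≠ [], ∀ v', v' ≠ v → T.score τ hτ v' < T.score τ hτ v

/-- Autoregressive generation from the sequence `p` with stopping symbols `F` terminates and gives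
the sequence `τ` (which includes `p`): every token after `p` is the output on the tokens before it,
and the first generated stopping symbol is the last token of `τ`. -/
def Generates (p : List V) (F : Set V) (τ : List V) : Prop :=
  p <+: τ ∧ p.length < τ.length ∧
    ∀ (k : ℕ) (hk : k < τ.length), p.length ≤ k →
      T.Outputs (τ.take k) τ[k] ∧ (τ[k] ∈ F ↔ k + 1 = τ.length)

/-- All weights (all parameters except the biases of the ReLU networks) are in `{-1, 0, 1}`. -/
def TernaryWeights : Prop :=
  (∀ v c, IsTernary (T.emb v c)) ∧ (∀ v c, IsTernary (T.unemb v c)) ∧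
  ∀ ℓ : Fin L,
    (∀ h, (∀ a c, IsTernary (((T.layer ℓ).head h).WQ a c)) ∧
      (∀ a c, IsTernary (((T.layer ℓ).head h).WK a c)) ∧
      (∀ a c, IsTernary (((T.layer ℓ).head h).WV a c)) ∧
      (∀ a c, IsTernary (((T.layer ℓ).head h).WO a c))) ∧
    (∀ a c, IsTernary ((T.layer ℓ).mlp.W1 a c)) ∧
    (∀ a c, IsTernary ((T.layer ℓ).mlp.W2 a c))

/-- Ternary activations on the token sequence `τ`: at all positions and in all layers, the hidden
representations (also those between attention and feed-forward block), the queries, keys and values,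
the outputs of the attention heads and their sum, and the hidden activations of the ReLU networks
have all entries in `{-1, 0, 1}`. -/
def TernaryActivations (τ : List V) : Prop :=
  (∀ ℓ ≤ L, ∀ i c, IsTernary (T.rep τ ℓ i c)) ∧
  ∀ (ℓ : Fin L) (i : Fin τ.length),
    (∀ c, IsTernary ((T.layer ℓ).mid (T.rep τ ℓ) i c)) ∧
    (∀ c, IsTernary ((T.layer ℓ).attn (T.rep τ ℓ) i c)) ∧
    (∀ a, IsTernary ((T.layer ℓ).mlp.hidden ((T.layer ℓ).mid (T.rep τ ℓ) i) a)) ∧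
    ∀ h,
      (∀ a, IsTernary (((T.layer ℓ).head h).query (T.rep τ ℓ) i a)) ∧
      (∀ a, IsTernary (((T.layer ℓ).head h).key (T.rep τ ℓ) i a)) ∧
      (∀ a, IsTernary (((T.layer ℓ).head h).value (T.rep τ ℓ) i a)) ∧
      (∀ c, IsTernary (((T.layer ℓ).head h).out (T.rep τ ℓ) i c))

/-- Ternary activations on every sequence which the transformer is evaluated on while generating
`τ` from `p`. -/
def TernaryDuring (p τ : List V) : Prop :=
  ∀ k, p.length ≤ k → k < τ.length → T.TernaryActivations (τ.take k)

end Transformer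

/-! ## Chain of thought -/

/-- The vocabulary for a Turing machine: the delimiters `<inp>`, `</inp>`, `<outp>`, `</outp>`,
`<p>`, `</p>`, the run tokens `Q × G^K × {L, S, R}^K`, the position tokens `{-1, 1}^K` and the
symbols of the input alphabet. -/
inductive CoTToken (K : ℕ) (Q S G : Type*) where
  | inp
  | inpEnd
  | outp
  | outpEnd
  | pos
  | posEnd
  | run (q : Q) (y : Fin K → G) (Δ : Fin K → HeadMove)
  | bits (b : Fin K → ℤˣ)
  | sym (a : S)

section CoT

variable {K : ℕ} {Q S G : Type*}

/-- `<inp> w </inp>`. -/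
def promptToks (w : List S) : List (CoTToken K Q S G) :=
  .inp :: (w.map .sym ++ [.inpEnd])

/-- `<outp> u </outp>`. -/
def outputToks (u : List S) : List (CoTToken K Q S G) :=
  .outp :: (u.map .sym ++ [.outpEnd])

/-- The transformer computes the word `u` from the word `w` with chain of thought, and the generated
token sequence (including the input tokens) is `τ`. -/
def Transformer.ComputesCoT {d dff dk dv H L dpos : ℕ}
    (T : Transformer d dff dk dv H L dpos (CoTToken K Q S G)) (w u : List S)
    (τ : List (CoTToken K Q S G)) : Prop :=
  T.Generates (promptToks w) {.outpEnd} τ ∧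
    (∃ mid, τ = promptToks w ++ mid ++ outputToks u) ∧
    ∃! k : ℕ, τ[k]? = some .outp

namespace TuringMachine

variable (M : TuringMachine K Q S G)

/-- The run token of step `t + 1`: the state entered, the symbols written, the head movements. -/
def runTok (w : List S) (t : ℕ) : CoTToken K Q S G :=
  .run (M.action (M.run w t)).1 (M.action (M.run w t)).2.1 (M.action (M.run w t)).2.2

/-- The block `<p> … </p>` with the head positions after `t` steps, written with `r` bits. -/
def posBlock (r : ℕ) (w : List S) (t : ℕ) : List (CoTToken K Q S G) :=
  .pos :: ((List.range r).map (fun s => .bits fun k => signBit s ((M.run w t).head k)) ++ [.posEnd])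

/-- The run tokens of the steps `1, …, t`, where after each `r` run tokens, except after the very
last run token, the head positions are inserted. -/
def traceToks (r : ℕ) (w : List S) (t : ℕ) : List (CoTToken K Q S G) :=
  (List.range t).flatMap fun i =>
    M.runTok w i :: if r ∣ i + 1 ∧ i + 1 ≠ t then M.posBlock r w (i + 1) else []

/-- The token sequence for an input `w` with running time `t` and output `u`. -/
def toks (r : ℕ) (w : List S) (t : ℕ) (u : List S) : List (CoTToken K Q S G) :=
  promptToks w ++ M.traceToks r w t ++ outputToks u

end TuringMachine

end CoT

/-! ## Register machines and their compilation to transformers -/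

/-! The residual stream is read as a bank of ternary registers at every position, and the
transformer as a fixed straight-line program on these banks; `compileTransformer` turns such a
program into weights. A ReLU neuron with input weights `±1` and bias `1` minus the number of its
inputs is a conjunction of literals, with value exactly `0` or `1` on ternary inputs. Numbers are
coded by `r` digits `±1`, so the scalar product of two of them is `r` exactly if they are equal;
hence a head can fetch registers from a position whose number is stored in registers
(`ptrHead_spec`). Hardmax averaging is harmless if all maximizers carry the same values
(`HeadSpec.Consistent`), which is verified for every head. As attention is causal, one family of
states on the complete sequence describes the computations on all its prefixes.

The next token depends on the state, which stands in the last run token, and on the symbols under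
the heads. The symbol in a cell is the one written there last. So every run token has to know the
cell which it wrote, and every query has to find the last position at which its cell was written.

Head positions: they are written out after every `r` steps. The token `</p>` collects the digits
through delay lines (`Trace.step_gather`). Then, in each of `r` layers, every run token takes the
head positions of its predecessor and moves them by one step. Since a run token is at most `r`
tokens away from the preceding `</inp>` or `</p>`, `r` layers suffice (`Trace.step_chain`).

Last write access: hardmax would average over all matching positions, so the number of the last one
is found digit by digit, beginning with the most significant digit (`searchHead_spec`). The score is
twice the match of contents, plus twice the agreement with the digits already known, plus the digit
in question. Because `r` is even, scores of contents are even, and no gain in the last digit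
outweighs a loss elsewhere. If the position found is no match, the cell was never written, and the
pointer is redirected to position `0`, where `<inp>` carries the blank. That this reproduces the
tape is `TuringMachine.tape_spec` together with `TuringMachine.st0_ptr`.

The remaining tasks are smaller. After `<outp>` the queried cell is the distance from `<outp>`,
computed by subtraction with borrow, one digit per chain layer; a blank there means the end of the
output. The delay lines also show where delimiters stand among the last `r` positions, which tells
when `<p>` and `</p>` are due and which digit comes next. The digits to be written are copied from
the last run token, found by pointer doubling. The transition function has one neuron per argument.

In the end the output registers contain the code of the next token (`TuringMachine.stFinal_eq`), and
this token wins the unembedding (`readout_lt`). A block of `r` steps takes `2r + 2` tokens, so the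
sequence has linear length, and `r` logarithmic in the running time gives the asymptotic form. -/

section Registers

variable {ι : Type*}

/-- A threshold neuron which is active if all registers in `pos` are `1` and all in `neg` are `-1`,
and which then increments the registers in `inc` and decrements those in `dec`. -/
structure Gate (ι : Type*) where
  pos : Finset ι
  neg : Finset ι
  inc : Finset ι
  dec : Finset ι

/-- Membership in `{-1, 0, 1}` for integers. -/
def Tern (a : ℤ) : Prop := a = -1 ∨ a = 0 ∨ a = 1

theorem Tern.cast {a : ℤ} (h : Tern a) : IsTernary (a : ℝ) := by
  rcases h with rfl | rfl | rfl <;> simp [IsTernary]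

theorem tern_iff {a : ℤ} : Tern a ↔ -1 ≤ a ∧ a ≤ 1 := by
  unfold Tern; omega

@[simp] theorem tern_zero : Tern 0 := by simp [Tern]
@[simp] theorem tern_one : Tern 1 := by simp [Tern]

@[simp] theorem tern_neg {a : ℤ} : Tern (-a) ↔ Tern a := by
  unfold Tern; omega

@[simp] theorem tern_unit (u : ℤˣ) : Tern (u : ℤ) := by
  rcases Int.units_eq_one_or u with rfl | rfl <;> simp

/-- All registers in `P` have the value `v`. -/
def AllEq (P : Finset ι) (x : ι → ℤ) (v : ℤ) : Prop := ∀ c ∈ P, x c = v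

@[simp] theorem allEq_empty (x : ι → ℤ) (v : ℤ) : AllEq ∅ x v := by simp [AllEq]

@[simp] theorem allEq_singleton (a : ι) (x : ι → ℤ) (v : ℤ) : AllEq {a} x v ↔ x a = v := by
  simp [AllEq]

@[simp] theorem allEq_insert [DecidableEq ι] (a : ι) (P : Finset ι) (x : ι → ℤ) (v : ℤ) :
    AllEq (insert a P) x v ↔ x a = v ∧ AllEq P x v := Finset.forall_mem_insert ..

@[simp] theorem allEq_union [DecidableEq ι] (P Q : Finset ι) (x : ι → ℤ) (v : ℤ) :
    AllEq (P ∪ Q) x v ↔ AllEq P x v ∧ AllEq Q x v := Finset.forall_mem_union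

@[simp] theorem allEq_image_univ [DecidableEq ι] {α : Type*} [Fintype α] (f : α → ι) (x : ι → ℤ)
    (v : ℤ) : AllEq (Finset.univ.image f) x v ↔ ∀ a, x (f a) = v := by simp [AllEq]

def Gate.Fires (g : Gate ι) (x : ι → ℤ) : Prop := AllEq g.pos x 1 ∧ AllEq g.neg x (-1)

open Classical in
noncomputable def Gate.effect (g : Gate ι) (c : ι) : ℤ :=
  (if c ∈ g.inc then 1 else 0) - (if c ∈ g.dec then 1 else 0)

open Classical in
/-- Total change of the register `c` by a list of neurons. -/
noncomputable def gateSum (gs : List (Gate ι)) (x : ι → ℤ) (c : ι) : ℤ :=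
  (gs.map fun g => if g.Fires x then g.effect c else 0).sum

@[simp] theorem gateSum_nil (x : ι → ℤ) (c : ι) : gateSum [] x c = 0 := by simp [gateSum]

open Classical in
theorem gateSum_cons (g : Gate ι) (gs : List (Gate ι)) (x : ι → ℤ) (c : ι) :
    gateSum (g :: gs) x c = (if g.Fires x then g.effect c else 0) + gateSum gs x c := by
  simp [gateSum]

@[simp] theorem gateSum_append (gs gs' : List (Gate ι)) (x : ι → ℤ) (c : ι) :
    gateSum (gs ++ gs') x c = gateSum gs x c + gateSum gs' x c := by
  simp [gateSum]

theorem gateSum_flatMap {α : Type*} (l : List α) (f : α → List (Gate ι)) (x : ι → ℤ) (c : ι) :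
    gateSum (l.flatMap f) x c = (l.map fun a => gateSum (f a) x c).sum := by
  induction l with
  | nil => simp
  | cons a l ih => simp [ih]

theorem sum_map_finRange {M : Type*} [AddCommMonoid M] {m : ℕ} (f : Fin m → M) :
    ((List.finRange m).map f).sum = ∑ i, f i := by
  rw [← List.ofFn_eq_map, List.sum_ofFn]

theorem gateSum_flatMap_finRange {m : ℕ} (f : Fin m → List (Gate ι)) (x : ι → ℤ) (c : ι) :
    gateSum ((List.finRange m).flatMap f) x c = ∑ a, gateSum (f a) x c := by
  rw [gateSum_flatMap, sum_map_finRange]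

open Classical in
/-- The value which arrives in register `c` if the contents `y` are copied along the list `l` of
pairs (source, target). -/
noncomputable def route (l : List (ι × ι)) (y : ι → ℤ) (c : ι) : ℤ :=
  (l.map fun p => if c = p.2 then y p.1 else 0).sum

@[simp] theorem route_nil (y : ι → ℤ) (c : ι) : route [] y c = 0 := by simp [route]

open Classical in
@[simp] theorem route_cons (p : ι × ι) (l : List (ι × ι)) (y : ι → ℤ) (c : ι) :
    route (p :: l) y c = (if c = p.2 then y p.1 else 0) + route l y c := by
  simp [route]

@[simp] theorem route_append (l l' : List (ι × ι)) (y : ι → ℤ) (c : ι) :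
    route (l ++ l') y c = route l y c + route l' y c := by simp [route]

theorem route_flatMap {m : ℕ} (f : Fin m → List (ι × ι)) (y : ι → ℤ) (c : ι) :
    route ((List.finRange m).flatMap f) y c = ∑ a, route (f a) y c := by
  rw [← sum_map_finRange]
  induction List.finRange m with
  | nil => simp
  | cons a l ih => simp [ih]

open Classical in
theorem route_map {m : ℕ} (f : Fin m → ι × ι) (y : ι → ℤ) (c : ι) :
    route ((List.finRange m).map f) y c = ∑ a, if c = (f a).2 then y (f a).1 else 0 := by
  rw [route, List.map_map, ← sum_map_finRange]; rfl

theorem route_eq_zero {l : List (ι × ι)} {c : ι} (hc : c ∉ l.map Prod.snd) (y : ι → ℤ) :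
    route l y c = 0 := by
  induction l with
  | nil => simp
  | cons p l ih =>
    simp only [List.map_cons, List.mem_cons, not_or] at hc
    rw [route_cons, if_neg hc.1, ih hc.2, add_zero]

/-- Distinct targets let at most one value arrive in each register. This is why `Fits` asks for
`nodup`: it makes the output of a single head ternary. -/
theorem tern_route {l : List (ι × ι)} (hl : (l.map Prod.snd).Nodup) {y : ι → ℤ}
    (hy : ∀ c, Tern (y c)) (c : ι) : Tern (route l y c) := by
  induction l with
  | nil => simp
  | cons p l ih =>
    simp only [List.map_cons, List.nodup_cons] at hl
    rw [route_cons]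
    split_ifs with h
    · rw [route_eq_zero (h ▸ hl.1), add_zero]; exact hy _
    · rw [zero_add]; exact ih hl.2

/-- An attention head: list of pairs (query register, key register), list of pairs (value register,
output register), and the sign of the output. -/
structure HeadSpec (ι : Type*) where
  qk : List (ι × ι)
  vo : List (ι × ι)
  neg : Bool := false

namespace HeadSpec

variable (h : HeadSpec ι) (S : ℕ → ι → ℤ)

def score (i j : ℕ) : ℤ := (h.qk.map fun p => S i p.1 * S j p.2).sum

/-- `j` is the last position `≤ i` of maximal score. -/
def IsLastMax (i j : ℕ) : Prop :=
  j ≤ i ∧ (∀ l ≤ i, h.score S i l ≤ h.score S i j) ∧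
    ∀ l ≤ i, j < l → h.score S i l < h.score S i j

/-- Maximize the pair (score, position) lexicographically. -/
theorem exists_isLastMax (i : ℕ) : ∃ j, h.IsLastMax S i j := by
  obtain ⟨j, hj, hmax⟩ := Finset.exists_max_image (Finset.range (i + 1))
    (fun j => toLex (h.score S i j, j)) ⟨0, by simp⟩
  simp only [Finset.mem_range, Nat.lt_succ_iff] at hj hmax
  refine ⟨j, hj, fun l hl => ?_, fun l hl hjl => ?_⟩ <;>
    (have := hmax l hl; rw [Prod.Lex.toLex_le_toLex] at this; simp only at this; omega)

variable {h S} in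
theorem IsLastMax.unique {i j j' : ℕ} (hj : h.IsLastMax S i j) (hj' : h.IsLastMax S i j') :
    j = j' := by
  rcases lt_trichotomy j j' with hlt | rfl | hlt
  · exact absurd (hj.2.2 j' hj'.1 hlt) (not_lt.2 (hj'.2.1 j hj.1))
  · rfl
  · exact absurd (hj'.2.2 j hj.1 hlt) (not_lt.2 (hj.2.1 j' hj'.1))

/-- The last position of maximal score. -/
noncomputable def att (i : ℕ) : ℕ := (h.exists_isLastMax S i).choose

theorem att_spec (i : ℕ) : h.IsLastMax S i (h.att S i) := (h.exists_isLastMax S i).choose_spec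

variable {h S} in
theorem IsLastMax.att_eq {i j : ℕ} (hj : h.IsLastMax S i j) : h.att S i = j :=
  (h.att_spec S i).unique hj

theorem att_le (i : ℕ) : h.att S i ≤ i := (h.att_spec S i).1

/-- All positions of maximal score have the same values. -/
def Consistent (i : ℕ) : Prop :=
  ∀ l ≤ i, h.score S i l = h.score S i (h.att S i) → ∀ p ∈ h.vo, S l p.1 = S (h.att S i) p.1

/-- The average over the maximizers is replaced by the value at the last of them; under `Consistent`
the two coincide. -/
noncomputable def read (i : ℕ) (c : ι) : ℤ :=
  (if h.neg then -1 else 1) * route h.vo (S (h.att S i)) c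

end HeadSpec

structure LayerSpec (ι : Type*) where
  heads : List (HeadSpec ι)
  gates : List (Gate ι)

namespace LayerSpec

variable (l : LayerSpec ι)

noncomputable def attn (S : ℕ → ι → ℤ) (i : ℕ) (c : ι) : ℤ :=
  (l.heads.map fun h => h.read S i c).sum

/-- The layer `l` maps `S` to `S'` on the positions `< n`, with ternary activations. -/
structure Step (n : ℕ) (S S' : ℕ → ι → ℤ) : Prop where
  consistent : ∀ i < n, ∀ h ∈ l.heads, h.Consistent S i
  tern_attn : ∀ i < n, ∀ c, Tern (l.attn S i c)
  tern_mid : ∀ i < n, ∀ c, Tern (S i c + l.attn S i c)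
  tern : ∀ i < n, ∀ c, Tern (S' i c)
  eq : ∀ i < n, ∀ c,
    S' i c = S i c + l.attn S i c + gateSum l.gates (fun c => S i c + l.attn S i c) c

theorem Step.congr {l : LayerSpec ι} {n : ℕ} {S S' S'' : ℕ → ι → ℤ} (h : l.Step n S S')
    (hS : ∀ i < n, ∀ c, S' i c = S'' i c) : l.Step n S S'' :=
  ⟨h.1, h.2, h.3, fun i hi c => hS i hi c ▸ h.4 i hi c, fun i hi c => hS i hi c ▸ h.5 i hi c⟩

/-- Size bounds of a layer. -/
structure Fits (d_ff d_k d_v H : ℕ) : Prop where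
  gates : l.gates.length ≤ d_ff
  heads : l.heads.length ≤ H
  qk : ∀ h ∈ l.heads, h.qk.length ≤ d_k
  vo : ∀ h ∈ l.heads, h.vo.length ≤ d_v
  nodup : ∀ h ∈ l.heads, (h.vo.map Prod.snd).Nodup

end LayerSpec

/-- The sequence of layers maps `S` to `S'`. -/
def Runs (n : ℕ) : List (LayerSpec ι) → (ℕ → ι → ℤ) → (ℕ → ι → ℤ) → Prop
  | [], S, S' => S = S'
  | l :: ls, S, S' => ∃ S₁, l.Step n S S₁ ∧ Runs n ls S₁ S'

theorem Runs.append {n : ℕ} {ls ls' : List (LayerSpec ι)} {S S' S'' : ℕ → ι → ℤ}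
    (h : Runs n ls S S') (h' : Runs n ls' S' S'') : Runs n (ls ++ ls') S S'' := by
  induction ls generalizing S with
  | nil => cases h; exact h'
  | cons l ls ih => obtain ⟨S₁, h₁, h₂⟩ := h; exact ⟨S₁, h₁, ih h₂⟩

theorem Runs.single {n : ℕ} {l : LayerSpec ι} {S S' : ℕ → ι → ℤ} (h : l.Step n S S') :
    Runs n [l] S S' := ⟨S', h, rfl⟩

theorem Runs.range {n m : ℕ} {l : ℕ → LayerSpec ι} {S : ℕ → ℕ → ι → ℤ}
    (h : ∀ e < m, (l e).Step n (S e) (S (e + 1))) :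
    Runs n ((List.range m).map l) (S 0) (S m) := by
  induction m with
  | zero => rfl
  | succ m ih =>
    rw [List.range_succ, List.map_append]
    exact (ih fun e he => h e (by omega)).append (Runs.single (h m (by omega)))

theorem Runs.exists_states {n : ℕ} {ls : List (LayerSpec ι)} {S S' : ℕ → ι → ℤ}
    (h : Runs n ls S S') : ∃ X : ℕ → ℕ → ι → ℤ, X 0 = S ∧ X ls.length = S' ∧
      ∀ (j : ℕ) (hj : j < ls.length), (ls[j]).Step n (X j) (X (j + 1)) := by
  induction ls generalizing S with
  | nil => exact ⟨fun _ => S, rfl, h, by simp⟩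
  | cons l ls ih =>
    obtain ⟨S₁, h₁, h₂⟩ := h
    obtain ⟨X, hX0, hX1, hX⟩ := ih h₂
    refine ⟨fun j => match j with | 0 => S | j + 1 => X j, rfl, hX1, ?_⟩
    rintro (_ | j) hj
    · simpa [hX0] using h₁
    · simpa using hX j (by simpa using hj)

/-! ### Compilation -/

section Compile

variable {d dff dk dv H : ℕ} (e : ι ↪ Fin d)

/-- The vector with the registers `y`. -/
noncomputable def toVec (y : ι → ℤ) : Fin d → ℝ := Function.extend e (fun c => (y c : ℝ)) 0

@[simp] theorem toVec_apply (y : ι → ℤ) (c : ι) : toVec e y (e c) = y c :=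
  e.injective.extend_apply _ _ _

theorem toVec_of_notMem (y : ι → ℤ) {c : Fin d} (hc : c ∉ Set.range e) : toVec e y c = 0 :=
  Function.extend_apply' _ _ _ (by simpa using hc)

theorem toVec_cases (c : Fin d) : (∃ b, e b = c) ∨ c ∉ Set.range e :=
  (em (c ∈ Set.range e)).imp_left id

theorem toVec_tern {y : ι → ℤ} (hy : ∀ c, Tern (y c)) (c : Fin d) : IsTernary (toVec e y c) := by
  rcases toVec_cases e c with ⟨c, rfl⟩ | hc
  · rw [toVec_apply]; exact (hy c).cast
  · rw [toVec_of_notMem e y hc]; simp [IsTernary]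

/-- Specifications are padded with zeros up to the prescribed dimensions, so that their sizes need
only be bounded. -/
theorem sum_getElem?_elim {α M : Type*} [AddCommMonoid M] {m : ℕ} (l : List α) (hl : l.length ≤ m)
    (f : α → M) : ∑ a : Fin m, (l[(a : ℕ)]?).elim 0 f = (l.map f).sum := by
  rw [Fin.sum_univ_eq_sum_range (fun a => (l[a]?).elim 0 f) m]
  rw [← Finset.sum_subset (Finset.range_subset_range.2 hl)]
  · induction l with
    | nil => simp
    | cons a l ih =>
      rw [List.length_cons, Finset.sum_range_succ', List.map_cons, List.sum_cons, add_comm]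
      simp only [List.getElem?_cons_succ, List.getElem?_cons_zero, Option.elim_some]
      rw [ih (by simp at hl; omega)]
  · intro a _ ha
    rw [List.getElem?_eq_none (by simpa using ha)]; rfl

/-- Rows which are unit vectors. -/
noncomputable def selectRow (o : Option ι) : Fin d → ℝ := o.elim 0 fun c => Pi.single (e c) 1

theorem selectRow_tern (o : Option ι) (c : Fin d) : IsTernary (selectRow e o c) := by
  cases o with
  | none => simp [selectRow, IsTernary]
  | some a => by_cases h : c = e a <;> simp [selectRow, IsTernary, h]

theorem selectRow_dotProduct (o : Option ι) (x : Fin d → ℝ) :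
    selectRow e o ⬝ᵥ x = o.elim 0 fun c => x (e c) := by
  cases o <;> simp [selectRow]

noncomputable def HeadSpec.compile (h : HeadSpec ι) : AttentionHead d dk dv where
  WQ a := selectRow e ((h.qk[(a : ℕ)]?).map Prod.fst)
  WK a := selectRow e ((h.qk[(a : ℕ)]?).map Prod.snd)
  WV a := selectRow e ((h.vo[(a : ℕ)]?).map Prod.fst)
  WO c a := (if h.neg then -1 else 1) * selectRow e ((h.vo[(a : ℕ)]?).map Prod.snd) c

/-- Rows which are differences of indicator vectors. -/
noncomputable def diffRow (p q : Finset ι) (c : Fin d) : ℝ :=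
  (if c ∈ p.map e then 1 else 0) - (if c ∈ q.map e then 1 else 0)

theorem diffRow_tern (p q : Finset ι) (c : Fin d) : IsTernary (diffRow e p q c) := by
  unfold diffRow IsTernary; split_ifs <;> simp

theorem diffRow_dotProduct (p q : Finset ι) (y : ι → ℤ) :
    diffRow e p q ⬝ᵥ toVec e y = ((∑ c ∈ p, y c - ∑ c ∈ q, y c : ℤ) : ℝ) := by
  have : ∀ s : Finset ι, ∑ c : Fin d, (if c ∈ s.map e then (1 : ℝ) else 0) * toVec e y c
      = ∑ c ∈ s, (y c : ℝ) := by
    intro s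
    simp only [ite_mul, one_mul, zero_mul, Finset.sum_ite_mem, Finset.univ_inter, Finset.sum_map,
      toVec_apply]
  simp only [dotProduct, diffRow, sub_mul, Finset.sum_sub_distrib, this]
  push_cast; rfl

noncomputable def compileGates (gs : List (Gate ι)) : ReLUNet d dff where
  W1 a := (gs[(a : ℕ)]?).elim 0 fun g => diffRow e g.pos g.neg
  b a := (gs[(a : ℕ)]?).elim 0 fun g => 1 - g.pos.card - g.neg.card
  W2 c a := (gs[(a : ℕ)]?).elim 0 fun g => diffRow e g.inc g.dec c

noncomputable def LayerSpec.compile (l : LayerSpec ι) : TransformerLayer d dff dk dv H where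
  head a := ((l.heads[(a : ℕ)]?).getD ⟨[], [], false⟩).compile e
  mlp := compileGates e l.gates

theorem sum_pos_neg_le (p : Finset ι) {y : ι → ℤ} (hy : ∀ c, y c ≤ 1) :
    ∑ c ∈ p, y c ≤ p.card ∧ (∑ c ∈ p, y c = p.card ↔ ∀ c ∈ p, y c = 1) := by
  have h1 : ∑ c ∈ p, y c ≤ ∑ c ∈ p, 1 := Finset.sum_le_sum fun c _ => hy c
  have h2 := Finset.sum_eq_sum_iff_of_le (s := p) (f := y) (g := fun _ => 1) fun c _ => hy c
  simp only [Finset.sum_const, nsmul_eq_mul, mul_one] at h1 h2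
  exact ⟨h1, h2⟩

-- The preactivation is an integer which is at most `1` on ternary registers, with equality only if
-- every literal holds; in all other cases ReLU gives `0`.
open Classical in
theorem hidden_compileGates (gs : List (Gate ι)) {y : ι → ℤ} (hy : ∀ c, Tern (y c)) (a : Fin dff) :
    (compileGates e gs).hidden (toVec e y) a =
      (gs[(a : ℕ)]?).elim 0 fun g => if g.Fires y then 1 else 0 := by
  simp only [ReLUNet.hidden, compileGates, Pi.add_apply, Matrix.mulVec]
  cases gs[(a : ℕ)]? with
  | none => simp
  | some g =>
    simp only [Option.elim_some, diffRow_dotProduct]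
    obtain ⟨h1, h2⟩ := sum_pos_neg_le g.pos (y := y) fun c => (tern_iff.1 (hy c)).2
    obtain ⟨h3, h4⟩ := sum_pos_neg_le g.neg (y := fun c => - y c) fun c => by
      have := (tern_iff.1 (hy c)).1; omega
    simp only [Finset.sum_neg_distrib] at h3 h4
    have h4' : -∑ c ∈ g.neg, y c = g.neg.card ↔ ∀ c ∈ g.neg, y c = -1 := by
      rw [h4]; exact forall₂_congr fun c _ => by omega
    by_cases hf : g.Fires y
    · rw [if_pos hf]
      have e1 := h2.2 hf.1
      have e2 := h4'.2 hf.2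
      have : (((∑ c ∈ g.pos, y c - ∑ c ∈ g.neg, y c : ℤ) : ℝ) + (1 - g.pos.card - g.neg.card))
          = 1 := by
        have : (∑ c ∈ g.pos, y c - ∑ c ∈ g.neg, y c : ℤ) = g.pos.card + g.neg.card := by omega
        rw [this]; push_cast; ring
      rw [this]; simp
    · rw [if_neg hf]
      apply max_eq_left
      have : (∑ c ∈ g.pos, y c - ∑ c ∈ g.neg, y c : ℤ) + (1 - g.pos.card - g.neg.card) ≤ 0 := by
        by_contra hc
        exact hf ⟨h2.1 (by omega), h4'.1 (by omega)⟩
      exact_mod_cast this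

open Classical in
theorem out_compileGates (gs : List (Gate ι)) (hgs : gs.length ≤ dff) {y : ι → ℤ}
    (hy : ∀ c, Tern (y c)) :
    (compileGates (dff := dff) e gs).out (toVec e y) = toVec e (gateSum gs y) := by
  funext c
  have key : ∀ a : Fin dff, (compileGates e gs).W2 c a * (compileGates e gs).hidden (toVec e y) a
      = (gs[(a : ℕ)]?).elim 0 fun g => if g.Fires y then diffRow e g.inc g.dec c else 0 := by
    intro a
    rw [hidden_compileGates e gs hy]
    simp only [compileGates]
    cases gs[(a : ℕ)]? <;> simp
  simp only [ReLUNet.out, Matrix.mulVec, dotProduct, key]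
  rw [sum_getElem?_elim gs hgs]
  rcases toVec_cases e c with ⟨c, rfl⟩ | hc
  · rw [toVec_apply, gateSum, Int.cast_list_sum, List.map_map]
    congr 1
    refine List.map_congr_left fun g _ => ?_
    simp only [Function.comp, diffRow, Gate.effect, Finset.mem_map', Int.cast_ite, Int.cast_sub]
    simp
  · rw [toVec_of_notMem e _ hc]
    have : ∀ s : Finset ι, c ∉ s.map e := fun s h => hc (by
      obtain ⟨b, _, rfl⟩ := Finset.mem_map.1 h; exact ⟨b, rfl⟩)
    simp [diffRow, this]

theorem elim_mul_elim {α : Type*} (o : Option α) (f g : α → ℝ) :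
    o.elim 0 f * o.elim 0 g = o.elim 0 fun a => f a * g a := by cases o <;> simp

theorem elim_map {α β γ : Type*} (o : Option α) (f : α → β) (g : β → γ) (z : γ) :
    (o.map f).elim z g = o.elim z fun a => g (f a) := by cases o <;> rfl

variable {m : ℕ} {S : ℕ → ι → ℤ}

theorem score_compile (h : HeadSpec ι) (hk : h.qk.length ≤ dk) {x : Fin m → Fin d → ℝ}
    (hx : ∀ i, x i = toVec e (S i)) (i j : Fin m) :
    (h.compile (dk := dk) (dv := dv) e).score x i j = 1 / Real.sqrt dk * h.score S i j := by
  have : ((h.compile (dk := dk) (dv := dv) e).query x i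
      ⬝ᵥ (h.compile (dk := dk) (dv := dv) e).key x j) = h.score S i j := by
    simp only [dotProduct, AttentionHead.query, AttentionHead.key, HeadSpec.compile, Matrix.mulVec]
    simp only [← dotProduct.eq_1, selectRow_dotProduct, elim_map, elim_mul_elim, hx, toVec_apply]
    rw [sum_getElem?_elim _ hk, HeadSpec.score, Int.cast_list_sum, List.map_map]
    congr 1
    exact List.map_congr_left fun p _ => by simp
  rw [AttentionHead.score, this]

theorem value_compile (h : HeadSpec ι) {x : Fin m → Fin d → ℝ}
    (hx : ∀ i, x i = toVec e (S i)) (j : Fin m) (a : Fin dv) :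
    (h.compile (dk := dk) e).value x j a
      = (h.vo[(a : ℕ)]?).elim 0 fun p => (S j p.1 : ℝ) := by
  simp only [AttentionHead.value, HeadSpec.compile, Matrix.mulVec, selectRow_dotProduct, elim_map,
    hx, toVec_apply]

/-- The factor `1 / √dk` is positive and does not affect the maximizers. By consistency all values
in the average are equal, and the weights sum to `1`. -/
theorem out_compile (h : HeadSpec ι) (hk : h.qk.length ≤ dk) (hv : h.vo.length ≤ dv)
    (hdk : 0 < dk) {x : Fin m → Fin d → ℝ}
    (hx : ∀ i, x i = toVec e (S i)) (i : Fin m) (hc : h.Consistent S i) :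
    (h.compile (dk := dk) (dv := dv) e).out x i = toVec e (h.read S i) := by
  classical
  set A := h.compile (dk := dk) (dv := dv) e with hA
  have hs := fun i j => score_compile (dv := dv) e h hk hx i j
  rw [← hA] at hs
  have hpos : 0 < 1 / Real.sqrt dk := by positivity
  have hlt : h.att S i < m := (h.att_le S i).trans_lt i.2
  have hle : ∀ j l : Fin m, A.score x i l ≤ A.score x i j ↔ h.score S i l ≤ h.score S i j := by
    intro j l
    rw [hs, hs, mul_le_mul_iff_right₀ hpos, Int.cast_le]
  have hmem : ∀ j, j ∈ A.argmaxSet x i ↔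
      (j : ℕ) ≤ i ∧ h.score S i j = h.score S i (h.att S i) := by
    intro j
    simp only [AttentionHead.argmaxSet, Finset.mem_filter, Finset.mem_Iic, hle]
    refine and_congr_right fun hj => ⟨fun H => le_antisymm ((h.att_spec S i).2.1 j hj) ?_,
      fun H l hl => ?_⟩
    · exact H ⟨_, hlt⟩ (h.att_le S i)
    · rw [H]; exact (h.att_spec S i).2.1 l hl
  have hne : (A.argmaxSet x i).card ≠ 0 :=
    Finset.card_ne_zero_of_mem ((hmem ⟨_, hlt⟩).2 ⟨h.att_le S i, rfl⟩)
  have hsum : ∑ j ∈ Finset.Iic i, A.weight x i j • A.value x j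
      = A.value x ⟨_, hlt⟩ := by
    have : ∀ j ∈ Finset.Iic i, A.weight x i j • A.value x j
        = A.weight x i j • A.value x ⟨_, hlt⟩ := by
      intro j _
      by_cases hj : j ∈ A.argmaxSet x i
      · congr 1
        funext a
        rw [value_compile e h hx, value_compile e h hx]
        cases hh : h.vo[(a : ℕ)]? with
        | none => rfl
        | some p =>
          obtain ⟨h1, h2⟩ := (hmem j).1 hj
          simp only [Option.elim_some]
          rw [hc j h1 h2 p (List.mem_of_getElem? hh)]
      · simp [AttentionHead.weight, hj]
    rw [Finset.sum_congr rfl this, ← Finset.sum_smul]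
    have : ∑ j ∈ Finset.Iic i, A.weight x i j = 1 := by
      simp only [AttentionHead.weight]
      rw [← Finset.sum_filter]
      have : Finset.filter (fun j => j ∈ A.argmaxSet x i) (Finset.Iic i) = A.argmaxSet x i := by
        ext j; simp only [Finset.mem_filter, Finset.mem_Iic, and_iff_right_iff_imp]
        exact fun hj => ((hmem j).1 hj).1
      rw [this, Finset.sum_const, nsmul_eq_mul]
      field_simp
    rw [this, one_smul]
  rw [AttentionHead.out, hsum]
  funext c
  have key : ∀ a : Fin dv, A.WO c a * A.value x ⟨_, hlt⟩ a = (h.vo[(a : ℕ)]?).elim 0 fun p =>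
      (if h.neg then -1 else 1) * ((Pi.single (e p.2) 1 : Fin d → ℝ) c * S (h.att S i) p.1) := by
    intro a
    rw [value_compile e h hx]
    simp only [hA, HeadSpec.compile, selectRow]
    cases h.vo[(a : ℕ)]? <;> simp
  simp only [Matrix.mulVec, dotProduct, key]
  rw [sum_getElem?_elim _ hv, List.sum_map_mul_left]
  rcases toVec_cases e c with ⟨c, rfl⟩ | hc
  · rw [toVec_apply, HeadSpec.read, route, Int.cast_mul, Int.cast_list_sum, List.map_map]
    congr 1
    · split_ifs <;> simp
    · congr 1
      refine List.map_congr_left fun p _ => ?_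
      by_cases hp : c = p.2 <;> simp [hp]
  · rw [toVec_of_notMem e _ hc]
    have : ∀ b, c ≠ e b := fun b hb => hc ⟨b, hb.symm⟩
    simp [this]

theorem HeadSpec.read_nil (S : ℕ → ι → ℤ) (i : ℕ) :
    (⟨[], [], false⟩ : HeadSpec ι).read S i = 0 := by
  funext c; simp [HeadSpec.read]

theorem toVec_zero : toVec e (fun _ : ι => (0 : ℤ)) = 0 := by
  funext c
  rcases toVec_cases e c with ⟨c, rfl⟩ | hc
  · simp
  · rw [toVec_of_notMem e _ hc]; rfl

theorem toVec_add (y z : ι → ℤ) : toVec e y + toVec e z = toVec e (fun c => y c + z c) := by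
  funext c
  rcases toVec_cases e c with ⟨c, rfl⟩ | hc
  · simp
  · simp [toVec_of_notMem e _ hc]

theorem toVec_list_sum {α : Type*} (l : List α) (f : α → ι → ℤ) :
    (l.map fun a => toVec e (f a)).sum = toVec e (fun c => (l.map fun a => f a c).sum) := by
  induction l with
  | nil => simpa using (toVec_zero e).symm
  | cons a l ih => simp only [List.map_cons, List.sum_cons, ih, toVec_add]

variable {n : ℕ} {S' : ℕ → ι → ℤ}

/-- Position `i` only reads from positions `≤ i`, so states on `n` positions also describe the layer
on each prefix of length `m ≤ n`. Unused heads are empty specifications with output `0`. -/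
theorem layer_out_head (l : LayerSpec ι) (hl : l.Fits dff dk dv H) (hdk : 0 < dk)
    (hm : m ≤ n) (hs : l.Step n S S') {x : Fin m → Fin d → ℝ}
    (hx : ∀ i, x i = toVec e (S i)) (i : Fin m) (a : Fin H) :
    ((l.compile (dff := dff) (dk := dk) (dv := dv) (H := H) e).head a).out x i =
      (l.heads[(a : ℕ)]?).elim 0 fun h => toVec e (h.read S i) := by
  simp only [LayerSpec.compile]
  cases hh : l.heads[(a : ℕ)]? with
  | none =>
    rw [Option.getD_none, out_compile e _ (by simp) (by simp) hdk hx i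
      (by simp [HeadSpec.Consistent]), HeadSpec.read_nil]
    exact toVec_zero e
  | some h =>
    have hmem := List.mem_of_getElem? hh
    exact out_compile e h (hl.qk h hmem) (hl.vo h hmem) hdk hx i
      (hs.consistent i (i.2.trans_le hm) h hmem)

theorem layer_attn (l : LayerSpec ι) (hl : l.Fits dff dk dv H) (hdk : 0 < dk)
    (hm : m ≤ n) (hs : l.Step n S S') {x : Fin m → Fin d → ℝ}
    (hx : ∀ i, x i = toVec e (S i)) (i : Fin m) :
    (l.compile (dff := dff) (dk := dk) (dv := dv) (H := H) e).attn x i = toVec e (l.attn S i) := by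
  simp only [TransformerLayer.attn, layer_out_head e l hl hdk hm hs hx i]
  rw [sum_getElem?_elim _ hl.heads, toVec_list_sum]; rfl

theorem layer_mid (l : LayerSpec ι) (hl : l.Fits dff dk dv H) (hdk : 0 < dk)
    (hm : m ≤ n) (hs : l.Step n S S') {x : Fin m → Fin d → ℝ}
    (hx : ∀ i, x i = toVec e (S i)) (i : Fin m) :
    (l.compile (dff := dff) (dk := dk) (dv := dv) (H := H) e).mid x i
      = toVec e (fun c => S i c + l.attn S i c) := by
  rw [TransformerLayer.mid, layer_attn e l hl hdk hm hs hx, hx, toVec_add]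

theorem layer_out (l : LayerSpec ι) (hl : l.Fits dff dk dv H) (hdk : 0 < dk)
    (hm : m ≤ n) (hs : l.Step n S S') {x : Fin m → Fin d → ℝ}
    (hx : ∀ i, x i = toVec e (S i)) (i : Fin m) :
    (l.compile (dff := dff) (dk := dk) (dv := dv) (H := H) e).out x i = toVec e (S' i) := by
  have hi := i.2.trans_le hm
  rw [TransformerLayer.out, layer_mid e l hl hdk hm hs hx]
  simp only [LayerSpec.compile]
  rw [out_compileGates e _ hl.gates (hs.tern_mid i hi), toVec_add]
  congr 1
  funext c
  exact (hs.eq i hi c).symm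

end Compile

/-! ### Compilation of complete transformers -/

section CompileTransformer

variable {V : Type*} {r d dff dk dv H L : ℕ} (e : ι ↪ Fin d) (p : Fin r ↪ ι)

/-- The transformer given by a list of layers, an embedding, an unembedding and the position
registers `p`. -/
noncomputable def compileTransformer (ls : List (LayerSpec ι)) (emb unemb : V → ι → ℤ) :
    Transformer d dff dk dv H L r V where
  layer a := ((ls[(a : ℕ)]?).getD ⟨[], []⟩).compile e
  emb v := toVec e (emb v)
  unemb v := toVec e (unemb v)
  posCoord := p.trans e

variable (ls : List (LayerSpec ι)) (emb unemb : V → ι → ℤ)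

theorem compileTransformer_ternaryWeights (hemb : ∀ v c, Tern (emb v c))
    (hunemb : ∀ v c, Tern (unemb v c)) :
    (compileTransformer (dff := dff) (dk := dk) (dv := dv) (H := H) (L := L) e p ls emb
      unemb).TernaryWeights := by
  have hz : IsTernary 0 := by simp [IsTernary]
  refine ⟨fun v c => toVec_tern e (hemb v) c, fun v c => toVec_tern e (hunemb v) c, fun ℓ =>
    ⟨fun h => ⟨fun a c => selectRow_tern e _ c, fun a c => selectRow_tern e _ c,
      fun a c => selectRow_tern e _ c, fun c a => ?_⟩, fun a c => ?_, fun c a => ?_⟩⟩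
  · simp only [compileTransformer, LayerSpec.compile, HeadSpec.compile]
    have := selectRow_tern e ((((((ls[(ℓ : ℕ)]?).getD ⟨[], []⟩).heads[(h : ℕ)]?).getD
      ⟨[], [], false⟩).vo[(a : ℕ)]?).map Prod.snd) c
    unfold IsTernary at *
    split_ifs
    · rcases this with h | h | h <;> rw [h] <;> simp
    · simpa using this
  · simp only [compileTransformer, LayerSpec.compile, compileGates]
    cases ((ls[(ℓ : ℕ)]?).getD ⟨[], []⟩).gates[(a : ℕ)]? with
    | none => exact hz
    | some g => exact diffRow_tern e _ _ _
  · simp only [compileTransformer, LayerSpec.compile, compileGates]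
    cases ((ls[(ℓ : ℕ)]?).getD ⟨[], []⟩).gates[(a : ℕ)]? with
    | none => exact hz
    | some g => exact diffRow_tern e _ _ _

theorem posemb_compileTransformer (i : ℕ) (y : ι → ℤ) (hy : ∀ s, y (p s) = (signBit s i : ℤ))
    (hy' : ∀ c ∉ Set.range p, y c = 0) :
    (compileTransformer (dff := dff) (dk := dk) (dv := dv) (H := H) (L := L) e p ls emb
      unemb).posemb i = toVec e y := by
  funext c
  have : (p.trans e : Fin r → Fin d) = e ∘ p := rfl
  simp only [Transformer.posemb, compileTransformer]
  rcases toVec_cases e c with ⟨c, rfl⟩ | hc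
  · rw [toVec_apply]
    by_cases hc : c ∈ Set.range p
    · obtain ⟨s, rfl⟩ := hc
      rw [hy s]
      exact (p.trans e).injective.extend_apply _ _ s
    · rw [hy' c hc, Function.extend_apply']
      · simp
      · rintro ⟨s, hs⟩
        exact hc ⟨s, e.injective hs⟩
  · rw [toVec_of_notMem e _ hc, Function.extend_apply']
    · rfl
    · rintro ⟨s, hs⟩
      exact hc ⟨p s, hs⟩

variable {n : ℕ} {S₀ S' : ℕ → ι → ℤ} {ls emb}

/-- The same states `X` can be used for all prefixes of a generated sequence. -/
theorem rep_compileTransformer {X : ℕ → ℕ → ι → ℤ} (hL : ls.length = L) (hdk : 0 < dk)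
    (hfit : ∀ l ∈ ls, l.Fits dff dk dv H)
    (hstep : ∀ (j : ℕ) (hj : j < ls.length), (ls[j]).Step n (X j) (X (j + 1)))
    (τ : List V) (hτ : τ.length ≤ n) (hX : ∀ i : Fin τ.length,
      toVec e (emb (τ.get i)) + (compileTransformer (dff := dff) (dk := dk) (dv := dv) (H := H)
        (L := L) e p ls emb unemb).posemb i = toVec e (X 0 i)) :
    ∀ j ≤ L, ∀ i, (compileTransformer (dff := dff) (dk := dk) (dv := dv) (H := H) (L := L) e p ls
      emb unemb).rep τ j i = toVec e (X j i) := by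
  intro j
  induction j with
  | zero => intro _ i; exact hX i
  | succ j ih =>
    intro hj i
    have hj' : j < L := by omega
    rw [Transformer.rep, dif_pos hj']
    have hl : ls[j]? = some ls[j] := List.getElem?_eq_getElem (by omega)
    have : (compileTransformer (dff := dff) (dk := dk) (dv := dv) (H := H) (L := L) e p ls
      emb unemb).layer ⟨j, hj'⟩ = (ls[j]).compile e := by
      simp only [compileTransformer, hl, Option.getD_some]
    rw [this]
    exact layer_out e _ (hfit _ (List.getElem_mem _)) hdk hτ (hstep j (by omega)) (ih (by omega)) i

theorem ternaryActivations_compileTransformer {X : ℕ → ℕ → ι → ℤ} (hL : ls.length = L)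
    (hdk : 0 < dk) (hfit : ∀ l ∈ ls, l.Fits dff dk dv H)
    (hstep : ∀ (j : ℕ) (hj : j < ls.length), (ls[j]).Step n (X j) (X (j + 1)))
    (hX0 : ∀ i < n, ∀ c, Tern (X 0 i c))
    (τ : List V) (hτ : τ.length ≤ n) (hX : ∀ i : Fin τ.length,
      toVec e (emb (τ.get i)) + (compileTransformer (dff := dff) (dk := dk) (dv := dv) (H := H)
        (L := L) e p ls emb unemb).posemb i = toVec e (X 0 i)) :
    (compileTransformer (dff := dff) (dk := dk) (dv := dv) (H := H) (L := L) e p ls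
      emb unemb).TernaryActivations τ := by
  classical
  have hrep := rep_compileTransformer (unemb := unemb) e p hL hdk hfit hstep τ hτ hX
  have hXt : ∀ j ≤ L, ∀ i < n, ∀ c, Tern (X j i c) := by
    rintro (_ | j) hj i hi c
    · exact hX0 i hi c
    · exact (hstep j (by omega)).tern i hi c
  have hz : IsTernary 0 := by simp [IsTernary]
  refine ⟨fun j hj i c => ?_, fun j i => ?_⟩
  · rw [hrep j hj]
    exact toVec_tern e (hXt j hj i (i.2.trans_le hτ)) c
  · have hi := i.2.trans_le hτ
    have hl : ls[(j : ℕ)]? = some (ls[(j : ℕ)]'(by omega)) := List.getElem?_eq_getElem (by omega)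
    have hlay : (compileTransformer (dff := dff) (dk := dk) (dv := dv) (H := H) (L := L) e p ls
      emb unemb).layer j = (ls[(j : ℕ)]'(by omega)).compile e := by
      simp only [compileTransformer, hl, Option.getD_some]
    have hs := hstep j (by omega)
    have hf := hfit _ (List.getElem_mem (l := ls) (n := j) (by omega))
    have hx := hrep j j.2.le
    rw [hlay]
    set l := ls[(j : ℕ)]'(by omega)
    have hel : ∀ (c : Option ι) , IsTernary (c.elim 0 fun c => toVec e (X j i) (e c)) := by
      intro c
      cases c with
      | none => exact hz
      | some c => exact toVec_tern e (hXt j j.2.le i hi) _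
    refine ⟨fun c => ?_, fun c => ?_, fun a => ?_, fun h => ⟨fun a => ?_, fun a => ?_, fun a => ?_,
      fun c => ?_⟩⟩
    · rw [layer_mid e l hf hdk hτ hs hx]
      exact toVec_tern e (hs.tern_mid i hi) c
    · rw [layer_attn e l hf hdk hτ hs hx]
      exact toVec_tern e (hs.tern_attn i hi) c
    · rw [layer_mid e l hf hdk hτ hs hx]
      simp only [LayerSpec.compile]
      rw [hidden_compileGates e _ (hs.tern_mid i hi)]
      cases l.gates[(a : ℕ)]? with
      | none => exact hz
      | some g => simp only [Option.elim_some]; split_ifs <;> simp [IsTernary]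
    · simp only [AttentionHead.query, LayerSpec.compile, HeadSpec.compile, Matrix.mulVec,
        selectRow_dotProduct, hx]
      exact hel _
    · simp only [AttentionHead.key, LayerSpec.compile, HeadSpec.compile, Matrix.mulVec,
        selectRow_dotProduct, hx]
      exact hel _
    · simp only [AttentionHead.value, LayerSpec.compile, HeadSpec.compile, Matrix.mulVec,
        selectRow_dotProduct, hx]
      exact hel _
    · rw [layer_out_head e l hf hdk hτ hs hx]
      cases hh : l.heads[(h : ℕ)]? with
      | none => exact hz
      | some g =>
        refine toVec_tern e (fun c => ?_) c
        rw [HeadSpec.read]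
        have := tern_route (hf.nodup g (List.mem_of_getElem? hh))
          (hXt j j.2.le _ ((g.att_le (X j) i).trans_lt hi)) c
        split_ifs <;> simpa using this

theorem toVec_dotProduct [Fintype ι] (y z : ι → ℤ) :
    toVec e y ⬝ᵥ toVec e z = ((∑ c, y c * z c : ℤ) : ℝ) := by
  rw [dotProduct, ← Finset.sum_subset (Finset.subset_univ (Finset.univ.map e))]
  · simp
  · intro c _ hc
    rw [toVec_of_notMem e y (by simpa using hc), zero_mul]

end CompileTransformer

end Registers

/-! ### Signed binary digits -/

section Bits

/-- The `s`-th binary digit of `n`, coded by `±1`. -/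
def bitSign (s n : ℕ) : ℤ := (signBit s n : ℤ)

theorem bitSign_eq (s n : ℕ) : bitSign s n = 2 * ((n / 2 ^ s % 2 : ℕ) : ℤ) - 1 := by
  unfold bitSign signBit
  have := Nat.mod_lt (n / 2 ^ s) (show 0 < 2 by norm_num)
  split_ifs with h
  · rw [h]; norm_num
  · have h : n / 2 ^ s % 2 = 0 := by omega
    rw [h]; norm_num

theorem bitSign_cases (s n : ℕ) : bitSign s n = 1 ∨ bitSign s n = -1 := by
  rw [bitSign_eq]; omega

@[simp] theorem tern_bitSign (s n : ℕ) : Tern (bitSign s n) := by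
  rcases bitSign_cases s n with h | h <;> rw [h] <;> simp

@[simp] theorem bitSign_zero (s : ℕ) : bitSign s 0 = -1 := by simp [bitSign_eq]

/-- The digits of `n` below `s` are all equal to `v`. -/
def LowBits (s n : ℕ) (v : ℤ) : Prop := ∀ a < s, bitSign a n = v

theorem lowBits_one_iff (s n : ℕ) :
    LowBits s n 1 ↔ n % 2 ^ s = 2 ^ s - 1 := by
  unfold LowBits
  induction s with
  | zero => simp [Nat.mod_one]
  | succ s ih =>
    rw [Nat.forall_lt_succ_right, ih, bitSign_eq, Nat.mod_pow_succ, pow_succ]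
    have h1 := Nat.mod_lt n (show 0 < 2 ^ s by positivity)
    have h2 := Nat.mod_lt (n / 2 ^ s) (show 0 < 2 by norm_num)
    have : n / 2 ^ s % 2 = 0 ∨ n / 2 ^ s % 2 = 1 := by omega
    rcases this with h | h <;> rw [h] <;> omega

theorem lowBits_neg_one_iff (s n : ℕ) :
    LowBits s n (-1) ↔ n % 2 ^ s = 0 := by
  unfold LowBits
  induction s with
  | zero => simp [Nat.mod_one]
  | succ s ih =>
    rw [Nat.forall_lt_succ_right, ih, bitSign_eq, Nat.mod_pow_succ]
    have h1 := Nat.mod_lt n (show 0 < 2 ^ s by positivity)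
    have h2 := Nat.mod_lt (n / 2 ^ s) (show 0 < 2 by norm_num)
    have : n / 2 ^ s % 2 = 0 ∨ n / 2 ^ s % 2 = 1 := by omega
    rcases this with h | h <;> rw [h] <;> omega

theorem mod_eq_of_bitSign_eq {r a b : ℕ} (h : ∀ s < r, bitSign s a = bitSign s b) :
    a % 2 ^ r = b % 2 ^ r := by
  induction r with
  | zero => simp [Nat.mod_one]
  | succ r ih =>
    have h1 := h r (by omega)
    rw [bitSign_eq, bitSign_eq] at h1
    rw [Nat.mod_pow_succ, Nat.mod_pow_succ, ih fun s hs => h s (by omega)]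
    congr 2
    omega

theorem eq_of_bitSign_eq {r a b : ℕ} (ha : a < 2 ^ r) (hb : b < 2 ^ r)
    (h : ∀ s < r, bitSign s a = bitSign s b) : a = b := by
  have := mod_eq_of_bitSign_eq h
  rwa [Nat.mod_eq_of_lt ha, Nat.mod_eq_of_lt hb] at this

theorem succ_div_pow (s n : ℕ) :
    (n + 1) / 2 ^ s = if n % 2 ^ s = 2 ^ s - 1 then n / 2 ^ s + 1 else n / 2 ^ s := by
  have hp : 0 < 2 ^ s := by positivity
  rw [Nat.succ_div]
  have : 2 ^ s ∣ n + 1 ↔ n % 2 ^ s = 2 ^ s - 1 := by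
    rw [Nat.dvd_iff_mod_eq_zero, Nat.add_mod]
    have h1 := Nat.mod_lt n hp
    by_cases hs : 2 ^ s = 1
    · simp [hs, Nat.mod_one]
    · rw [Nat.mod_eq_of_lt (show 1 < 2 ^ s by omega)]
      constructor
      · intro h
        by_contra hne
        rw [Nat.mod_eq_of_lt (by omega)] at h
        omega
      · intro h
        rw [h, Nat.sub_add_cancel hp, Nat.mod_self]
  simp only [this]
  split_ifs <;> simp

-- A carry reaches a digit exactly if all lower digits are `1`.
open Classical in
theorem bitSign_succ (s n : ℕ) :
    bitSign s (n + 1) = if LowBits s n 1 then -bitSign s n else bitSign s n := by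
  rw [if_congr (lowBits_one_iff s n) rfl rfl]
  simp only [bitSign_eq, succ_div_pow]
  split_ifs <;> omega

-- The lower digits of `m + 1` are all `-1` exactly if those of `m` are all `1`, so this is
-- `bitSign_succ` read backwards.
open Classical in
theorem bitSign_pred (s n : ℕ) (hn : n ≠ 0) :
    bitSign s (n - 1) = if LowBits s n (-1) then -bitSign s n else bitSign s n := by
  obtain ⟨m, rfl⟩ := Nat.exists_eq_succ_of_ne_zero hn
  have hp : 0 < 2 ^ s := by positivity
  have h1 : (m + 1) % 2 ^ s = 0 ↔ m % 2 ^ s = 2 ^ s - 1 := by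
    have h := Nat.div_add_mod (m + 1) (2 ^ s)
    have h' := Nat.div_add_mod m (2 ^ s)
    have hl := Nat.mod_lt m hp
    have hl' := Nat.mod_lt (m + 1) hp
    rw [succ_div_pow] at h
    split_ifs at h with hm
    · rw [mul_add] at h
      simp only [hm, iff_true]; omega
    · simp only [hm, iff_false]; omega
  rw [Nat.succ_eq_add_one, Nat.add_sub_cancel,
    if_congr ((lowBits_neg_one_iff s (m + 1)).trans h1) rfl rfl, bitSign_succ,
    if_congr (lowBits_one_iff s m) rfl rfl]
  split_ifs <;> simp

theorem bitSign_mul_le (s a b : ℕ) : bitSign s a * bitSign s b ≤ 1 := by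
  rcases bitSign_cases s a with h | h <;> rcases bitSign_cases s b with h' | h' <;>
    rw [h, h'] <;> norm_num

theorem bitSign_mul_cases (s a b : ℕ) :
    bitSign s a * bitSign s b = 1 ∧ bitSign s a = bitSign s b ∨
      bitSign s a * bitSign s b = -1 ∧ bitSign s a ≠ bitSign s b := by
  rcases bitSign_cases s a with h | h <;> rcases bitSign_cases s b with h' | h' <;>
    rw [h, h'] <;> norm_num

@[simp] theorem bitSign_mul_self (s a : ℕ) : bitSign s a * bitSign s a = 1 := by
  rcases bitSign_cases s a with h | h <;> rw [h] <;> norm_num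

/-- One step of binary subtraction with borrow. -/
theorem sub_div_mod (s : ℕ) {i o : ℕ} (h : o ≤ i) :
    (i - o) / 2 ^ s % 2 =
      (i / 2 ^ s % 2 + o / 2 ^ s % 2 + if i % 2 ^ s < o % 2 ^ s then 1 else 0) % 2 := by
  have hp : 0 < 2 ^ s := by positivity
  have h1 := Nat.div_add_mod i (2 ^ s)
  have h2 := Nat.div_add_mod o (2 ^ s)
  have l1 := Nat.mod_lt i hp
  have l2 := Nat.mod_lt o hp
  generalize i / 2 ^ s = A at *
  generalize o / 2 ^ s = B at *
  generalize i % 2 ^ s = a at *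
  generalize o % 2 ^ s = b at *
  generalize 2 ^ s = p at *
  have hBA : B ≤ A := by
    by_contra hc
    have : p * (A + 1) ≤ p * B := Nat.mul_le_mul_left _ (by omega)
    rw [mul_add] at this; omega
  obtain ⟨D, rfl⟩ := Nat.exists_eq_add_of_le hBA
  rw [mul_add] at h1
  split_ifs with hab
  · have hD : D ≠ 0 := by rintro rfl; omega
    obtain ⟨E, rfl⟩ := Nat.exists_eq_succ_of_ne_zero hD
    have : (i - o) / p = E := by
      apply Nat.div_eq_of_lt_le
      · rw [Nat.succ_eq_add_one, mul_add] at h1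
        rw [mul_comm]; omega
      · rw [Nat.succ_eq_add_one, mul_add] at h1
        rw [mul_comm, mul_add]; omega
    rw [this]; omega
  · have : (i - o) / p = D := by
      apply Nat.div_eq_of_lt_le
      · rw [mul_comm]; omega
      · rw [mul_comm, mul_add]; omega
    rw [this]; omega

/-- The inequality of remainders is the borrow into a digit, and this recursion is the update rule
of the register `bor`. -/
theorem mod_pow_succ_lt (s i o : ℕ) :
    i % 2 ^ (s + 1) < o % 2 ^ (s + 1) ↔ i / 2 ^ s % 2 < o / 2 ^ s % 2 ∨
      (i / 2 ^ s % 2 = o / 2 ^ s % 2 ∧ i % 2 ^ s < o % 2 ^ s) := by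
  have hp : 0 < 2 ^ s := by positivity
  rw [Nat.mod_pow_succ, Nat.mod_pow_succ]
  have l1 := Nat.mod_lt i hp
  have l2 := Nat.mod_lt o hp
  have h1 : i / 2 ^ s % 2 = 0 ∨ i / 2 ^ s % 2 = 1 := by omega
  have h2 : o / 2 ^ s % 2 = 0 ∨ o / 2 ^ s % 2 = 1 := by omega
  rcases h1 with h1 | h1 <;> rcases h2 with h2 | h2 <;> rw [h1, h2] <;> omega

/-- The quotients by `2 ^ (s + 1)` are equal, so the quotients by `2 ^ s`, which are ordered like
`a` and `b`, can differ only in their last digit. -/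
theorem bitSign_le_of_prefix {r s a b : ℕ} (hs : s < r) (ha : a < 2 ^ r) (hb : b < 2 ^ r)
    (hab : a ≤ b) (h : ∀ s' < r, s < s' → bitSign s' a = bitSign s' b) :
    bitSign s a ≤ bitSign s b := by
  have h1 : a / 2 ^ (s + 1) = b / 2 ^ (s + 1) := by
    have hr : 2 ^ r = 2 ^ (s + 1) * 2 ^ (r - (s + 1)) := by rw [← pow_add]; congr 1; omega
    refine eq_of_bitSign_eq (r := r - (s + 1)) ?_ ?_ fun t ht => ?_
    · rw [Nat.div_lt_iff_lt_mul (by positivity), mul_comm, ← hr]; exact ha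
    · rw [Nat.div_lt_iff_lt_mul (by positivity), mul_comm, ← hr]; exact hb
    · have := h (s + 1 + t) (by omega) (by omega)
      simpa [bitSign_eq, Nat.div_div_eq_div_mul, ← pow_add] using this
  rw [pow_succ, ← Nat.div_div_eq_div_mul, ← Nat.div_div_eq_div_mul] at h1
  have h2 : a / 2 ^ s ≤ b / 2 ^ s := Nat.div_le_div_right hab
  rw [bitSign_eq, bitSign_eq]
  omega

/-- Digits of an optional number, `0` if there is none. -/
def optBit (s : ℕ) (o : Option ℕ) : ℤ := o.elim 0 (bitSign s)

@[simp] theorem optBit_none (s : ℕ) : optBit s none = 0 := rfl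
@[simp] theorem optBit_some (s n : ℕ) : optBit s (some n) = bitSign s n := rfl

@[simp] theorem tern_optBit (s : ℕ) (o : Option ℕ) : Tern (optBit s o) := by
  cases o <;> simp

/-- A sum of an even number of signs is even. This is where the parity of `r` matters: different
scores of contents are at least `2` apart, as `searchHead_spec` requires. -/
theorem even_sum_optBit {r : ℕ} (hr : Even r) (a b : Option ℕ) :
    Even (∑ s : Fin r, optBit s a * optBit s b) := by
  cases a with
  | none => simp
  | some a =>
    cases b with
    | none => simp
    | some b =>
      have : (∑ s : Fin r, optBit s (some a) * optBit s (some b))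
          = ∑ s : Fin r, (optBit s (some a) * optBit s (some b) - 1) + r := by
        simp [Finset.sum_sub_distrib]
      rw [this]
      refine Even.add (Finset.even_sum _ fun s _ => ?_) (by exact_mod_cast hr)
      simp only [optBit_some]
      rcases bitSign_mul_cases s a b with ⟨h, _⟩ | ⟨h, _⟩ <;> rw [h] <;> decide

/-- The scalar product of digits has its unique maximum at equality. -/
theorem sum_bitSign_mul_lt {r a b : ℕ} (ha : a < 2 ^ r) (hb : b < 2 ^ r) (hab : a ≠ b) :
    ∑ s : Fin r, bitSign s a * bitSign s b < r := by
  have : ∃ s < r, bitSign s a ≠ bitSign s b := by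
    by_contra hc
    push Not at hc
    exact hab (eq_of_bitSign_eq ha hb hc)
  obtain ⟨s, hs, hne⟩ := this
  calc ∑ s : Fin r, bitSign s a * bitSign s b < ∑ s : Fin r, 1 := by
        refine Finset.sum_lt_sum (fun s _ => bitSign_mul_le _ _ _) ⟨⟨s, hs⟩, by simp, ?_⟩
        rcases bitSign_mul_cases s a b with ⟨_, h⟩ | ⟨h, _⟩
        · exact absurd h hne
        · simp only; omega
    _ = r := by simp

end Bits

/-! ### Standard heads and networks -/

section Blocks

variable {ι : Type*} {r : ℕ}

/-- The head which reads from the position with number `ptr`. -/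
def ptrHead (ptr pos : Fin r → ι) (vo : List (ι × ι)) (neg : Bool := false) : HeadSpec ι :=
  ⟨(List.finRange r).map fun s => (ptr s, pos s), vo, neg⟩

theorem HeadSpec.isLastMax_of_lt {h : HeadSpec ι} {S : ℕ → ι → ℤ} {i p : ℕ} (hp : p ≤ i)
    (H : ∀ l ≤ i, l ≠ p → h.score S i l < h.score S i p) : h.att S i = p ∧ h.Consistent S i := by
  have h1 : h.IsLastMax S i p := by
    refine ⟨hp, fun l hl => ?_, fun l hl hpl => H l hl (by omega)⟩
    by_cases hlp : l = p
    · rw [hlp]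
    · exact (H l hl hlp).le
  refine ⟨h1.att_eq, fun l hl hs q _ => ?_⟩
  rw [h1.att_eq] at hs ⊢
  by_cases hlp : l = p
  · rw [hlp]
  · exact absurd hs (H l hl hlp).ne

/-- Scores are scalar products of digit vectors. Positions below `2 ^ r` are determined by their `r`
digits, so the maximum `r` is attained only at `p`. -/
theorem ptrHead_spec {ptr pos : Fin r → ι} (vo : List (ι × ι)) (neg : Bool) {S : ℕ → ι → ℤ}
    {i p : ℕ} (hi : i < 2 ^ r) (hpos : ∀ j s, S j (pos s) = bitSign s j)
    (hptr : ∀ s, S i (ptr s) = bitSign s p) (hp : p ≤ i) :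
    (ptrHead ptr pos vo neg).att S i = p ∧ (ptrHead ptr pos vo neg).Consistent S i := by
  refine HeadSpec.isLastMax_of_lt hp fun l hl hlp => ?_
  have : ∀ l, (ptrHead ptr pos vo neg).score S i l = ∑ s : Fin r, bitSign s p * bitSign s l := by
    intro l
    simp only [HeadSpec.score, ptrHead, List.map_map]
    rw [sum_map_finRange]
    simp [hpos, hptr]
  rw [this, this]
  have := sum_bitSign_mul_lt (hp.trans_lt hi) (hl.trans_lt hi) (Ne.symm hlp)
  simpa using this

/-- The head which determines one bit of the last position whose contents `W` match the query
registers `Q` best, if the higher bits are already known. -/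
def searchHead (Q W F pos : Fin r → ι) (one : ι) (s : Fin r) : HeadSpec ι where
  -- Weights are ternary, so a factor `2` in the score is obtained by listing the pairs twice. At
  -- most `2r + 2(r - 1) + 1 = 4r - 1` pairs are used, which is the value of `d_k`.
  qk := (List.finRange r).map (fun a => (Q a, W a)) ++ (List.finRange r).map (fun a => (Q a, W a))
    ++ (((List.finRange r).filter (s < ·)).map (fun a => (F a, pos a))
    ++ ((List.finRange r).filter (s < ·)).map (fun a => (F a, pos a))) ++ [(one, pos s)]
  vo := [(pos s, F s)]

theorem sum_map_filter {α M : Type*} [AddCommMonoid M] (l : List α) (p : α → Bool) (f : α → M) :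
    ((l.filter p).map f).sum = (l.map fun a => if p a then f a else 0).sum := by
  induction l with
  | nil => simp
  | cons a l ih => by_cases h : p a <;> simp [h, ih]

/-- The head which only compares contents. -/
def contentHead (Q W : Fin r → ι) : HeadSpec ι :=
  ⟨(List.finRange r).map fun a => (Q a, W a), [], false⟩

theorem contentHead_score (Q W : Fin r → ι) (S : ℕ → ι → ℤ) (i j : ℕ) :
    (contentHead Q W).score S i j = ∑ a, S i (Q a) * S j (W a) := by
  simp only [contentHead, HeadSpec.score, List.map_map]
  rw [sum_map_finRange]; rfl

/-- Maximizers need not be unique, but all of them match as well as the last best match `j`, share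
its known higher digits and have its digit `s`. Only this digit is read, so the head is consistent.
-/
theorem searchHead_spec {Q W F pos : Fin r → ι} {one : ι} {s : Fin r} {S : ℕ → ι → ℤ} {i : ℕ}
    (hi : i < 2 ^ r) (hpos : ∀ j s, S j (pos s) = bitSign s j) (hone : S i one = 1)
    (heven : ∀ j ≤ i, Even (∑ a, S i (Q a) * S j (W a)))
    (hF : ∀ a, s < a → S i (F a) = bitSign a ((contentHead Q W).att S i)) :
    (searchHead Q W F pos one s).Consistent S i ∧
      bitSign s ((searchHead Q W F pos one s).att S i)
        = bitSign s ((contentHead Q W).att S i) := by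
  set j := (contentHead Q W).att S i with hj
  obtain ⟨hji, hmax, hlast⟩ := (contentHead Q W).att_spec S i
  rw [← hj] at hji hmax hlast
  simp only [contentHead_score] at hmax hlast
  set q : ℕ → ℤ := fun l => ∑ a : Fin r, if s < a then bitSign a j * bitSign a l else 0 with hq
  have hscore : ∀ l, (searchHead Q W F pos one s).score S i l =
      2 * (∑ a, S i (Q a) * S l (W a)) + 2 * q l + bitSign s l := by
    intro l
    have : q l = ∑ a : Fin r, if s < a then S i (F a) * bitSign a l else 0 := by
      simp only [hq]
      refine Finset.sum_congr rfl fun a _ => ?_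
      split_ifs with h
      · rw [hF a h]
      · rfl
    rw [this]
    simp only [HeadSpec.score, searchHead, List.map_append, List.sum_append, List.map_map,
      sum_map_filter, sum_map_finRange]
    simp only [Function.comp, hpos, hone, decide_eq_true_eq, List.map_cons, List.map_nil,
      List.sum_cons, List.sum_nil]
    ring
  -- The known digits are those of `j` itself, so the agreement is largest at `j`, and each
  -- deviating digit costs `2`.
  have hqj : ∀ l, (q l = q j ∧ ∀ a, s < a → bitSign a l = bitSign a j) ∨ q l ≤ q j - 2 := by
    intro l
    have hsub : q j - q l = ∑ a : Fin r, if s < a then 1 - bitSign a j * bitSign a l else 0 := by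
      simp only [hq, ← Finset.sum_sub_distrib]
      refine Finset.sum_congr rfl fun a _ => ?_
      split_ifs <;> simp
    by_cases hall : ∀ a, s < a → bitSign a l = bitSign a j
    · left
      refine ⟨?_, hall⟩
      simp only [hq]
      refine Finset.sum_congr rfl fun a _ => ?_
      split_ifs with h
      · rw [hall a h]
      · rfl
    · right
      push Not at hall
      obtain ⟨a, ha, hne⟩ := hall
      have : (if s < a then 1 - bitSign a j * bitSign a l else 0) ≤
          ∑ a : Fin r, if s < a then 1 - bitSign a j * bitSign a l else 0 := by
        refine Finset.single_le_sum (f := fun a : Fin r =>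
          if s < a then 1 - bitSign a j * bitSign a l else 0) (fun b _ => ?_) (Finset.mem_univ a)
        have := bitSign_mul_le b j l
        split_ifs <;> omega
      rw [← hsub, if_pos ha] at this
      rcases bitSign_mul_cases a j l with ⟨_, h⟩ | ⟨h, _⟩
      · exact absurd h.symm hne
      · omega
  have hkey : ∀ l ≤ i, (searchHead Q W F pos one s).score S i j ≤
      (searchHead Q W F pos one s).score S i l → bitSign s l = bitSign s j := by
    intro l hl hle
    rw [hscore, hscore] at hle
    obtain ⟨u, hu⟩ := heven l hl
    obtain ⟨v, hv⟩ := heven j hji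
    have h1 := hmax l hl
    have h2 := bitSign_cases s l
    have h3 := bitSign_cases s j
    -- A worse content costs at least `4`, by evenness and the factor `2`, and so does a deviation
    -- in a known digit; digit `s` can gain at most `2`.
    rcases hqj l with ⟨h4, h5⟩ | h4
    · have hc : ∑ a, S i (Q a) * S l (W a) = ∑ a, S i (Q a) * S j (W a) := by omega
      -- With equal content `l` cannot lie after the last best match, so with equal higher digits
      -- its digit `s` is not larger than that of `j`.
      have hlj : l ≤ j := by
        by_contra hc'
        exact (hlast l hl (by omega)).ne hc
      have := bitSign_le_of_prefix (r := r) s.2 (by omega) (by omega) hlj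
        fun s' hs' hss => h5 ⟨s', hs'⟩ hss
      omega
    · omega
  obtain ⟨ha1, ha2, -⟩ := (searchHead Q W F pos one s).att_spec S i
  have hatt := hkey _ ha1 (ha2 j hji)
  refine ⟨fun l hl hls p hp => ?_, hatt⟩
  simp only [searchHead, List.mem_singleton] at hp
  subst hp
  simp only [hpos]
  rw [hatt, hkey l hl (hls ▸ ha2 j hji)]

variable [DecidableEq ι]

/-- If all registers in `P` are `1`, add the contents of sources to targets. -/
def addGates (P : Finset ι) (l : List (ι × ι)) : List (Gate ι) :=
  l.flatMap fun p => [⟨insert p.1 P, ∅, {p.2}, ∅⟩, ⟨P, {p.1}, ∅, {p.2}⟩]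

/-- If all registers in `P` are `1`, subtract the contents of sources from targets. -/
def subGates (P : Finset ι) (l : List (ι × ι)) : List (Gate ι) :=
  l.flatMap fun p => [⟨insert p.1 P, ∅, ∅, {p.2}⟩, ⟨P, {p.1}, {p.2}, ∅⟩]

@[simp] theorem length_addGates (P : Finset ι) (l : List (ι × ι)) :
    (addGates P l).length = 2 * l.length := by
  simp [addGates, List.length_flatMap, mul_comm]

@[simp] theorem length_subGates (P : Finset ι) (l : List (ι × ι)) :
    (subGates P l).length = 2 * l.length := by
  simp [subGates, List.length_flatMap, mul_comm]

open Classical in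
theorem gateSum_addGates (P : Finset ι) (l : List (ι × ι)) {x : ι → ℤ}
    (hx : ∀ p ∈ l, Tern (x p.1)) (c : ι) :
    gateSum (addGates P l) x c = if AllEq P x 1 then route l x c else 0 := by
  induction l with
  | nil => simp [addGates]
  | cons p l ih =>
    have : addGates P (p :: l) = [⟨insert p.1 P, ∅, {p.2}, ∅⟩, ⟨P, {p.1}, ∅, {p.2}⟩]
      ++ addGates P l := by simp [addGates]
    rw [this, gateSum_append, ih fun q hq => hx q (List.mem_cons_of_mem _ hq), route_cons]
    have hp := hx p List.mem_cons_self
    simp only [gateSum_cons, Gate.Fires, Gate.effect, allEq_insert]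
    by_cases hP : AllEq P x 1
    · rcases hp with h | h | h <;> by_cases hc : c = p.2 <;> simp [h, hc, hP, add_comm]
    · simp [hP]

open Classical in
theorem gateSum_subGates (P : Finset ι) (l : List (ι × ι)) {x : ι → ℤ}
    (hx : ∀ p ∈ l, Tern (x p.1)) (c : ι) :
    gateSum (subGates P l) x c = if AllEq P x 1 then -route l x c else 0 := by
  induction l with
  | nil => simp [subGates]
  | cons p l ih =>
    have : subGates P (p :: l) = [⟨insert p.1 P, ∅, ∅, {p.2}⟩, ⟨P, {p.1}, {p.2}, ∅⟩]
      ++ subGates P l := by simp [subGates]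
    rw [this, gateSum_append, ih fun q hq => hx q (List.mem_cons_of_mem _ hq), route_cons]
    have hp := hx p List.mem_cons_self
    simp only [gateSum_cons, Gate.Fires, Gate.effect, allEq_insert]
    by_cases hP : AllEq P x 1
    · rcases hp with h | h | h <;> by_cases hc : c = p.2 <;> simp [h, hc, hP, add_comm]
    · simp [hP]

/-- If all registers in `P` are `1`, add to `dst` the difference of the digits of `n + 1` and `n`,
where `n` is the number in `src`. -/
def succGates (P : Finset ι) (src dst : Fin r → ι) : List (Gate ι) :=
  (List.finRange r).flatMap fun s =>
    -- A flipped digit changes by `2`; ternary output weights allow only `1`, so each neuron occurs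
    -- twice.
    [⟨insert (src s) (P ∪ (Finset.univ.filter (· < s)).image src), ∅, ∅, {dst s}⟩,
      ⟨insert (src s) (P ∪ (Finset.univ.filter (· < s)).image src), ∅, ∅, {dst s}⟩,
      ⟨P ∪ (Finset.univ.filter (· < s)).image src, {src s}, {dst s}, ∅⟩,
      ⟨P ∪ (Finset.univ.filter (· < s)).image src, {src s}, {dst s}, ∅⟩]

/-- If all registers in `P` are `1`, add to `dst` the difference of the digits of `n - 1`
(truncated subtraction) and `n`, where `n` is the number in `src`. -/
def predGates (P : Finset ι) (src dst : Fin r → ι) : List (Gate ι) :=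
  ((List.finRange r).flatMap fun s =>
    [⟨insert (src s) P, (Finset.univ.filter (· < s)).image src, ∅, {dst s}⟩,
      ⟨insert (src s) P, (Finset.univ.filter (· < s)).image src, ∅, {dst s}⟩,
      ⟨P, insert (src s) ((Finset.univ.filter (· < s)).image src), {dst s}, ∅⟩,
      ⟨P, insert (src s) ((Finset.univ.filter (· < s)).image src), {dst s}, ∅⟩]) ++
  -- For `n = 0` the borrow runs through and flips all digits to `1`; the last two neurons undo
  -- this, as a left move in cell `0` does nothing.
  [⟨P, Finset.univ.image src, ∅, Finset.univ.image dst⟩,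
    ⟨P, Finset.univ.image src, ∅, Finset.univ.image dst⟩]

@[simp] theorem length_succGates (P : Finset ι) (src dst : Fin r → ι) :
    (succGates P src dst).length = 4 * r := by
  simp [succGates, List.length_flatMap, mul_comm]

@[simp] theorem length_predGates (P : Finset ι) (src dst : Fin r → ι) :
    (predGates P src dst).length = 4 * r + 2 := by
  simp [predGates, List.length_flatMap, mul_comm]

theorem forall_mem_lower {src : Fin r → ι} {s : Fin r} {x : ι → ℤ} {n : ℕ} {v : ℤ}
    (hx : ∀ s, x (src s) = bitSign s n) :
    AllEq ((Finset.univ.filter (· < s)).image src) x v ↔ LowBits s n v := by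
  unfold AllEq LowBits
  simp only [Finset.forall_mem_image, Finset.mem_filter, Finset.mem_univ, true_and, hx]
  exact ⟨fun h a ha => h (x := ⟨a, ha.trans s.2⟩) ha, fun h a ha => h a ha⟩

open Classical in
theorem gateSum_succGates (P : Finset ι) (src dst : Fin r → ι) {x : ι → ℤ} {o : Option ℕ}
    (hx : ∀ s : Fin r, x (src s) = optBit s o) (c : ι) :
    gateSum (succGates P src dst) x c = ∑ s : Fin r, if c = dst s then
      (if AllEq P x 1 then optBit s (o.map (· + 1)) - optBit s o else 0) else 0 := by
  rw [succGates, gateSum_flatMap_finRange]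
  refine Finset.sum_congr rfl fun s _ => ?_
  simp only [gateSum_cons, gateSum_nil, Gate.Fires, Gate.effect, allEq_insert,
    allEq_union, hx]
  by_cases hP : AllEq P x 1
  swap
  · simp [hP]
  cases o with
  | none => simp [hx]
  | some n =>
    simp only [forall_mem_lower (n := n) (x := x) (src := src) hx, optBit_some, Option.map_some,
      bitSign_succ, allEq_singleton, hx, hP]
    by_cases hl : LowBits s n 1
    · rcases bitSign_cases s n with h | h <;> by_cases hc : c = dst s <;> simp [h, hc, hl]
    · simp [hl]

open Classical in
theorem gateSum_predGates (P : Finset ι) (src dst : Fin r → ι) (hdst : Function.Injective dst)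
    {x : ι → ℤ} {o : Option ℕ} (ho : ∀ n ∈ o, n < 2 ^ r)
    (hx : ∀ s : Fin r, x (src s) = optBit s o) (c : ι) :
    gateSum (predGates P src dst) x c = ∑ s : Fin r, if c = dst s then
      (if AllEq P x 1 then optBit s (o.map (· - 1)) - optBit s o else 0) else 0 := by
  rw [predGates, gateSum_append, gateSum_flatMap_finRange]
  by_cases hP : AllEq P x 1
  swap
  · simp [gateSum_cons, Gate.Fires, hP]
  by_cases hc : ∃ t, c = dst t
  swap
  · push Not at hc
    simp [gateSum_cons, Gate.effect, hc, fun a => Ne.symm (hc a)]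
  obtain ⟨t, rfl⟩ := hc
  have h1 : ∀ f : Fin r → ℤ, ∑ s, (if dst t = dst s then f s else 0) = f t := by
    intro f; simp [hdst.eq_iff]
  rw [h1, if_pos hP]
  have h2 : ∀ s, gateSum [(⟨insert (src s) P, (Finset.univ.filter (· < s)).image src, ∅, {dst s}⟩ :
      Gate ι),
      ⟨insert (src s) P, (Finset.univ.filter (· < s)).image src, ∅, {dst s}⟩,
      ⟨P, insert (src s) ((Finset.univ.filter (· < s)).image src), {dst s}, ∅⟩,
      ⟨P, insert (src s) ((Finset.univ.filter (· < s)).image src), {dst s}, ∅⟩] x (dst t)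
      = if dst t = dst s then
        (o.elim 0 fun n => if LowBits s n (-1) then -2 * bitSign s n else 0)
        else 0 := by
    intro s
    simp only [gateSum_cons, gateSum_nil, Gate.Fires, Gate.effect, allEq_insert, hx]
    cases o with
    | none => simp
    | some n =>
      simp only [forall_mem_lower (n := n) (x := x) (src := src) hx, optBit_some, Option.elim_some]
      by_cases hl : LowBits s n (-1)
      · rcases bitSign_cases s n with h | h <;> by_cases hc : dst t = dst s <;>
          simp [h, hc, hl, hP]
      · simp [hl]
  simp only [h2, h1]
  simp only [gateSum_cons, gateSum_nil, Gate.Fires, Gate.effect, allEq_image_univ, hx, eq_true hP]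
  cases o with
  | none =>
    have : Nonempty (Fin r) := ⟨t⟩
    simp
  | some n =>
    have hn := ho n rfl
    have hall : (∀ s : Fin r, bitSign s n = -1) ↔ n = 0 := by
      constructor
      · intro h
        exact eq_of_bitSign_eq hn (by positivity) fun s hs => by
          simpa using h ⟨s, hs⟩
      · rintro rfl; simp
    simp only [true_and, hall, Option.elim_some, Option.map_some, optBit_some]
    by_cases hn0 : n = 0
    · subst hn0; simp [LowBits]
    · rw [bitSign_pred _ _ hn0]
      split_ifs <;> simp_all; ring

end Blocks

/-! ## The program -/

/-- The registers of the simulating program. -/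
inductive Reg (K r dQ dG : ℕ)
  | pos (s : Fin r) | prev (s : Fin r) | prev2 (s : Fin r) | cp (s : Fin r) | rp (s : Fin r)
  | op (s : Fin r)
  | cnt (e : Fin (r + 1))
  | H (k : Fin K) (s : Fin r) | W (k : Fin K) (s : Fin r) | F (k : Fin K) (s : Fin r)
  | FW (k : Fin K) (s : Fin r) | HB (k : Fin K) (s : Fin r)
  | d0 (a : Option (Fin K)) | d1 (a : Option (Fin K))
  | e0 (a : Option (Fin K)) | e1 (a : Option (Fin K))
  | mL (k : Fin K) | mR (k : Fin K) | oM (k : Fin K) (b : Fin 2) | oB (k : Fin K)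
  | Qs (b : Fin dQ) | QC (b : Fin dQ) | oQ (b : Fin dQ)
  | Y (k : Fin K) (b : Fin dG) | SC (k : Fin K) (b : Fin dG) | oY (k : Fin K) (b : Fin dG)
  | oS (b : Fin dG)
  | one | isInp | isOutp | nout | out | isRun | nh | endp | bit | sym | relay | nrel | go | bor
  | oOut | oP | oPe
  deriving DecidableEq

namespace Reg

variable {K r dQ dG : ℕ}

/-- The summands: `r`-bit numbers, `K` numbers of `r` bits, tracks, moves, tapes, states, symbols,
and single registers. -/
abbrev Sum (K r dQ dG : ℕ) : Type :=
  (Fin 6 × Fin r) ⊕ Fin (r + 1) ⊕ (Fin 5 × Fin K × Fin r) ⊕ (Fin 4 × Option (Fin K)) ⊕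
    (Fin 5 × Fin K) ⊕ (Fin 3 × Fin dQ) ⊕ (Fin 3 × Fin K × Fin dG) ⊕ Fin dG ⊕ Fin 17

def toSum : Reg K r dQ dG → Sum K r dQ dG
  | pos s => .inl (0, s) | prev s => .inl (1, s) | prev2 s => .inl (2, s) | cp s => .inl (3, s)
  | rp s => .inl (4, s) | op s => .inl (5, s)
  | cnt e => .inr (.inl e)
  | H k s => .inr (.inr (.inl (0, k, s))) | W k s => .inr (.inr (.inl (1, k, s)))
  | F k s => .inr (.inr (.inl (2, k, s))) | FW k s => .inr (.inr (.inl (3, k, s)))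
  | HB k s => .inr (.inr (.inl (4, k, s)))
  | d0 a => .inr (.inr (.inr (.inl (0, a)))) | d1 a => .inr (.inr (.inr (.inl (1, a))))
  | e0 a => .inr (.inr (.inr (.inl (2, a)))) | e1 a => .inr (.inr (.inr (.inl (3, a))))
  | mL k => .inr (.inr (.inr (.inr (.inl (0, k))))) | mR k => .inr (.inr (.inr (.inr (.inl (1, k)))))
  | oB k => .inr (.inr (.inr (.inr (.inl (2, k)))))
  | oM k 0 => .inr (.inr (.inr (.inr (.inl (3, k)))))
  | oM k 1 => .inr (.inr (.inr (.inr (.inl (4, k)))))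
  | Qs b => .inr (.inr (.inr (.inr (.inr (.inl (0, b))))))
  | QC b => .inr (.inr (.inr (.inr (.inr (.inl (1, b))))))
  | oQ b => .inr (.inr (.inr (.inr (.inr (.inl (2, b))))))
  | Y k b => .inr (.inr (.inr (.inr (.inr (.inr (.inl (0, k, b)))))))
  | SC k b => .inr (.inr (.inr (.inr (.inr (.inr (.inl (1, k, b)))))))
  | oY k b => .inr (.inr (.inr (.inr (.inr (.inr (.inl (2, k, b)))))))
  | oS b => .inr (.inr (.inr (.inr (.inr (.inr (.inr (.inl b)))))))
  | one => single 0 | isInp => single 1 | isOutp => single 2 | nout => single 3 | out => single 4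
  | isRun => single 5 | nh => single 6 | endp => single 7 | bit => single 8 | sym => single 9
  | relay => single 10 | nrel => single 11 | go => single 12 | bor => single 13 | oOut => single 14
  | oP => single 15 | oPe => single 16
where
  single (i : Fin 17) : Sum K r dQ dG := .inr (.inr (.inr (.inr (.inr (.inr (.inr (.inr i)))))))

def ofSum : Sum K r dQ dG → Reg K r dQ dG
  | .inl (i, s) => ![pos s, prev s, prev2 s, cp s, rp s, op s] i
  | .inr (.inl e) => cnt e
  | .inr (.inr (.inl (i, k, s))) => ![H k s, W k s, F k s, FW k s, HB k s] i
  | .inr (.inr (.inr (.inl (i, a)))) => ![d0 a, d1 a, e0 a, e1 a] i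
  | .inr (.inr (.inr (.inr (.inl (i, k))))) => ![mL k, mR k, oB k, oM k 0, oM k 1] i
  | .inr (.inr (.inr (.inr (.inr (.inl (i, b)))))) => ![Qs b, QC b, oQ b] i
  | .inr (.inr (.inr (.inr (.inr (.inr (.inl (i, k, b))))))) => ![Y k b, SC k b, oY k b] i
  | .inr (.inr (.inr (.inr (.inr (.inr (.inr (.inl b))))))) => oS b
  | .inr (.inr (.inr (.inr (.inr (.inr (.inr (.inr i))))))) =>
      ![one, isInp, isOutp, nout, out, isRun, nh, endp, bit, sym, relay, nrel, go, bor, oOut, oP,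
        oPe] i

theorem ofSum_toSum (c : Reg K r dQ dG) : ofSum (toSum c) = c := by
  cases c with
  | oM k b => fin_cases b <;> rfl
  | _ => rfl

theorem toSum_injective : Function.Injective (toSum (K := K) (r := r) (dQ := dQ) (dG := dG)) :=
  Function.LeftInverse.injective ofSum_toSum

noncomputable instance : Fintype (Reg K r dQ dG) := Fintype.ofInjective _ toSum_injective

/-- The summands provide `5Kr + 7r + 3dQ + (3K+1)dG + 9K + 22` places; `K ≥ 1` turns this into the
stated bound. -/
theorem card_le (hK : 0 < K) : Fintype.card (Reg K r dQ dG) ≤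
    6 * K * r + 6 * r + 3 * dQ + (3 * K + 1) * dG + 10 * K + 21 := by
  refine (Fintype.card_le_of_injective _ toSum_injective).trans ?_
  simp only [Sum, Fintype.card_sum, Fintype.card_prod, Fintype.card_fin, Fintype.card_option]
  have : r ≤ r * K := Nat.le_mul_of_pos_right r hK
  ring_nf
  omega

end Reg

/-! ### Lists of register pairs and code sets -/

section Lists

variable {ι : Type*} {m : ℕ}

/-- Pairs of corresponding registers of two arrays. -/
def copyList (src dst : Fin m → ι) : List (ι × ι) := (List.finRange m).map fun s => (src s, dst s)

@[simp] theorem length_copyList (src dst : Fin m → ι) : (copyList src dst).length = m := by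
  simp [copyList]

open Classical in
theorem route_copyList (src dst : Fin m → ι) (y : ι → ℤ) (c : ι) :
    route (copyList src dst) y c = ∑ s, if c = dst s then y (src s) else 0 := route_map _ _ _

theorem nodup_copyList {src dst : Fin m → ι} (h : Function.Injective dst) :
    ((copyList src dst).map Prod.snd).Nodup := by
  simp only [copyList, List.map_map]
  exact (List.nodup_finRange m).map h

/-- The list of those indices `s : Fin r` with `r - s = δ`. -/
def slot (r δ : ℕ) : List (Fin r) := if h : 0 < δ ∧ δ ≤ r then [⟨r - δ, by omega⟩] else []

theorem length_slot_le (r δ : ℕ) : (slot r δ).length ≤ 1 := by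
  unfold slot; split_ifs <;> simp

theorem mem_slot {r δ : ℕ} {s : Fin r} : s ∈ slot r δ ↔ r - (s : ℕ) = δ := by
  unfold slot; split_ifs with h <;> simp [Fin.ext_iff] <;> omega

open Classical in
theorem route_slot {r δ : ℕ} (a : ι) (f : Fin r → ι) (y : ι → ℤ) (c : ι) :
    route ((slot r δ).map fun s => (a, f s)) y c = if ∃ s ∈ slot r δ, c = f s then y a else 0 := by
  unfold slot; split_ifs <;> simp_all

/-- The list of those indices `s : Fin m` with `s = δ`. -/
def cslot (m δ : ℕ) : List (Fin m) := if h : δ < m then [⟨δ, h⟩] else []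

theorem length_cslot_le (m δ : ℕ) : (cslot m δ).length ≤ 1 := by
  unfold cslot; split_ifs <;> simp

theorem mem_cslot {m δ : ℕ} {s : Fin m} : s ∈ cslot m δ ↔ (s : ℕ) = δ := by
  unfold cslot; split_ifs with h <;> simp [Fin.ext_iff] <;> omega

open Classical in
theorem route_cslot {m δ : ℕ} (a : ι) (f : Fin m → ι) (y : ι → ℤ) (c : ι) :
    route ((cslot m δ).map fun s => (a, f s)) y c = if ∃ s ∈ cslot m δ, c = f s then y a else 0 := by
  unfold cslot; split_ifs <;> simp_all

/-- Indices with a given sign in the code word `u`. -/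
def codeSet [DecidableEq ι] (u : Fin m → ℤˣ) (f : Fin m → ι) (v : ℤˣ) : Finset ι :=
  (Finset.univ.filter (u · = v)).image f

end Lists

/-! ### Classes and contents of tokens -/

namespace CoTToken

variable {K : ℕ} {Q S G : Type*}

def isRun : CoTToken K Q S G → Bool | .run .. => true | _ => false
/-- The tokens after which a run token is expected, unless a delimiter is due. -/
def isAct : CoTToken K Q S G → Bool | .run .. => true | .inpEnd => true | .posEnd => true | _ => false
def isRelay : CoTToken K Q S G → Bool
  | .pos => true | .bits _ => true | .posEnd => true | _ => false
def isSym : CoTToken K Q S G → Bool | .sym _ => true | _ => false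
def isBits : CoTToken K Q S G → Bool | .bits _ => true | _ => false
def move (v : CoTToken K Q S G) (k : Fin K) : Option HeadMove :=
  match v with | .run _ _ Δ => some (Δ k) | _ => none
def bitVal (v : CoTToken K Q S G) (k : Fin K) : ℤ :=
  match v with | .bits b => (b k : ℤ) | _ => 0
-- `</inp>` and `</p>` share a sign because a series of run tokens starts after either of them.
def delim : CoTToken K Q S G → ℤ | .pos => 1 | .posEnd => -1 | .inpEnd => -1 | _ => 0

variable (M : TuringMachine K Q S G)

def state? : CoTToken K Q S G → Option Q
  | .run q _ _ => some q | .inpEnd => some M.qinit | _ => none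

def symbol? (v : CoTToken K Q S G) (k : Fin K) : Option G :=
  match v with
  | .run _ y _ => some (y k)
  | .sym a => if (k : ℕ) = 0 then some (M.incl a) else none
  -- Unsuccessful searches are redirected to position `0`, so `<inp>` carries the blank on every
  -- tape.
  | .inp => some M.blank
  | _ => none

def notHalt (v : CoTToken K Q S G) : Prop :=
  match v with | .run q _ _ => q ≠ M.qhalt | _ => False

end CoTToken

/-- Binary codes of states, symbols and head movements. -/
structure Codes (Q G : Type*) (dQ dG : ℕ) where
  Q : Q → Fin dQ → ℤˣ
  G : G → Fin dG → ℤˣ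
  M : HeadMove → Fin 2 → ℤˣ
  Q_inj : Function.Injective Q
  G_inj : Function.Injective G
  M_inj : Function.Injective M

/-! ### Embedding, layers and unembedding -/

namespace TuringMachine

variable {K : ℕ} {Q S G : Type*} {r dQ dG : ℕ} (M : TuringMachine K Q S G) (code : Codes Q G dQ dG)

/-- The first tape. -/
def k0 : Fin K := ⟨0, M.K_pos⟩

open Classical in
/-- The embedding of tokens. -/
noncomputable def tokEmb (v : CoTToken K Q S G) : Reg K r dQ dG → ℤ
  -- All digits `-1` code position `0`. Run tokens start with empty digits, to which `prevLayer`
  -- adds the previous position.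
  | .cp _ => if v.isRun then 0 else -1
  | .H _ _ => if v = .inpEnd then -1 else 0
  | .d0 none => v.delim
  | .d0 (some k) => v.bitVal k
  | .mL k => if v.move k = some .left then 1 else 0
  | .mR k => if v.move k = some .right then 1 else 0
  | .Qs b => (v.state? M).elim 0 fun q => (code.Q q b : ℤ)
  | .Y k b => (v.symbol? M k).elim 0 fun g => (code.G g b : ℤ)
  | .one => 1
  | .isInp => if v = .inp then 1 else 0
  | .isOutp => if v = .outp then 1 else 0
  | .nout => 1
  | .isRun => if v.isRun then 1 else 0
  | .nh => if v.notHalt M then 1 else 0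
  | .endp => if v = .posEnd then 1 else 0
  | .bit => if v.isBits then 1 else 0
  | .sym => if v.isSym then 1 else 0
  | .relay => if v.isRelay then 1 else 0
  | .nrel => if v.isRelay then 0 else 1
  | .go => if v.isAct then 1 else 0
  | .bor => -1
  | _ => 0

open Reg

/-- Find `<outp>`; compute the previous position. -/
def outpLayer : LayerSpec (Reg K r dQ dG) where
  heads :=
    [⟨[(one, isOutp), (one, isOutp), (one, isInp)], copyList pos op, false⟩,
      ⟨[(one, isOutp), (one, isOutp), (one, isInp)], [(isOutp, out)], false⟩,
      ⟨[(one, isOutp), (one, isOutp), (one, isInp)], [(isOutp, nout)], true⟩]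
  gates := addGates ∅ (copyList pos prev) ++ predGates ∅ pos prev

/-- Read from the previous position, and initialize the pointers. -/
def prevLayer : LayerSpec (Reg K r dQ dG) where
  heads := ptrHead prev pos (copyList prev prev2) :: ptrHead prev pos [(d0 none, d1 none)] ::
    (List.finRange K).map fun k => ptrHead prev pos [(d0 (some k), d1 (some k))]
  gates := addGates {isRun} (copyList prev cp) ++ addGates {relay} (copyList prev rp)
    ++ addGates {nrel} (copyList pos rp)

/-- Delay lines, by which the head positions and delimiters are gathered. -/
def gatherLayer (e : ℕ) : LayerSpec (Reg K r dQ dG) where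
  heads := ptrHead prev2 pos [(d0 none, e0 none), (d1 none, e1 none)] ::
    (List.finRange K).map fun k =>
      ptrHead prev2 pos [(d0 (some k), e0 (some k)), (d1 (some k), e1 (some k))]
  gates := (subGates ∅ ([(d0 none, d0 none), (d1 none, d1 none), (e0 none, e0 none),
        (e1 none, e1 none)] ++
      (List.finRange K).flatMap fun k => [(d0 (some k), d0 (some k)), (d1 (some k), d1 (some k)),
        (e0 (some k), e0 (some k)), (e1 (some k), e1 (some k))])
    ++ addGates ∅ ([(e0 none, d0 none), (e1 none, d1 none)] ++
      (List.finRange K).flatMap fun k => [(e0 (some k), d0 (some k)), (e1 (some k), d1 (some k))]))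
    ++ addGates {endp} ((List.finRange K).flatMap fun k =>
      -- Digit `s` of a head position stands `r - s` positions before `</p>`, so round `e` delivers
      -- the digits with `r - s = 2e` and `r - s = 2e + 1`.
      (slot r (2 * e)).map (fun s => (d0 (some k), H k s))
        ++ (slot r (2 * e + 1)).map (fun s => (d1 (some k), H k s)))
    ++ addGates ∅ ((cslot (r + 1) (2 * e)).map (fun s => (d0 none, cnt s))
        ++ (cslot (r + 1) (2 * e + 1)).map (fun s => (d1 none, cnt s)))

/-- One binary digit of the distance from `<outp>`. -/
def rippleGates (s : Fin r) : List (Gate (Reg K r dQ dG)) :=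
  [⟨{out, pos s, op s, bor}, ∅, {H M.k0 s}, ∅⟩,
    ⟨{out, pos s, op s}, {bor}, ∅, {H M.k0 s}⟩,
    -- The borrow changes by `2`, hence by two neurons, of which only one also emits the digit.
    ⟨{out, pos s, bor}, {op s}, ∅, {H M.k0 s, bor}⟩,
    ⟨{out, pos s, bor}, {op s}, ∅, {bor}⟩,
    ⟨{out, pos s}, {op s, bor}, {H M.k0 s}, ∅⟩,
    ⟨{out, op s, bor}, {pos s}, ∅, {H M.k0 s}⟩,
    ⟨{out, op s}, {pos s, bor}, {H M.k0 s, bor}, ∅⟩,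
    ⟨{out, op s}, {pos s, bor}, {bor}, ∅⟩,
    ⟨{out, bor}, {pos s, op s}, {H M.k0 s}, ∅⟩,
    ⟨{out}, {pos s, op s, bor}, ∅, {H M.k0 s}⟩]

/-- Move the heads by one step. -/
def chainLayer (s : Fin r) : LayerSpec (Reg K r dQ dG) where
  heads := (List.finRange K).map (fun k => ptrHead cp pos (copyList (H k) (W k))) ++
    -- Reading the own position with negative sign erases the old contents of `W`, so that the sum
    -- over the heads overwrites instead of adding.
    (List.finRange K).map (fun k => ptrHead pos pos (copyList (W k) (W k)) true)
  gates := ((List.finRange K).flatMap fun k => addGates ∅ (copyList (W k) (H k))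
      ++ succGates {mR k} (W k) (H k) ++ predGates {mL k} (W k) (H k)
      ++ subGates {isRun} (copyList (H k) (H k))) ++ M.rippleGates s

/-- Treat input symbols as written symbols. -/
def inputLayer : LayerSpec (Reg K r dQ dG) where
  heads := []
  gates := addGates {sym, nout} (copyList prev (W M.k0))

/-- One digit of the binary search for the last write access, and pointer jumping. -/
def searchLayer (s : Fin r) : LayerSpec (Reg K r dQ dG) where
  heads := ptrHead rp pos (copyList rp (FW M.k0)) ::
    (List.finRange K).map fun k => searchHead (H k) (W k) (F k) pos one s
  gates := addGates ∅ (copyList (FW M.k0) rp) ++ subGates ∅ (copyList rp rp)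
    ++ subGates ∅ (copyList (FW M.k0) (FW M.k0))

/-- Compare the cells of the positions found, and read from the last run token. -/
def compareLayer : LayerSpec (Reg K r dQ dG) where
  heads := ptrHead rp pos (copyList Qs QC) ::
    ((List.finRange K).map (fun k => ptrHead (F k) pos (copyList (W k) (FW k))) ++
      (List.finRange K).map (fun k => ptrHead rp pos (copyList (H k) (HB k))))
  gates := ((List.finRange K).flatMap fun k => (List.finRange r).flatMap fun s =>
      -- If the queried digit is `-1`, a found digit `-1` is raised to `1` and a found digit `1` is
      -- lowered to `0`; otherwise the found digit itself already tells whether it equals `1`.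
      [⟨∅, {H k s, FW k s}, {FW k s}, ∅⟩, ⟨∅, {H k s, FW k s}, {FW k s}, ∅⟩,
        ⟨{FW k s}, {H k s}, ∅, {FW k s}⟩]) ++
    -- A starting delimiter `r` positions back means that `r` steps are complete: `<p>` is due and
    -- the transition is suppressed. A `<p>` that far back means that all `r` digits are written.
    [⟨{nh}, {cnt (Fin.last r)}, {oP}, {go}⟩, ⟨{bit, cnt (Fin.last r)}, ∅, {oPe}, ∅⟩]

/-- Redirect unsuccessful searches to the first position; output of head positions. -/
def redirectLayer : LayerSpec (Reg K r dQ dG) where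
  heads := []
  -- All neurons read the old `F`. It is replaced by `-1` in every digit, the code of position `0`,
  -- and if all digits in `FW` are `1`, then `F + 1` is added back.
  gates := ((List.finRange K).flatMap fun k => subGates ∅ (copyList (F k) (F k)) ++
      [⟨∅, ∅, ∅, Finset.univ.image (F k)⟩] ++
      addGates (Finset.univ.image (FW k)) (copyList (F k) (F k)) ++
      [⟨Finset.univ.image (FW k), ∅, Finset.univ.image (F k), ∅⟩]) ++
    (List.finRange K).flatMap fun k => (List.finRange r).flatMap fun e =>
      addGates {cnt e.castSucc} [(HB k e, oB k)]

/-- Read the symbols. -/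
def readLayer : LayerSpec (Reg K r dQ dG) where
  heads := (List.finRange K).map fun k => ptrHead (F k) pos (copyList (Y k) (SC k))
  gates := addGates {out} (copyList (SC M.k0) oS)

open Classical in
/-- The neuron for one value of the transition function. -/
noncomputable def deltaGate (p : Q × (Fin K → G)) : Gate (Reg K r dQ dG) where
  pos := insert go (codeSet (code.Q p.1) QC 1 ∪
    Finset.univ.biUnion fun k => codeSet (code.G (p.2 k)) (SC k) 1)
  neg := codeSet (code.Q p.1) QC (-1) ∪
    Finset.univ.biUnion fun k => codeSet (code.G (p.2 k)) (SC k) (-1)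
  inc := if p.1 = M.qhalt then {oOut} else codeSet (code.Q (M.δ p.1 p.2).1) oQ 1 ∪
    (Finset.univ.biUnion fun k => codeSet (code.G ((M.δ p.1 p.2).2.1 k)) (oY k) 1) ∪
    Finset.univ.biUnion fun k => codeSet (code.M ((M.δ p.1 p.2).2.2 k)) (oM k) 1
  dec := if p.1 = M.qhalt then ∅ else codeSet (code.Q (M.δ p.1 p.2).1) oQ (-1) ∪
    (Finset.univ.biUnion fun k => codeSet (code.G ((M.δ p.1 p.2).2.1 k)) (oY k) (-1)) ∪
    Finset.univ.biUnion fun k => codeSet (code.M ((M.δ p.1 p.2).2.2 k)) (oM k) (-1)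

open Classical in
/-- Evaluate the transition function. -/
noncomputable def deltaLayer [Fintype Q] [Fintype G] : LayerSpec (Reg K r dQ dG) where
  heads := []
  gates := (Finset.univ : Finset (Q × (Fin K → G))).toList.map (M.deltaGate code)

/-- The whole program. -/
noncomputable def program [Fintype Q] [Fintype G] (h : ℕ) : List (LayerSpec (Reg K r dQ dG)) :=
  [outpLayer, prevLayer] ++ (List.range (h + 1)).map gatherLayer
    ++ (List.finRange r).map M.chainLayer ++ [M.inputLayer]
    ++ (List.finRange r).map (fun s => M.searchLayer s.rev)
    ++ [compareLayer, redirectLayer, M.readLayer, M.deltaLayer code]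

theorem length_program [Fintype Q] [Fintype G] (h : ℕ) :
    (M.program (r := r) code h).length = 2 * r + h + 8 := by
  simp [program]; ring

/-- The unembedding of tokens. -/
def tokUnemb : CoTToken K Q S G → Reg K r dQ dG → ℤ
  | .inp, _ => 0
  | .inpEnd, _ => 0
  | .outp, c => if c = oOut then 1 else 0
  -- The end of the output is recognized by reading a blank.
  | .outpEnd, c => match c with | .oS b => (code.G M.blank b : ℤ) | .out => 1 | _ => 0
  | .pos, c => if c = oP then 1 else 0
  | .posEnd, c => if c = oPe then 1 else 0
  | .run q y Δ, c => match c with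
    | .oQ b => (code.Q q b : ℤ) | .oY k b => (code.G (y k) b : ℤ) | .oM k b => (code.M (Δ k) b : ℤ)
    | _ => 0
  | .bits b, c => match c with | .oB k => (b k : ℤ) | _ => 0
  | .sym a, c => match c with | .oS b => (code.G (M.incl a) b : ℤ) | .out => 1 | _ => 0

end TuringMachine

/-! ## The states of the program on a trace -/

section Assemble

variable {ι : Type*}

/-- With an explicit formula `A` for the attention output, the neurons are evaluated on `S + A`
independently of how the heads found their positions. -/
theorem LayerSpec.Step.of_eq {l : LayerSpec ι} {n : ℕ} {S S' : ℕ → ι → ℤ} (A : ℕ → ι → ℤ)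
    (hc : ∀ i < n, ∀ h ∈ l.heads, h.Consistent S i) (hA : ∀ i < n, ∀ c, l.attn S i c = A i c)
    (h1 : ∀ i < n, ∀ c, Tern (A i c)) (h2 : ∀ i < n, ∀ c, Tern (S i c + A i c))
    (h3 : ∀ i < n, ∀ c, Tern (S' i c))
    (h4 : ∀ i < n, (∀ c, Tern (S i c + A i c)) → ∀ c,
      S' i c = S i c + A i c + gateSum l.gates (fun c => S i c + A i c) c) :
    l.Step n S S' where
  consistent := hc
  tern_attn i hi c := by rw [hA i hi]; exact h1 i hi c
  tern_mid i hi c := by rw [hA i hi]; exact h2 i hi c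
  tern := h3
  eq i hi c := by rw [funext (hA i hi)]; exact h4 i hi (h2 i hi) c

theorem LayerSpec.Step.of_gates {l : LayerSpec ι} {n : ℕ} {S S' : ℕ → ι → ℤ} (hl : l.heads = [])
    (h2 : ∀ i < n, ∀ c, Tern (S i c)) (h3 : ∀ i < n, ∀ c, Tern (S' i c))
    (h4 : ∀ i < n, ∀ c, S' i c = S i c + gateSum l.gates (S i) c) :
    l.Step n S S' :=
  .of_eq (fun _ _ => 0) (by simp [hl]) (by simp [LayerSpec.attn, hl]) (by simp) (by simpa using h2)
    h3 (by simpa using fun i hi _ => h4 i hi)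

theorem ptrHead_read {r : ℕ} {ptr pos : Fin r → ι} {vo : List (ι × ι)} {neg : Bool}
    {S : ℕ → ι → ℤ} {i p : ℕ} (hi : i < 2 ^ r) (hpos : ∀ j s, S j (pos s) = bitSign s j)
    (hptr : ∀ s, S i (ptr s) = bitSign s p) (hp : p ≤ i) (c : ι) :
    (ptrHead ptr pos vo neg).read S i c = (if neg then -1 else 1) * route vo (S p) c := by
  rw [HeadSpec.read, (ptrHead_spec vo neg hi hpos hptr hp).1]; rfl

@[simp] theorem sum_ite_and_eq {m m' : ℕ} (k : Fin m) (s : Fin m') (f : Fin m → Fin m' → ℤ) :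
    ∑ k', ∑ s', (if k = k' ∧ s = s' then f k' s' else 0) = f k s := by
  rw [Finset.sum_eq_single k, Finset.sum_eq_single s]
  · simp
  · intro b _ hb; simp [hb.symm]
  · simp
  · intro b _ hb; simp [hb.symm]
  · simp

theorem Runs.finRange {n m : ℕ} {l : Fin m → LayerSpec ι} {S : ℕ → ℕ → ι → ℤ}
    (h : ∀ e : Fin m, (l e).Step n (S e) (S (e + 1))) :
    Runs n ((List.finRange m).map l) (S 0) (S m) := by
  induction m with
  | zero => rfl
  | succ m ih =>
    rw [List.finRange_succ_last, List.map_append, List.map_map]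
    exact (ih fun e => h e.castSucc).append (Runs.single (h (Fin.last m)))

end Assemble

/-! ### Traces and the intended register contents -/

section Simulation

variable {K : ℕ} {Q S G : Type*} {r dQ dG : ℕ}

/-- What is used of the token sequence of a computation: `o` is the position of `<outp>`, `hp` are
the head positions, `ci` is the distance to the last position where all head positions are known
directly, and `dist` is the distance to the last run token. -/
structure Trace (M : TuringMachine K Q S G) (r : ℕ) where
  tok : ℕ → CoTToken K Q S G
  n : ℕ
  o : ℕ
  hp : ℕ → Fin K → ℕ
  ci : ℕ → ℕ
  dist : ℕ → ℕ
  n_le : n ≤ 2 ^ r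
  o_pos : 0 < o
  inp_iff : ∀ i < n, tok i = .inp ↔ i = 0
  outp_iff : ∀ i < n, tok i = .outp ↔ i = o
  act_lt : ∀ i < n, (tok i).isAct → i < o
  ci_base : ∀ i < n, (tok i).isAct → (tok i).isRun = false → ci i = 0
  hp_inpEnd : ∀ i < n, tok i = .inpEnd → hp i = 0
  run_prev : ∀ i < n, (tok i).isRun → 1 ≤ i ∧ (tok (i - 1)).isAct ∧ ci i = ci (i - 1) + 1 ∧ ci i ≤ r
  run_hp : ∀ i < n, ∀ k m, (tok i).move k = some m → hp i k = m.apply (hp (i - 1) k)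
  hp_posEnd : ∀ i < n, tok i = .posEnd → ∀ δ, 0 < δ → δ ≤ r →
    ∀ k, (tok (i - δ)).bitVal k = bitSign (r - δ) (hp i k)
  hp_lt : ∀ i < n, (tok i).isAct → ∀ k, hp i k < 2 ^ r
  dist_relay : ∀ i < n, (tok i).isRelay → 1 ≤ i ∧ dist i = dist (i - 1) + 1
  dist_nonrelay : ∀ i < n, (tok i).isRelay = false → dist i = 0
  dist_le : ∀ i < n, dist i ≤ i
  pos_unique : ∀ i < n, ∀ e < r, ∀ e' < r, tok (i - e) = .pos → tok (i - e') = .pos → e = e'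

namespace Trace

variable {M : TuringMachine K Q S G} (T : Trace M r) (code : Codes Q G dQ dG)

open Classical in
noncomputable def oo (i : ℕ) : ℕ := if T.o ≤ i then T.o else 0

def cpf (i : ℕ) : ℕ := if (T.tok i).isRun then i - 1 else 0

def last (i : ℕ) : ℕ := i - T.dist i

/-- The cell queried by position `i` on tape `k`. -/
def qc (i : ℕ) (k : Fin K) : Option ℕ :=
  if (T.tok i).isAct then some (T.hp i k) else
    if k = M.k0 ∧ T.o ≤ i then some (i - T.o) else none

/-- The cell written by position `j` on tape `k`. -/
def wc (j : ℕ) (k : Fin K) : Option ℕ :=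
  if (T.tok j).isRun then some (T.hp (j - 1) k) else
    if k = M.k0 ∧ (T.tok j).isSym ∧ j < T.o then some (j - 1) else none

noncomputable def st0 (i : ℕ) : Reg K r dQ dG → ℤ
  | .pos s => bitSign s i
  | c => M.tokEmb code (T.tok i) c

noncomputable def st1 (i : ℕ) : Reg K r dQ dG → ℤ
  | .prev s => bitSign s (i - 1)
  | .op s => bitSign s (T.oo i)
  | .out => if T.o ≤ i then 1 else 0
  | .nout => if T.o ≤ i then 0 else 1
  | c => T.st0 code i c

-- After `e` rounds the delay lines show the tokens `2e` and `2e + 1` positions back. Truncated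
-- subtraction does no harm at the beginning: position `0` carries `<inp>`, which is neither a
-- counted delimiter nor a digit token.
open Classical in
noncomputable def stGather (e i : ℕ) : Reg K r dQ dG → ℤ
  | .prev2 s => bitSign s (i - 1 - 1)
  | .cp s => bitSign s (T.cpf i)
  | .rp s => bitSign s (i - min 1 (T.dist i))
  | .d0 a => T.st0 code (i - 2 * e) (.d0 a)
  | .d1 a => T.st0 code (i - 1 - 2 * e) (.d0 a)
  | .H k s => if T.tok i = .posEnd ∧ r - (s : ℕ) < 2 * e
      then T.st0 code (i - (r - s)) (.d0 (some k)) else T.st0 code i (.H k s)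
  | .cnt δ => if (δ : ℕ) < 2 * e then T.st0 code (i - δ) (.d0 none) else 0
  | c => T.st1 code i c

/-- The counter `c` has two roles: run tokens with `ci ≤ c` know their head positions, and from
`<outp>` on the lowest `c` digits of the distance are known, with `bor` the borrow into digit `c`.
-/
noncomputable def stChain (c i : ℕ) : Reg K r dQ dG → ℤ
  | .d0 a => T.st0 code (i - (r + 2)) (.d0 a)
  | .d1 a => T.st0 code (i - 1 - (r + 2)) (.d0 a)
  | .cnt δ => T.st0 code (i - δ) (.d0 none)
  | .H k s => if (T.tok i).isAct ∧ T.ci i ≤ c then bitSign s (T.hp i k) else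
      if k = M.k0 ∧ T.o ≤ i ∧ (s : ℕ) < c then bitSign s (i - T.o) else 0
  | .W k s => if (T.tok i).isRun ∧ T.ci i ≤ c then bitSign s (T.hp (i - 1) k) else 0
  | .bor => if T.o ≤ i ∧ i % 2 ^ c < T.o % 2 ^ c then 1 else -1
  | x => T.stGather code 0 i x

noncomputable def stInput (i : ℕ) : Reg K r dQ dG → ℤ
  | .H k s => optBit s (T.qc i k)
  | .W k s => optBit s (T.wc i k)
  | c => T.stChain code r i c

/-- The last position with the best match. -/
noncomputable def jst (i : ℕ) (k : Fin K) : ℕ :=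
  (contentHead (Reg.H k) (Reg.W k)).att (T.stInput code) i

/-- After `e` rounds the `e` most significant digits are found, and the pointer to the last run
token has advanced by up to `2 ^ e` positions. -/
noncomputable def stSearch (e i : ℕ) : Reg K r dQ dG → ℤ
  | .F k s => if r ≤ s + e then bitSign s (T.jst code i k) else 0
  | .rp s => bitSign s (i - min (2 ^ e) (T.dist i))
  | c => T.stInput code i c

/-- `1` if both digits are equal. -/
def eqBit (a b : ℤ) : ℤ := if a = -1 then (if b = -1 then 1 else 0) else b

noncomputable def stCompare (i : ℕ) : Reg K r dQ dG → ℤ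
  | .FW k s => eqBit (optBit s (T.qc i k)) (optBit s (T.wc (T.jst code i k) k))
  | .HB k s => optBit s (T.qc (T.last i) k)
  | .QC b => T.st0 code (T.last i) (.Qs b)
  | .oP => if T.st0 code i .nh = 1 ∧ T.st0 code (i - r) (.d0 none) = -1 then 1 else 0
  | .go => if T.st0 code i .nh = 1 ∧ T.st0 code (i - r) (.d0 none) = -1 then 0
      else T.st0 code i .go
  | .oPe => if T.st0 code i .bit = 1 ∧ T.st0 code (i - r) (.d0 none) = 1 then 1 else 0
  | c => T.stSearch code r i c

open Classical in
/-- The position from which the symbol is read. -/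
noncomputable def ptr (i : ℕ) (k : Fin K) : ℕ :=
  if ∀ s : Fin r, eqBit (optBit s (T.qc i k)) (optBit s (T.wc (T.jst code i k) k)) = 1
    then T.jst code i k else 0

noncomputable def stRedirect (i : ℕ) : Reg K r dQ dG → ℤ
  | .F k s => bitSign s (T.ptr code i k)
  | .oB k => ∑ e : Fin r, if T.st0 code (i - e) (.d0 none) = 1 then optBit e (T.qc (T.last i) k)
      else 0
  | c => T.stCompare code i c

noncomputable def stRead (i : ℕ) : Reg K r dQ dG → ℤ
  | .SC k b => T.st0 code (T.ptr code i k) (.Y k b)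
  | .oS b => if T.o ≤ i then T.st0 code (T.ptr code i M.k0) (.Y M.k0 b) else 0
  | c => T.stRedirect code i c

noncomputable def stFinal [Fintype Q] [Fintype G] (i : ℕ) (c : Reg K r dQ dG) : ℤ :=
  T.stRead code i c + gateSum (M.deltaLayer code).gates (T.stRead code i) c

theorem tern_tokEmb (v : CoTToken K Q S G) (c : Reg K r dQ dG) : Tern (M.tokEmb code v c) := by
  cases c with
  | d0 a =>
    cases a with
    | none => cases v <;> simp [TuringMachine.tokEmb, CoTToken.delim]
    | some k => cases v <;> simp [TuringMachine.tokEmb, CoTToken.bitVal]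
  | Qs b => simp only [TuringMachine.tokEmb]; cases v.state? M <;> simp
  | Y k b => simp only [TuringMachine.tokEmb]; cases v.symbol? M k <;> simp
  | _ => simp only [TuringMachine.tokEmb] <;> (try split_ifs) <;> simp

theorem tern_st0 (i : ℕ) (c : Reg K r dQ dG) : Tern (T.st0 code i c) := by
  cases c <;> simp only [st0, tern_bitSign] <;> exact tern_tokEmb code _ _

theorem tern_st1 (i : ℕ) (c : Reg K r dQ dG) : Tern (T.st1 code i c) := by
  cases c <;> simp only [st1, tern_bitSign, tern_st0] <;> split_ifs <;> simp

theorem tern_stGather (e i : ℕ) (c : Reg K r dQ dG) : Tern (T.stGather code e i c) := by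
  cases c <;> simp only [stGather, tern_bitSign, tern_st0, tern_st1] <;> split_ifs <;>
    simp [tern_st0]

theorem tern_stChain (e i : ℕ) (c : Reg K r dQ dG) : Tern (T.stChain code e i c) := by
  cases c <;> simp only [stChain, tern_st0, tern_stGather] <;> split_ifs <;> simp

theorem tern_stInput (i : ℕ) (c : Reg K r dQ dG) : Tern (T.stInput code i c) := by
  cases c <;> simp only [stInput, tern_optBit, tern_stChain]

theorem tern_stSearch (e i : ℕ) (c : Reg K r dQ dG) : Tern (T.stSearch code e i c) := by
  cases c <;> simp only [stSearch, tern_bitSign, tern_stInput] <;> split_ifs <;> simp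

theorem tern_eqBit {a b : ℤ} (hb : Tern b) : Tern (eqBit a b) := by
  unfold eqBit; split_ifs <;> simp [hb]

theorem tern_stCompare (i : ℕ) (c : Reg K r dQ dG) : Tern (T.stCompare code i c) := by
  cases c with
  | FW k s => exact tern_eqBit (by simp)
  | _ =>
    simp only [stCompare, tern_optBit, tern_st0, tern_stSearch] <;> split_ifs <;> simp [tern_st0]

theorem st0_delim_eq_one (i : ℕ) :
    T.st0 code i (.d0 none : Reg K r dQ dG) = 1 ↔ T.tok i = .pos := by
  simp only [st0, TuringMachine.tokEmb]
  cases T.tok i <;> simp [CoTToken.delim]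

/-- Only `oB` is a sum of several contributions, and at most one `<p>` stands among the `r`
positions it looks at. -/
theorem tern_stRedirect {i : ℕ} (hi : i < T.n) (c : Reg K r dQ dG) :
    Tern (T.stRedirect code i c) := by
  cases c with
  | oB k =>
    simp only [stRedirect]
    by_cases h : ∃ e : Fin r, T.tok (i - e) = .pos
    · obtain ⟨e, he⟩ := h
      rw [Finset.sum_eq_single e]
      · split_ifs <;> simp
      · intro e' _ hne
        rw [if_neg]
        exact fun h => hne (Fin.ext (T.pos_unique i hi e' e'.2 e e.2
          ((T.st0_delim_eq_one code _).1 h) he))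
      · simp
    · push Not at h
      rw [Finset.sum_eq_zero fun e _ => if_neg fun h' => h e ((T.st0_delim_eq_one code _).1 h')]
      simp
  | _ => simp only [stRedirect, tern_bitSign, tern_stCompare]

theorem tern_stRead {i : ℕ} (hi : i < T.n) (c : Reg K r dQ dG) : Tern (T.stRead code i c) := by
  cases c <;> simp only [stRead, tern_st0, T.tern_stRedirect code hi] <;> split_ifs <;>
    simp [tern_st0]

end Trace

/-! ### Finding `<outp>`, predecessors and delay lines -/

namespace Trace

variable {M : TuringMachine K Q S G} (T : Trace M r) (code : Codes Q G dQ dG)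

open Reg

theorem oo_le (i : ℕ) : T.oo i ≤ i := by
  unfold oo; split_ifs <;> omega

theorem tok_zero (hn : 0 < T.n) : T.tok 0 = .inp := (T.inp_iff 0 hn).2 rfl

/-- The score is `2` at `<outp>`, `1` at `<inp>` and `0` elsewhere, so `<inp>` serves as a unique
fallback before `<outp>` exists. -/
theorem outp_att (vo : List (Reg K r dQ dG × Reg K r dQ dG)) (neg : Bool) {i : ℕ} (hi : i < T.n) :
    (⟨[(one, isOutp), (one, isOutp), (one, isInp)], vo, neg⟩ : HeadSpec _).att (T.st0 code) i
        = T.oo i ∧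
      (⟨[(one, isOutp), (one, isOutp), (one, isInp)], vo, neg⟩ : HeadSpec _).Consistent
        (T.st0 code) i := by
  have ho := T.o_pos
  refine HeadSpec.isLastMax_of_lt (T.oo_le i) fun l hl hne => ?_
  have h1 := T.inp_iff l (by omega)
  have h2 := T.outp_iff l (by omega)
  have h3 := T.inp_iff (T.oo i) (by have := T.oo_le i; omega)
  have h4 := T.outp_iff (T.oo i) (by have := T.oo_le i; omega)
  simp only [HeadSpec.score, st0, TuringMachine.tokEmb, h1, h2, h3, h4, List.map_cons,
    List.map_nil, List.sum_cons, List.sum_nil]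
  unfold oo at *
  split_ifs <;> (try split_ifs at *) <;> omega

theorem step_outp : (TuringMachine.outpLayer : LayerSpec (Reg K r dQ dG)).Step T.n (T.st0 code)
    (T.st1 code) := by
  classical
  refine .of_eq (fun i c => match c with
    | .op s => bitSign s (T.oo i) | .out => if T.o ≤ i then 1 else 0
    | .nout => if T.o ≤ i then -1 else 0 | _ => 0) ?_ ?_ ?_ ?_ ?_ ?_
  · intro i hi h hh
    simp only [TuringMachine.outpLayer, List.mem_cons, List.not_mem_nil, or_false] at hh
    rcases hh with rfl | rfl | rfl <;> exact (T.outp_att code _ _ hi).2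
  · intro i hi c
    have h1 := T.outp_iff (T.oo i) (by have := T.oo_le i; omega)
    have h2 : T.oo i = T.o ↔ T.o ≤ i := by
      have := T.o_pos
      unfold oo; split_ifs <;> omega
    simp only [LayerSpec.attn, TuringMachine.outpLayer, List.map_cons, List.map_nil, List.sum_cons,
      List.sum_nil, HeadSpec.read, (T.outp_att code _ _ hi).1, route_cons, route_nil]
    rw [route_copyList]
    cases c <;> simp [st0, TuringMachine.tokEmb, h1, h2]
  · intro i hi c
    cases c <;> simp only [tern_bitSign, tern_zero] <;> split_ifs <;> simp
  · intro i hi c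
    cases c <;> simp only [add_zero, tern_st0] <;>
      simp [st0, TuringMachine.tokEmb] <;> split_ifs <;> simp
  · intro i _ c; exact T.tern_st1 code i c
  · intro i hi hm c
    have hin : i < 2 ^ r := hi.trans_le T.n_le
    simp only [TuringMachine.outpLayer, gateSum_append]
    rw [gateSum_addGates, gateSum_predGates (o := some i)]
    · simp only [allEq_empty, if_true, route_copyList]
      cases c <;> simp [st0, st1, TuringMachine.tokEmb]
      split_ifs <;> rfl
    · intro a b h; simpa using h
    · simpa using hin
    · intro s; simp [st0]
    · exact fun p _ => hm p.1

theorem step_prev : (TuringMachine.prevLayer : LayerSpec (Reg K r dQ dG)).Step T.n (T.st1 code)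
    (T.stGather code 0) := by
  classical
  have hpos : ∀ j s, T.st1 code j (Reg.pos s) = bitSign s j := fun _ _ => rfl
  refine .of_eq (fun i c => match c with
    | .prev2 s => bitSign s (i - 1 - 1) | .d1 a => T.st0 code (i - 1) (.d0 a) | _ => 0)
    ?_ ?_ ?_ ?_ ?_ ?_
  · intro i hi h hh
    have hin : i < 2 ^ r := hi.trans_le T.n_le
    simp only [TuringMachine.prevLayer, List.mem_cons, List.mem_map] at hh
    rcases hh with rfl | rfl | ⟨k, _, rfl⟩ <;>
      exact (ptrHead_spec _ _ hin hpos (fun s => rfl) (Nat.sub_le i 1)).2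
  · intro i hi c
    have hin : i < 2 ^ r := hi.trans_le T.n_le
    have := fun vo => ptrHead_read (vo := vo) (neg := false) hin hpos
      (ptr := Reg.prev) (p := i - 1) (fun s => rfl) (Nat.sub_le i 1) c
    simp only [LayerSpec.attn, TuringMachine.prevLayer, List.map_cons, List.map_map,
      List.sum_cons, Function.comp_def, this, sum_map_finRange, route_cons, route_nil,
      route_copyList]
    cases c with
    | d1 a => cases a <;> simp [st1]
    | _ => simp [st1]
  · intro i hi c
    cases c <;> simp [T.tern_st0]
  · intro i hi c
    cases c with
    | prev2 s => exact (zero_add (bitSign _ _)).symm ▸ tern_bitSign _ _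
    | d1 a => exact (zero_add (T.st0 code (i - 1) (.d0 a))).symm ▸ T.tern_st0 code _ _
    | _ => simpa only [add_zero] using T.tern_st1 code i _
  · intro i _ c; exact T.tern_stGather code 0 i c
  · intro i hi hm c
    simp only [TuringMachine.prevLayer, gateSum_append]
    have h1 := T.dist_relay i hi
    have h2 := T.dist_nonrelay i hi
    have hd : ∀ s, bitSign s (i - min 1 (T.dist i)) =
        if (T.tok i).isRelay then bitSign s (i - 1) else bitSign s i := by
      intro s
      split_ifs with h
      · rw [min_eq_left (by have := h1 h; omega)]
      · rw [h2 (by simpa using h)]; simp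
    rw [gateSum_addGates, gateSum_addGates, gateSum_addGates]
    · simp only [allEq_singleton, route_copyList]
      cases c <;> simp [st0, st1, stGather, TuringMachine.tokEmb, cpf, hd]
      all_goals split_ifs <;> simp_all
    all_goals exact fun p _ => hm p.1

theorem step_gather (e : ℕ) : (TuringMachine.gatherLayer e : LayerSpec (Reg K r dQ dG)).Step T.n
    (T.stGather code e) (T.stGather code (e + 1)) := by
  classical
  have hpos : ∀ j s, T.stGather code e j (Reg.pos s) = bitSign s j := fun _ _ => rfl
  -- Both delay lines are read from two positions back, which lengthens each delay by `2`.
  have hsub : ∀ i : ℕ, i - 1 - 1 - 2 * e = i - 2 * (e + 1) := fun i => by omega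
  have hsub' : ∀ i : ℕ, i - 1 - 1 - 1 - 2 * e = i - 1 - 2 * (e + 1) := fun i => by omega
  refine .of_eq (fun i c => match c with
    | .e0 a => T.st0 code (i - 2 * (e + 1)) (.d0 a)
    | .e1 a => T.st0 code (i - 1 - 2 * (e + 1)) (.d0 a) | _ => 0)
    ?_ ?_ ?_ ?_ ?_ ?_
  · intro i hi h hh
    have hin : i < 2 ^ r := hi.trans_le T.n_le
    simp only [TuringMachine.gatherLayer, List.mem_cons, List.mem_map] at hh
    rcases hh with rfl | ⟨k, _, rfl⟩ <;>
      exact (ptrHead_spec _ _ hin hpos (fun s => rfl) (by omega : i - 1 - 1 ≤ i)).2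
  · intro i hi c
    have hin : i < 2 ^ r := hi.trans_le T.n_le
    have := fun vo => ptrHead_read (vo := vo) (neg := false) hin hpos
      (ptr := Reg.prev2) (p := i - 1 - 1) (fun s => rfl) (by omega) c
    simp only [LayerSpec.attn, TuringMachine.gatherLayer, List.map_cons, List.map_map,
      List.sum_cons, Function.comp_def, this, sum_map_finRange, route_cons, route_nil]
    cases c with
    | e0 a => cases a <;> simp [stGather, hsub]
    | e1 a => cases a <;> simp [stGather, hsub']
    | _ => simp
  · intro i hi c
    cases c <;> simp [T.tern_st0]
  · intro i hi c
    cases c with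
    | e0 a => exact (zero_add (T.st0 code _ (.d0 a))).symm ▸ T.tern_st0 code _ _
    | e1 a => exact (zero_add (T.st0 code _ (.d0 a))).symm ▸ T.tern_st0 code _ _
    | _ => simpa only [add_zero] using T.tern_stGather code e i _
  · intro i _ c; exact T.tern_stGather code (e + 1) i c
  · intro i hi hm c
    simp only [TuringMachine.gatherLayer, gateSum_append]
    rw [gateSum_addGates, gateSum_addGates, gateSum_addGates, gateSum_subGates]
    · simp only [allEq_singleton, allEq_empty, if_true, route_append, route_flatMap, route_cons,
        route_nil, route_slot, route_cslot]
      cases c with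
      | d0 a => cases a <;> simp [stGather, st1, st0, TuringMachine.tokEmb]
      | d1 a => cases a <;> simp [stGather, st1, st0, TuringMachine.tokEmb]
      | e0 a => cases a <;> simp [stGather, st1, st0, TuringMachine.tokEmb]
      | e1 a => cases a <;> simp [stGather, st1, st0, TuringMachine.tokEmb]
      | cnt δ =>
        simp [stGather, mem_cslot]
        rw [show i - 1 - 2 * e = i - (2 * e + 1) by omega]
        split_ifs <;> first | omega | simp_all
      | H k s =>
        simp [stGather, mem_slot]
        have hp : T.st1 code i (endp : Reg K r dQ dG) = if T.tok i = .posEnd then 1 else 0 := rfl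
        have h0 : T.tok i = .posEnd → T.st0 code i (H k s : Reg K r dQ dG) = 0 := by
          intro h; simp [st0, TuringMachine.tokEmb, h]
        simp only [Finset.sum_add_distrib, ite_and, Finset.sum_ite_irrel, Finset.sum_ite_eq,
          Finset.mem_univ, if_true, Finset.sum_const_zero]
        rw [hp, show i - 1 - 2 * e = i - (2 * e + 1) by omega]
        by_cases hE : T.tok i = .posEnd
        · simp only [hE, if_true, h0 hE]
          split_ifs <;> first | omega | simp_all
        · simp [hE]
      | _ => simp [stGather]
    all_goals exact fun p _ => hm p.1

end Trace

theorem CoTToken.isAct_of_isRun {v : CoTToken K Q S G} (h : v.isRun) : v.isAct := by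
  cases v <;> simp_all [CoTToken.isRun, CoTToken.isAct]

theorem CoTToken.exists_move {v : CoTToken K Q S G} (h : v.isRun) (k : Fin K) :
    ∃ m, v.move k = some m := by
  cases v <;> simp_all [CoTToken.isRun, CoTToken.move]

theorem CoTToken.move_eq_none {v : CoTToken K Q S G} (h : v.isRun = false) (k : Fin K) :
    v.move k = none := by
  cases v <;> simp_all [CoTToken.isRun, CoTToken.move]

open Reg

-- In `±1` coding the difference digit, the parity of two digits and the borrow, is the product of
-- the three signs.
open Classical in
theorem TuringMachine.gateSum_rippleGates (M : TuringMachine K Q S G) (s : Fin r)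
    {x : Reg K r dQ dG → ℤ} (h1 : x (pos s) = 1 ∨ x (pos s) = -1)
    (h2 : x (op s) = 1 ∨ x (op s) = -1) (h3 : x bor = 1 ∨ x bor = -1) (c : Reg K r dQ dG) :
    gateSum (M.rippleGates s) x c = if x out = 1 then
      (if c = H M.k0 s then x (pos s) * x (op s) * x bor else 0) +
        (if c = bor then
          if x (pos s) = -1 ∧ x (op s) = 1 ∧ x bor = -1 then 2 else
            if x (pos s) = 1 ∧ x (op s) = -1 ∧ x bor = 1 then -2 else 0
          else 0) else 0 := by
  by_cases ho : x out = 1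
  · simp only [TuringMachine.rippleGates, gateSum_cons, gateSum_nil, Gate.Fires, Gate.effect,
      allEq_insert, allEq_singleton, allEq_empty, ho]
    by_cases hb : c = bor
    · subst hb
      rcases h1 with h1 | h1 <;> rcases h2 with h2 | h2 <;> rcases h3 with h3 | h3 <;>
        simp [h1, h2, h3]
    · rcases h1 with h1 | h1 <;> rcases h2 with h2 | h2 <;> rcases h3 with h3 | h3 <;>
        simp [h1, h2, h3, hb] <;> split_ifs <;> rfl
  · simp [TuringMachine.rippleGates, gateSum_cons, Gate.Fires, ho]

/-! ### Head positions along the trace, and output cells -/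

namespace Trace

variable {M : TuringMachine K Q S G} (T : Trace M r) (code : Codes Q G dQ dG)

/-- The `h` rounds would cover the distances below `r`; one more round is needed for the distance
`r`, by which blocks are closed. At this point exactly the action tokens with `ci = 0` know their
head positions. -/
theorem stGather_eq_stChain {h : ℕ} (hr : r = 2 * h) {i : ℕ} (hi : i < T.n) (c : Reg K r dQ dG) :
    T.stGather code (h + 1) i c = T.stChain code 0 i c := by
  cases c with
  | d0 a => simp only [stGather, stChain]; rw [show 2 * (h + 1) = r + 2 by omega]
  | d1 a => simp only [stGather, stChain]; rw [show 2 * (h + 1) = r + 2 by omega]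
  | cnt δ => simp only [stGather, stChain]; rw [if_pos (by omega)]
  | W k s =>
    simp only [stChain]
    rw [if_neg]
    · simp [stGather, st1, st0, TuringMachine.tokEmb]
    · rintro ⟨h1, h2⟩
      have := T.run_prev i hi h1
      omega
  | bor =>
    simp only [stChain]
    rw [if_neg (by simp [Nat.mod_one])]
    rfl
  | H k s =>
    simp only [stGather, stChain, Nat.not_lt_zero, and_false, if_false]
    have hb := T.ci_base i hi
    by_cases h1 : T.tok i = .posEnd
    · have h2 := T.hp_posEnd i hi h1 (r - s) (by omega) (by omega) k
      have h3 : (T.tok i).isAct = true := by rw [h1]; rfl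
      rw [if_pos ⟨h1, by omega⟩, if_pos ⟨h3, (hb h3 (by rw [h1]; rfl)).le⟩]
      rw [show r - (r - (s : ℕ)) = s by omega] at h2
      exact h2
    · rw [if_neg (by tauto)]
      by_cases h2 : T.tok i = .inpEnd
      · have h3 : (T.tok i).isAct = true := by rw [h2]; rfl
        rw [if_pos ⟨h3, (hb h3 (by rw [h2]; rfl)).le⟩, T.hp_inpEnd i hi h2]
        simp [st0, TuringMachine.tokEmb, h2]
      · rw [if_neg]
        · simp [st0, TuringMachine.tokEmb, h2]
        · rintro ⟨h3, h4⟩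
          have h5 : (T.tok i).isRun = true := by
            revert h1 h2 h3
            cases T.tok i <;> simp [CoTToken.isAct, CoTToken.isRun]
          have := T.run_prev i hi h5
          omega
  | _ => rfl

theorem cpf_le (i : ℕ) : T.cpf i ≤ i := by unfold cpf; split_ifs <;> omega

/-- The number of the cell written by a run token, if already known. -/
def wOpt (c i : ℕ) (k : Fin K) : Option ℕ :=
  if (T.tok i).isRun ∧ T.ci i ≤ c then some (T.hp (i - 1) k) else none

theorem stChain_W (c i : ℕ) (k : Fin K) (s : Fin r) :
    T.stChain code c i (W k s) = optBit s (T.wOpt c i k) := by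
  simp only [stChain, wOpt]; split_ifs <;> rfl

/-- A run token reads from its predecessor, whose `ci` is smaller by one. All other tokens read from
position `0`, where no head position is stored. -/
theorem stChain_cpf (c : ℕ) {i : ℕ} (hi : i < T.n) (k : Fin K) (s : Fin r) :
    T.stChain code c (T.cpf i) (H k s) = optBit s (T.wOpt (c + 1) i k) := by
  simp only [stChain, wOpt]
  unfold cpf
  by_cases h : (T.tok i).isRun
  · obtain ⟨h1, h2, h3, -⟩ := T.run_prev i hi h
    have h4 := T.act_lt (i - 1) (by omega) h2
    simp only [h, if_true, h2, true_and]
    rw [if_neg (by omega : ¬ (k = M.k0 ∧ T.o ≤ i - 1 ∧ (s : ℕ) < c)), h3]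
    simp only [Nat.add_le_add_iff_right]
    split_ifs <;> rfl
  · have h0 : (T.tok 0).isAct = false := by rw [T.tok_zero (by omega)]; rfl
    have ho := T.o_pos
    simp [h, h0, ho.ne']

theorem wOpt_lt {c i : ℕ} (hi : i < T.n) (k : Fin K) : ∀ m ∈ T.wOpt c i k, m < 2 ^ r := by
  intro m hm
  unfold wOpt at hm
  split_ifs at hm with h
  · obtain ⟨h1, h2, -⟩ := T.run_prev i hi h.1
    simp only [Option.mem_def, Option.some.injEq] at hm
    rw [← hm]
    exact T.hp_lt (i - 1) (by omega) h2 k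
  · simp at hm

/-- Overwriting `W` either changes nothing or fills empty registers, so new minus old contents is
ternary. -/
theorem wOpt_cases (c i : ℕ) (k : Fin K) :
    T.wOpt c i k = T.wOpt (c + 1) i k ∨ T.wOpt c i k = none := by
  unfold wOpt
  by_cases h : (T.tok i).isRun ∧ T.ci i ≤ c
  · left; rw [if_pos h, if_pos ⟨h.1, by omega⟩]
  · right; rw [if_neg h]

theorem bitSign_sub (s : ℕ) {i o : ℕ} (h : o ≤ i) : bitSign s (i - o) =
    bitSign s i * bitSign s o * if i % 2 ^ s < o % 2 ^ s then 1 else -1 := by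
  simp only [bitSign_eq, sub_div_mod s h]
  have h1 : i / 2 ^ s % 2 = 0 ∨ i / 2 ^ s % 2 = 1 := by omega
  have h2 : o / 2 ^ s % 2 = 0 ∨ o / 2 ^ s % 2 = 1 := by omega
  rcases h1 with h1 | h1 <;> rcases h2 with h2 | h2 <;> split_ifs <;> simp [h1, h2]

/-- The heads replace `W` by the contents of `H` at the predecessor; then the neurons recompute `H`
of run tokens from `W` and the moves. Independently, one digit of the subtraction is processed. -/
theorem step_chain (s : Fin r) : (M.chainLayer s : LayerSpec (Reg K r dQ dG)).Step T.n
    (T.stChain code s) (T.stChain code (s + 1)) := by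
  classical
  have hpos : ∀ j a, T.stChain code s j (Reg.pos a) = bitSign a j := fun _ _ => rfl
  have hmid : ∀ i < T.n, ∀ c, T.stChain code s i c + (match c with
      | .W k a => optBit a (T.wOpt (s + 1) i k) - optBit a (T.wOpt s i k) | _ => 0) =
      match c with
      | .W k a => optBit a (T.wOpt (s + 1) i k)
      | c => T.stChain code s i c := by
    intro i hi c
    cases c <;> simp [stChain_W]
  refine .of_eq (fun i c => match c with
    | .W k a => optBit a (T.wOpt (s + 1) i k) - optBit a (T.wOpt s i k) | _ => 0)
    ?_ ?_ ?_ ?_ ?_ ?_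
  · intro i hi h hh
    have hin : i < 2 ^ r := hi.trans_le T.n_le
    simp only [TuringMachine.chainLayer, List.mem_append, List.mem_map] at hh
    rcases hh with ⟨k, _, rfl⟩ | ⟨k, _, rfl⟩
    · exact (ptrHead_spec _ _ hin hpos (fun s => rfl) (T.cpf_le i)).2
    · exact (ptrHead_spec _ _ hin hpos (fun s => rfl) le_rfl).2
  · intro i hi c
    have hin : i < 2 ^ r := hi.trans_le T.n_le
    have h1 := fun vo => ptrHead_read (vo := vo) (neg := false) hin hpos
      (ptr := Reg.cp) (p := T.cpf i) (fun s => rfl) (T.cpf_le i) c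
    have h2 := fun vo => ptrHead_read (vo := vo) (neg := true) hin hpos
      (ptr := Reg.pos) (p := i) (fun s => rfl) le_rfl c
    simp only [LayerSpec.attn, TuringMachine.chainLayer, List.map_append, List.map_map,
      List.sum_append, Function.comp_def, h1, h2, sum_map_finRange, route_copyList]
    cases c <;> simp [T.stChain_cpf code s hi, stChain_W, sub_eq_add_neg]
  · intro i hi c
    cases c with
    | W k a => rcases T.wOpt_cases s i k with h | h <;> simp [h]
    | _ => simp
  · intro i hi c
    rw [hmid i hi]
    cases c <;> simp [T.tern_stChain]
  · intro i _ c; exact T.tern_stChain code _ i c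
  · intro i hi hm c
    have hx' : ∀ c, Tern _ := fun c => hmid i hi c ▸ hm c
    rw [funext (hmid i hi)]
    set x : Reg K r dQ dG → ℤ := fun c => match c with
      | .W k a => optBit a (T.wOpt (s + 1) i k)
      | c => T.stChain code s i c with hx
    have hxW : ∀ k a, x (W k a) = optBit a (T.wOpt (s + 1) i k) := fun _ _ => rfl
    simp only [TuringMachine.chainLayer, gateSum_append, gateSum_flatMap_finRange]
    rw [M.gateSum_rippleGates s (bitSign_cases _ _) (bitSign_cases _ _)
      (by simp only [hx, stChain]; split_ifs <;> simp)]
    have hk : ∀ k, gateSum (addGates ∅ (copyList (W k) (H k))) x c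
        + gateSum (succGates {mR k} (W k) (H k)) x c + gateSum (predGates {mL k} (W k) (H k)) x c
        + gateSum (subGates {isRun} (copyList (H k) (H k))) x c =
        ∑ a, if c = H k a then optBit a (T.wOpt (s + 1) i k)
          + (if x (mR k) = 1 then optBit a ((T.wOpt (s + 1) i k).map (· + 1))
              - optBit a (T.wOpt (s + 1) i k) else 0)
          + (if x (mL k) = 1 then optBit a ((T.wOpt (s + 1) i k).map (· - 1))
              - optBit a (T.wOpt (s + 1) i k) else 0)
          + (if x isRun = 1 then - x (H k a) else 0) else 0 := by
      intro k
      rw [gateSum_addGates, gateSum_subGates, gateSum_succGates (o := T.wOpt (s + 1) i k),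
        gateSum_predGates (o := T.wOpt (s + 1) i k)]
      · simp only [allEq_empty, allEq_singleton, if_true, route_copyList, hxW]
        by_cases hr : x isRun = 1
        · simp only [hr, if_true, ← Finset.sum_add_distrib, ← Finset.sum_neg_distrib]
          refine Finset.sum_congr rfl fun a _ => ?_
          by_cases hc : c = H k a <;> simp [hc]
        · simp only [hr, if_false, add_zero, ← Finset.sum_add_distrib]
          refine Finset.sum_congr rfl fun a _ => ?_
          by_cases hc : c = H k a <;> simp [hc]
      · intro a b h; simpa using h
      · exact T.wOpt_lt hi k
      · exact hxW k
      · exact hxW k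
      · exact fun p _ => hx' p.1
      · exact fun p _ => hx' p.1
    rw [Finset.sum_congr rfl fun k _ => hk k]
    clear hk
    have hxR : ∀ k, x (mR k) = if (T.tok i).move k = some .right then 1 else 0 := fun _ => rfl
    have hxL : ∀ k, x (mL k) = if (T.tok i).move k = some .left then 1 else 0 := fun _ => rfl
    have hxr : x isRun = if (T.tok i).isRun then 1 else 0 := rfl
    have hxo : x out = if T.o ≤ i then 1 else 0 := rfl
    have hxp : x (pos s) = bitSign s i := rfl
    have hxH : ∀ k a, x (H k a) = T.stChain code s i (H k a) := fun _ _ => rfl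
    have hxb : x bor = if T.o ≤ i ∧ i % 2 ^ (s : ℕ) < T.o % 2 ^ (s : ℕ) then 1 else -1 := rfl
    have hxop : T.o ≤ i → x (op s) = bitSign s T.o := by
      intro h
      change bitSign s (T.oo i) = _
      rw [oo, if_pos h]
    rw [hmid i hi]
    cases c with
    | bor =>
      simp only [reduceCtorEq, if_false, Finset.sum_const_zero, zero_add, if_true, hxo, hxp, hxb]
      by_cases ho : T.o ≤ i
      · simp only [ho, true_and, if_true, stChain, hxop ho, mod_pow_succ_lt s]
        have h1 : i / 2 ^ (s : ℕ) % 2 = 0 ∨ i / 2 ^ (s : ℕ) % 2 = 1 := by omega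
        have h2 : T.o / 2 ^ (s : ℕ) % 2 = 0 ∨ T.o / 2 ^ (s : ℕ) % 2 = 1 := by omega
        rcases h1 with h1 | h1 <;> rcases h2 with h2 | h2 <;>
          by_cases h3 : i % 2 ^ (s : ℕ) < T.o % 2 ^ (s : ℕ) <;> simp [bitSign_eq, h1, h2, h3]
      · simp [ho, stChain]
    | H k a =>
      simp only [H.injEq, reduceCtorEq, if_false, add_zero, sum_ite_and_eq, hxR, hxL, hxr, hxo, hxp,
        hxH, hxb]
      by_cases hR : (T.tok i).isRun
      · obtain ⟨h1, h2, h3, h4⟩ := T.run_prev i hi hR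
        obtain ⟨m, hm⟩ := CoTToken.exists_move hR k
        have hA := CoTToken.isAct_of_isRun hR
        -- Run tokens stand before `<outp>`, so the two uses of the registers `H` do not interfere.
        have ho : ¬ T.o ≤ i := by have := T.act_lt i hi hA; omega
        simp only [hR, hm, wOpt, stChain, hA, ho, T.run_hp i hi k m hm]
        by_cases hc : T.ci i ≤ s + 1
        · cases m <;> simp [hc, HeadMove.apply]
        · have : ¬ T.ci i ≤ s := by omega
          simp [hc, this]
      · have hN := CoTToken.move_eq_none (by simpa using hR) k
        simp only [hR, hN, wOpt, stChain]
        by_cases hA : (T.tok i).isAct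
        · have ho : ¬ T.o ≤ i := by have := T.act_lt i hi hA; omega
          simp [hA, T.ci_base i hi hA (by simpa using hR), ho]
        · simp only [hA]
          by_cases ho : T.o ≤ i
          · simp only [ho, hxop ho, bitSign_sub a ho]
            by_cases hk : k = M.k0
            · by_cases has : a = s
              · subst has; simp [hk]
              · have : (a : ℕ) ≠ s := fun h => has (Fin.ext h)
                simp [hk, has]
                split_ifs <;> omega
            · simp [hk]
          · simp [ho]
    | W k a => simp [stChain_W]
    | _ => simp [stChain]

end Trace

/-! ### Search for the last write access, and pointer doubling -/

namespace Trace

variable {M : TuringMachine K Q S G} (T : Trace M r) (code : Codes Q G dQ dG)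

open Reg

theorem ci_le {i : ℕ} (hi : i < T.n) (h : (T.tok i).isAct) : T.ci i ≤ r := by
  by_cases hR : (T.tok i).isRun
  · exact (T.run_prev i hi hR).2.2.2
  · rw [T.ci_base i hi h (by simpa using hR)]; exact Nat.zero_le r

theorem stInput_eq_stSearch (i : ℕ) (c : Reg K r dQ dG) :
    T.stInput code i c = T.stSearch code 0 i c := by
  cases c with
  | F k s =>
    simp only [stSearch]
    rw [if_neg (by omega)]
    rfl
  | _ => rfl

theorem step_input : (M.inputLayer : LayerSpec (Reg K r dQ dG)).Step T.n
    (T.stChain code r) (T.stSearch code 0) := by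
  classical
  refine LayerSpec.Step.congr (S' := T.stInput code) ?_ fun i _ c => T.stInput_eq_stSearch code i c
  refine .of_gates rfl (fun i _ c => T.tern_stChain code r i c)
    (fun i _ c => T.tern_stInput code i c) fun i hi c => ?_
  simp only [TuringMachine.inputLayer]
  rw [gateSum_addGates _ _ fun p _ => T.tern_stChain code r i p.1]
  have h1 : T.stChain code r i (sym : Reg K r dQ dG) = if (T.tok i).isSym then 1 else 0 := rfl
  have h2 : T.stChain code r i (nout : Reg K r dQ dG) = if T.o ≤ i then 0 else 1 := rfl
  have h3 : ∀ s, T.stChain code r i (prev s : Reg K r dQ dG) = bitSign s (i - 1) := fun _ => rfl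
  simp only [allEq_insert, allEq_singleton, route_copyList, h1, h2, h3]
  cases c with
  | H k s =>
    simp only [stInput, stChain, qc, reduceCtorEq, if_false, Finset.sum_const_zero, ite_self,
      add_zero]
    by_cases hA : (T.tok i).isAct
    · simp [hA, T.ci_le hi hA]
    · simp only [hA]
      split_ifs <;> simp_all
  | W k s =>
    simp only [stInput, stChain, wc, W.injEq]
    by_cases hR : (T.tok i).isRun
    · have hS : (T.tok i).isSym = false := by
        revert hR; cases T.tok i <;> simp [CoTToken.isRun, CoTToken.isSym]
      simp [hR, hS, T.ci_le hi (CoTToken.isAct_of_isRun hR)]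
    · simp only [hR]
      by_cases hk : k = M.k0
      · by_cases hS : (T.tok i).isSym <;> by_cases ho : T.o ≤ i <;> simp [hk, hS, ho]
        all_goals first | (rw [if_pos (by omega)]; rfl) | (rw [if_neg (by omega)]; rfl)
      · simp [hk]
  | _ => simp [stInput]

theorem last_add {i : ℕ} (hi : i < T.n) : ∀ m ≤ T.dist i, T.dist (i - m) = T.dist i - m := by
  intro m
  induction m with
  | zero => simp
  | succ m ih =>
    intro hm
    have h1 := ih (by omega)
    have h2 := T.dist_relay (i - m) (by omega)
    have h3 := T.dist_nonrelay (i - m) (by omega)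
    by_cases hR : (T.tok (i - m)).isRelay
    · have := h2 hR
      rw [show i - (m + 1) = i - m - 1 by omega]
      omega
    · have := h3 (by simpa using hR)
      omega

/-- The first jump shortens the remaining distance by its own length, so two jumps bounded by `2 ^
e` compose to one bounded by `2 ^ (e + 1)`. -/
theorem jump {i : ℕ} (hi : i < T.n) (e : ℕ) :
    (i - min (2 ^ e) (T.dist i)) - min (2 ^ e) (T.dist (i - min (2 ^ e) (T.dist i))) =
      i - min (2 ^ (e + 1)) (T.dist i) := by
  rw [T.last_add hi _ (min_le_right _ _), pow_succ]
  omega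

theorem jst_le (i : ℕ) (k : Fin K) : T.jst code i k ≤ i := HeadSpec.att_le _ _ _

/-- The search changes neither `H` nor `W`, so its target stays the same in all rounds. -/
theorem contentHead_att_stSearch (e i : ℕ) (k : Fin K) :
    (contentHead (Reg.H k) (Reg.W k)).att (T.stSearch code e) i = T.jst code i k := by
  refine HeadSpec.IsLastMax.att_eq ?_
  have := (contentHead (Reg.H k) (Reg.W k)).att_spec (T.stInput code) i
  simp only [HeadSpec.IsLastMax, contentHead_score] at this ⊢
  exact this

theorem step_search (hr : Even r) (e : Fin r) :
    (M.searchLayer e.rev : LayerSpec (Reg K r dQ dG)).Step T.n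
    (T.stSearch code e) (T.stSearch code (e + 1)) := by
  classical
  have hpos : ∀ j a, T.stSearch code e j (Reg.pos a) = bitSign a j := fun _ _ => rfl
  have hspec : ∀ i < T.n, ∀ k, (searchHead (Reg.H k) (Reg.W k) (Reg.F k) Reg.pos Reg.one
      e.rev).Consistent (T.stSearch code e) i ∧
      bitSign e.rev ((searchHead (Reg.H k) (Reg.W k) (Reg.F k) Reg.pos Reg.one e.rev).att
        (T.stSearch code e) i) = bitSign e.rev (T.jst code i k) := by
    intro i hi k
    rw [← T.contentHead_att_stSearch code e i k]
    refine searchHead_spec (hi.trans_le T.n_le) hpos rfl (fun j _ => even_sum_optBit hr _ _) ?_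
    intro a ha
    rw [T.contentHead_att_stSearch]
    have := Fin.lt_def.1 ha
    simp only [Fin.val_rev] at this
    simp only [stSearch]
    rw [if_pos (by omega)]
  refine .of_eq (fun i c => match c with
    | .FW k s => if k = M.k0 then bitSign s (i - min (2 ^ (e + 1 : ℕ)) (T.dist i)) else 0
    | .F k s => if s = e.rev then bitSign s (T.jst code i k) else 0 | _ => 0)
    ?_ ?_ ?_ ?_ ?_ ?_
  · intro i hi h hh
    simp only [TuringMachine.searchLayer, List.mem_cons, List.mem_map] at hh
    rcases hh with rfl | ⟨k, _, rfl⟩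
    · exact (ptrHead_spec _ _ (hi.trans_le T.n_le) hpos (fun s => rfl) (Nat.sub_le _ _)).2
    · exact (hspec i hi k).1
  · intro i hi c
    have h1 := fun vo => ptrHead_read (vo := vo) (neg := false) (hi.trans_le T.n_le) hpos
      (ptr := Reg.rp) (p := i - min (2 ^ (e : ℕ)) (T.dist i)) (fun s => rfl) (Nat.sub_le _ _) c
    have h2 : ∀ k, (searchHead (Reg.H k) (Reg.W k) (Reg.F k) Reg.pos Reg.one e.rev).read
        (T.stSearch code e) i c = if c = F k e.rev then bitSign e.rev (T.jst code i k) else 0 := by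
      intro k
      rw [← (hspec i hi k).2]
      simp [HeadSpec.read, searchHead, hpos]
    simp only [LayerSpec.attn, TuringMachine.searchLayer, List.map_cons, List.map_map,
      List.sum_cons, Function.comp_def, h1, h2, sum_map_finRange, route_copyList]
    cases c with
    | FW k s =>
      by_cases hk : k = M.k0
      · simp [stSearch, hk, T.jump hi]
      · simp [hk]
    | F k s =>
      by_cases hs : s = e.rev
      · simp [hs]
      · simp [hs]
    | _ => simp
  · intro i hi c
    cases c <;> simp <;> split_ifs <;> simp
  · intro i hi c
    cases c with
    | FW k s =>
      simp only
      have : T.stSearch code e i (FW k s : Reg K r dQ dG) = 0 := rfl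
      rw [this]; split_ifs <;> simp
    | F k s =>
      simp only [stSearch]
      by_cases hs : s = e.rev
      · rw [if_neg (by rw [hs, Fin.val_rev]; omega)]; simp [hs]
      · simp only [hs, if_false, add_zero]; split_ifs <;> simp
    | _ => simpa only [add_zero] using T.tern_stSearch code e i _
  · intro i _ c; exact T.tern_stSearch code (e + 1) i c
  · intro i hi hm c
    have h0 : ∀ e k s, T.stSearch code e i (FW k s : Reg K r dQ dG) = 0 := fun _ _ _ => rfl
    have h1 : ∀ k s, T.stInput code i (FW k s : Reg K r dQ dG) = 0 := fun _ _ => rfl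
    simp only [TuringMachine.searchLayer, gateSum_append]
    rw [gateSum_addGates, gateSum_subGates, gateSum_subGates]
    · simp only [allEq_empty, if_true, route_copyList]
      cases c with
      | FW k s =>
        by_cases hk : k = M.k0
        · simp [h0, hk]
        · simp [h0, hk]
      | rp s => simp [h1, stSearch]
      | F k s =>
        simp only [stSearch]
        by_cases hs : s = e.rev
        · rw [if_neg (c := r ≤ s + e) (by rw [hs, Fin.val_rev]; omega), if_pos]
          · simp [hs]
          · rw [hs, Fin.val_rev]; omega
        · have : (s : ℕ) ≠ r - (e + 1) := fun h => hs (Fin.ext (by rw [Fin.val_rev]; exact h))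
          have : r ≤ s + (e + 1) ↔ r ≤ s + e := by omega
          simp [hs, this]
      | _ => simp [stSearch]
    all_goals exact fun p _ => hm p.1

end Trace

/-! ### Comparison, redirection and reading of symbols -/

namespace Trace

variable {M : TuringMachine K Q S G} (T : Trace M r) (code : Codes Q G dQ dG)

open Reg

theorem last_le (i : ℕ) : T.last i ≤ i := Nat.sub_le _ _

/-- The distance is at most `i < 2 ^ r`, so `r` doublings exhaust it. -/
theorem stSearch_last {i : ℕ} (hi : i < T.n) (s : Fin r) :
    T.stSearch code r i (rp s) = bitSign s (T.last i) := by
  simp only [stSearch, last]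
  rw [min_eq_right]
  exact (T.dist_le i hi).trans (hi.trans_le T.n_le).le

theorem stSearch_F (i : ℕ) (k : Fin K) (s : Fin r) :
    T.stSearch code r i (F k s) = bitSign s (T.jst code i k) := by
  simp only [stSearch]
  rw [if_pos (by omega)]

theorem step_compare : (TuringMachine.compareLayer : LayerSpec (Reg K r dQ dG)).Step T.n
    (T.stSearch code r) (T.stCompare code) := by
  classical
  have hpos : ∀ j a, T.stSearch code r j (Reg.pos a) = bitSign a j := fun _ _ => rfl
  refine .of_eq (fun i c => match c with
    | .FW k s => optBit s (T.wc (T.jst code i k) k)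
    | .HB k s => optBit s (T.qc (T.last i) k)
    | .QC b => T.st0 code (T.last i) (.Qs b) | _ => 0)
    ?_ ?_ ?_ ?_ ?_ ?_
  · intro i hi h hh
    have hin := hi.trans_le T.n_le
    simp only [TuringMachine.compareLayer, List.mem_cons, List.mem_append, List.mem_map] at hh
    rcases hh with rfl | ⟨k, _, rfl⟩ | ⟨k, _, rfl⟩
    · exact (ptrHead_spec _ _ hin hpos (T.stSearch_last code hi) (T.last_le i)).2
    · exact (ptrHead_spec _ _ hin hpos (T.stSearch_F code i k) (T.jst_le code i k)).2
    · exact (ptrHead_spec _ _ hin hpos (T.stSearch_last code hi) (T.last_le i)).2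
  · intro i hi c
    have hin := hi.trans_le T.n_le
    have h1 := fun vo => ptrHead_read (vo := vo) (neg := false) hin hpos
      (T.stSearch_last code hi) (T.last_le i) c
    have h2 := fun k vo => ptrHead_read (vo := vo) (neg := false) hin hpos
      (T.stSearch_F code i k) (T.jst_le code i k) c
    simp only [LayerSpec.attn, TuringMachine.compareLayer, List.map_cons, List.map_append,
      List.map_map, List.sum_cons, List.sum_append, Function.comp_def, h1, h2, sum_map_finRange,
      route_copyList]
    cases c <;> simp [stSearch, stInput, stChain, stGather, st1]
  · intro i hi c
    cases c <;> simp [T.tern_st0]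
  · intro i hi c
    cases c with
    | FW k s => exact (zero_add (optBit _ _)).symm ▸ tern_optBit _ _
    | HB k s => exact (zero_add (optBit _ _)).symm ▸ tern_optBit _ _
    | QC b => exact (zero_add (T.st0 code _ (Qs b))).symm ▸ T.tern_st0 code _ _
    | _ => simpa only [add_zero] using T.tern_stSearch code r i _
  · intro i _ c; exact T.tern_stCompare code i c
  · intro i hi hm c
    set x : Reg K r dQ dG → ℤ := fun c => T.stSearch code r i c + (match c with
      | .FW k s => optBit s (T.wc (T.jst code i k) k)
      | .HB k s => optBit s (T.qc (T.last i) k)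
      | .QC b => T.st0 code (T.last i) (.Qs b) | _ => 0) with hx
    have hFW : ∀ k s, x (FW k s) = optBit s (T.wc (T.jst code i k) k) := fun k s => zero_add _
    have hH : ∀ k s, x (H k s) = optBit s (T.qc i k) := fun k s => add_zero _
    have hcnt : x (cnt (Fin.last r)) = T.st0 code (i - r) (d0 none : Reg K r dQ dG) :=
      add_zero _
    have hnh : x nh = T.st0 code i (nh : Reg K r dQ dG) := add_zero _
    have hbit : x bit = T.st0 code i (bit : Reg K r dQ dG) := add_zero _
    have hk : ∀ k s, gateSum [(⟨∅, {H k s, FW k s}, {FW k s}, ∅⟩ : Gate (Reg K r dQ dG)),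
        ⟨∅, {H k s, FW k s}, {FW k s}, ∅⟩, ⟨{FW k s}, {H k s}, ∅, {FW k s}⟩] x c =
        if c = FW k s then eqBit (x (H k s)) (x (FW k s)) - x (FW k s) else 0 := by
      intro k s
      simp only [gateSum_cons, gateSum_nil, Gate.Fires, Gate.effect, allEq_insert, allEq_singleton,
        allEq_empty, eqBit]
      by_cases hc : c = FW k s
      · rcases hm (FW k s) with h | h | h <;> change x (FW k s) = _ at h <;>
          by_cases h' : x (H k s) = -1 <;> simp [h, h', hc]
      · simp [hc]
    simp only [TuringMachine.compareLayer, gateSum_append, gateSum_flatMap_finRange, hk]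
    simp only [gateSum_cons, gateSum_nil, Gate.Fires, Gate.effect, allEq_insert, allEq_singleton,
      allEq_empty, hcnt, hnh, hbit, hFW, hH]
    cases c with
    | FW k s => simp [stCompare, stSearch, stInput, stChain, stGather, st1, st0,
        TuringMachine.tokEmb]
    | HB k s => simp [stCompare, stSearch, stInput, stChain, stGather, st1, st0,
        TuringMachine.tokEmb]
    | QC b => simp [stCompare, stSearch, stInput, stChain, stGather, st1, st0,
        TuringMachine.tokEmb]
    | go =>
      have h1 : T.stSearch code r i (go : Reg K r dQ dG) = T.st0 code i go := rfl
      -- Wherever `go` can be decremented it is `1`, so it drops to `0`.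
      have h2 : T.st0 code i (nh : Reg K r dQ dG) = 1 → T.st0 code i (go : Reg K r dQ dG) = 1 := by
        simp only [st0, TuringMachine.tokEmb]
        cases T.tok i <;> simp [CoTToken.notHalt, CoTToken.isAct]
      simp only [stCompare, h1]
      by_cases h : T.st0 code i (nh : Reg K r dQ dG) = 1
      · simp [h, h2 h]; split_ifs <;> rfl
      · simp [h]
    | oP =>
      have h1 : T.stSearch code r i (oP : Reg K r dQ dG) = 0 := rfl
      simp [stCompare, h1]
    | oPe =>
      have h1 : T.stSearch code r i (oPe : Reg K r dQ dG) = 0 := rfl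
      simp [stCompare, h1]
    | _ => simp [stCompare]

theorem ptr_le (i : ℕ) (k : Fin K) : T.ptr code i k ≤ i := by
  unfold ptr; split_ifs
  · exact T.jst_le code i k
  · exact Nat.zero_le i

theorem step_redirect : (TuringMachine.redirectLayer : LayerSpec (Reg K r dQ dG)).Step T.n
    (T.stCompare code) (T.stRedirect code) := by
  classical
  refine .of_gates rfl (fun i _ c => T.tern_stCompare code i c)
    (fun i hi c => T.tern_stRedirect code hi c) fun i hi c => ?_
  have hFW : ∀ k s, T.stCompare code i (FW k s) =
    eqBit (optBit s (T.qc i k)) (optBit s (T.wc (T.jst code i k) k)) := fun _ _ => rfl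
  have hF : ∀ k s, T.stCompare code i (F k s) = bitSign s (T.jst code i k) := T.stSearch_F code i
  have hk : ∀ k, gateSum (subGates ∅ (copyList (F k) (F k)) ++
      [⟨∅, ∅, ∅, Finset.univ.image (F k)⟩] ++
      addGates (Finset.univ.image (FW k)) (copyList (F k) (F k)) ++
      [⟨Finset.univ.image (FW k), ∅, Finset.univ.image (F k), ∅⟩]) (T.stCompare code i) c =
      ∑ s, if c = F k s then bitSign s (T.ptr code i k) - bitSign s (T.jst code i k) else 0 := by
    intro k
    have hsum : ∀ f : Fin r → ℤ, (∑ s, if c = F k s then f s else 0) =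
        if h : ∃ s, c = F k s then f h.choose else 0 := by
      intro f
      split_ifs with h
      · have := h.choose_spec
        rw [Finset.sum_eq_single h.choose, if_pos this]
        · intro b _ hb
          rw [if_neg]
          intro h'
          rw [this] at h'
          exact hb (by simpa using h'.symm)
        · simp
      · push Not at h
        exact Finset.sum_eq_zero fun s _ => if_neg (h s)
    simp only [gateSum_append]
    rw [gateSum_addGates _ _ fun p _ => T.tern_stCompare code i p.1,
      gateSum_subGates _ _ fun p _ => T.tern_stCompare code i p.1]
    simp only [gateSum_cons, gateSum_nil, Gate.Fires, Gate.effect, allEq_image_univ, hFW,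
      allEq_empty, route_copyList, ptr, hF, hsum, Finset.mem_image, Finset.mem_univ, true_and,
      and_true, if_true, Finset.notMem_empty, if_false, eq_comm (b := c)]
    by_cases h : ∃ s, c = F k s
    · simp only [h, if_true, dif_pos]
      split_ifs <;> simp <;> ring
    · simp only [h, if_false, dif_neg, not_false_eq_true]
      simp
  have hcnt : ∀ e : Fin r, T.stCompare code i (cnt e.castSucc) =
    T.st0 code (i - e) (d0 none : Reg K r dQ dG) := fun _ => rfl
  have hHB : ∀ k s, T.stCompare code i (HB k s) = optBit s (T.qc (T.last i) k) := fun _ _ => rfl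
  simp only [TuringMachine.redirectLayer, gateSum_append, gateSum_flatMap_finRange] at hk ⊢
  simp only [hk]
  simp only [gateSum_addGates _ _ fun p _ => T.tern_stCompare code i p.1, allEq_singleton, hcnt,
    route_cons, route_nil, add_zero, hHB]
  cases c with
  | F k s => simp [stRedirect, hF]
  | oB k =>
    have h1 : T.stCompare code i (oB k) = 0 := rfl
    simp only [stRedirect, h1, zero_add, reduceCtorEq, if_false, Finset.sum_const_zero, oB.injEq]
    rw [Finset.sum_eq_single k]
    · simp
    · intro b _ hb; simp [hb.symm]
    · simp
  | _ => simp [stRedirect]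

theorem step_read : (M.readLayer : LayerSpec (Reg K r dQ dG)).Step T.n
    (T.stRedirect code) (T.stRead code) := by
  classical
  have hpos : ∀ j a, T.stRedirect code j (Reg.pos a) = bitSign a j := fun _ _ => rfl
  refine .of_eq (fun i c => match c with
    | .SC k b => T.st0 code (T.ptr code i k) (.Y k b) | _ => 0)
    ?_ ?_ ?_ ?_ ?_ ?_
  · intro i hi h hh
    simp only [TuringMachine.readLayer, List.mem_map] at hh
    obtain ⟨k, _, rfl⟩ := hh
    exact (ptrHead_spec _ _ (hi.trans_le T.n_le) hpos (fun _ => rfl) (T.ptr_le code i k)).2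
  · intro i hi c
    have h1 := fun k vo => ptrHead_read (vo := vo) (neg := false) (ptr := F k)
      (hi.trans_le T.n_le) hpos (fun _ => rfl) (T.ptr_le code i k) c
    simp only [LayerSpec.attn, TuringMachine.readLayer, List.map_map, Function.comp_def, h1,
      sum_map_finRange, route_copyList]
    cases c with
    | SC k b => simp; rfl
    | _ => simp
  · intro i hi c
    cases c <;> simp [T.tern_st0]
  · intro i hi c
    cases c with
    | SC k b => exact (zero_add (T.st0 code _ (Y k b))).symm ▸ T.tern_st0 code _ _
    | _ => simpa only [add_zero] using T.tern_stRedirect code hi _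
  · intro i hi c; exact T.tern_stRead code hi c
  · intro i hi hm c
    simp only [TuringMachine.readLayer]
    rw [gateSum_addGates _ _ fun p _ => hm p.1]
    have h1 : T.stRedirect code i (out : Reg K r dQ dG) = if T.o ≤ i then 1 else 0 := rfl
    have h2 : ∀ k b, T.stRedirect code i (SC k b : Reg K r dQ dG) = 0 := fun _ _ => rfl
    have h3 : ∀ b, T.stRedirect code i (oS b : Reg K r dQ dG) = 0 := fun _ => rfl
    simp only [allEq_singleton, route_copyList, h1, h2, zero_add, add_zero]
    cases c with
    | SC k b => simp [stRead, h2]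
    | oS b =>
      by_cases ho : T.o ≤ i <;> simp [stRead, h3, ho]
    | _ => simp [stRead]

end Trace

/-! ### The transition function as a layer of neurons -/

section Delta

variable {M : TuringMachine K Q S G} {code : Codes Q G dQ dG}

open Reg

theorem allEq_codeSet {ι : Type*} [DecidableEq ι] {m : ℕ} {u : Fin m → ℤˣ} {f : Fin m → ι}
    {x : ι → ℤ} : (AllEq (codeSet u f 1) x 1 ∧ AllEq (codeSet u f (-1)) x (-1)) ↔
      ∀ b, x (f b) = u b := by
  simp only [AllEq, codeSet, Finset.forall_mem_image, Finset.mem_filter, Finset.mem_univ,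
    true_and]
  constructor
  · rintro ⟨h1, h2⟩ b
    rcases Int.units_eq_one_or (u b) with h | h
    · rw [h1 h, h]; rfl
    · rw [h2 h, h]; rfl
  · intro h
    exact ⟨fun b hb => by rw [h, hb]; rfl, fun b hb => by rw [h, hb]; rfl⟩

theorem allEq_biUnion {ι : Type*} [DecidableEq ι] {m : ℕ} {P : Fin m → Finset ι}
    {x : ι → ℤ} {v : ℤ} : AllEq (Finset.univ.biUnion P) x v ↔ ∀ k, AllEq (P k) x v := by
  simp only [AllEq, Finset.mem_biUnion, Finset.mem_univ, true_and]
  exact ⟨fun h k c hc => h c ⟨k, hc⟩, fun h c ⟨k, hc⟩ => h k c hc⟩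

theorem deltaGate_fires {p : Q × (Fin K → G)} {x : Reg K r dQ dG → ℤ} :
    (M.deltaGate code p).Fires x ↔ x go = 1 ∧ (∀ b, x (QC b) = code.Q p.1 b) ∧
      ∀ k b, x (SC k b) = code.G (p.2 k) b := by
  classical
  simp only [Gate.Fires, TuringMachine.deltaGate, allEq_insert, allEq_union, allEq_biUnion,
    ← allEq_codeSet (f := QC), ← allEq_codeSet (f := SC _), forall_and]
  tauto

/-- By injectivity of the codes, at most one neuron of the layer is active, so the sum of the
effects has at most one term. -/
theorem deltaGate_fires_unique {p p' : Q × (Fin K → G)} {x : Reg K r dQ dG → ℤ}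
    (h : (M.deltaGate code p).Fires x) (h' : (M.deltaGate code p').Fires x) : p = p' := by
  rw [deltaGate_fires] at h h'
  refine Prod.ext (code.Q_inj (funext fun b => ?_))
    (funext fun k => code.G_inj (funext fun b => ?_))
  · exact Units.ext ((h.2.1 b).symm.trans (h'.2.1 b))
  · exact Units.ext ((h.2.2 k b).symm.trans (h'.2.2 k b))

theorem mem_codeSet {ι : Type*} [DecidableEq ι] {m : ℕ} {u : Fin m → ℤˣ} {f : Fin m → ι} {v : ℤˣ}
    {c : ι} : c ∈ codeSet u f v ↔ ∃ b, u b = v ∧ f b = c := by simp [codeSet]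

open Classical in
theorem deltaGate_effect (p : Q × (Fin K → G)) (c : Reg K r dQ dG) :
    (M.deltaGate code p).effect c = match c with
      | oOut => if p.1 = M.qhalt then 1 else 0
      | oQ b => if p.1 = M.qhalt then 0 else (code.Q (M.δ p.1 p.2).1 b : ℤ)
      | oY k b => if p.1 = M.qhalt then 0 else (code.G ((M.δ p.1 p.2).2.1 k) b : ℤ)
      | oM k b => if p.1 = M.qhalt then 0 else (code.M ((M.δ p.1 p.2).2.2 k) b : ℤ)
      | _ => 0 := by
  have hu : ∀ u : ℤˣ, ((if u = 1 then 1 else 0) - if u = -1 then 1 else 0 : ℤ) = u := by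
    intro u
    rcases Int.units_eq_one_or u with h | h <;> rw [h] <;> decide
  by_cases hq : p.1 = M.qhalt
  · cases c <;> simp [Gate.effect, TuringMachine.deltaGate, hq]
  · simp only [Gate.effect, TuringMachine.deltaGate, hq, if_false, Finset.mem_union,
      Finset.mem_biUnion, mem_codeSet, Finset.mem_univ, true_and]
    cases c <;> simp [hu]

variable [Fintype Q] [Fintype G]

open Classical in
theorem gateSum_deltaLayer (x : Reg K r dQ dG → ℤ) (c : Reg K r dQ dG) :
    gateSum (M.deltaLayer code).gates x c =
      if h : ∃ p, (M.deltaGate code p).Fires x then (M.deltaGate code h.choose).effect c else 0 := by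
  rw [gateSum, TuringMachine.deltaLayer, List.map_map, Finset.sum_map_toList]
  split_ifs with h
  · rw [Finset.sum_eq_single h.choose]
    · simp [h.choose_spec]
    · intro p _ hp
      simp only [Function.comp]
      rw [if_neg fun h' => hp (deltaGate_fires_unique h' h.choose_spec)]
    · simp
  · push Not at h
    exact Finset.sum_eq_zero fun p _ => if_neg (h p)

theorem gateSum_deltaLayer_of_fires {x : Reg K r dQ dG → ℤ} {p : Q × (Fin K → G)}
    (h : (M.deltaGate code p).Fires x) (c : Reg K r dQ dG) :
    gateSum (M.deltaLayer code).gates x c = (M.deltaGate code p).effect c := by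
  have h' : ∃ p, (M.deltaGate code p).Fires x := ⟨p, h⟩
  rw [gateSum_deltaLayer, dif_pos h', deltaGate_fires_unique h'.choose_spec h]

theorem gateSum_deltaLayer_of_go {x : Reg K r dQ dG → ℤ} (h : x go ≠ 1) (c : Reg K r dQ dG) :
    gateSum (M.deltaLayer code).gates x c = 0 := by
  rw [gateSum_deltaLayer, dif_neg]
  rintro ⟨p, hp⟩
  exact h (deltaGate_fires.1 hp).1

end Delta

namespace Trace

variable {M : TuringMachine K Q S G} (T : Trace M r) (code : Codes Q G dQ dG)
variable [Fintype Q] [Fintype G]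

open Reg

theorem step_delta : (M.deltaLayer code : LayerSpec (Reg K r dQ dG)).Step T.n
    (T.stRead code) (T.stFinal code) := by
  refine .of_gates rfl (fun i hi c => T.tern_stRead code hi c) (fun i hi c => ?_)
    fun i hi c => rfl
  simp only [stFinal]
  by_cases h : ∃ p, (M.deltaGate code p).Fires (T.stRead code i)
  · obtain ⟨p, hp⟩ := h
    rw [gateSum_deltaLayer_of_fires hp, deltaGate_effect]
    -- The registers written by the active neuron are still empty, so the result is ternary.
    have h1 : T.stRead code i oOut = 0 := rfl
    have h2 : ∀ b, T.stRead code i (oQ b) = 0 := fun _ => rfl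
    have h3 : ∀ k b, T.stRead code i (oY k b) = 0 := fun _ _ => rfl
    have h4 : ∀ k b, T.stRead code i (oM k b) = 0 := fun _ _ => rfl
    cases c with
    | oOut => simp only [h1]; split_ifs <;> simp
    | oQ b => simp only [h2]; split_ifs <;> simp
    | oY k b => simp only [h3]; split_ifs <;> simp
    | oM k b => simp only [h4]; split_ifs <;> simp
    | _ => simpa only [add_zero] using T.tern_stRead code hi _
  · rw [gateSum_deltaLayer, dif_neg h, add_zero]
    exact T.tern_stRead code hi c

theorem runs_program {h : ℕ} (hr : r = 2 * h) :
    Runs T.n (M.program code h) (T.st0 code) (T.stFinal code) := by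
  have h1 : Runs T.n [TuringMachine.outpLayer, TuringMachine.prevLayer] (T.st0 code)
      (T.stGather code 0) := ⟨_, T.step_outp code, _, T.step_prev code, rfl⟩
  have h2 : Runs T.n ((List.range (h + 1)).map TuringMachine.gatherLayer) (T.stGather code 0)
      (T.stChain code 0) := by
    rw [List.range_succ, List.map_append]
    exact (Runs.range fun e _ => T.step_gather code e).append
      (.single ((T.step_gather code h).congr fun i hi c => T.stGather_eq_stChain code hr hi c))
  have h3 : Runs T.n ((List.finRange r).map M.chainLayer) (T.stChain code 0) (T.stChain code r) :=
    Runs.finRange fun e => T.step_chain code e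
  have h4 : Runs T.n ((List.finRange r).map fun s => M.searchLayer s.rev) (T.stSearch code 0)
      (T.stSearch code r) :=
    Runs.finRange fun e => T.step_search code (hr ▸ even_two_mul h) e
  exact ((((h1.append h2).append h3).append (.single (T.step_input code))).append h4).append
    ⟨_, T.step_compare code, _, T.step_redirect code, _, T.step_read code, _,
      T.step_delta code, rfl⟩

end Trace

/-! ### Sizes of the layers -/

section Fits

variable {dff dv : ℕ} {M : TuringMachine K Q S G} {code : Codes Q G dQ dG}

open Reg

theorem Reg.pos_injective : Function.Injective (pos : Fin r → Reg K r dQ dG) :=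
  fun _ _ h => by simpa using h

/-- The index `s` itself is missing; this saving is what gives `4r - 1` in `d_k`. -/
theorem length_filter_lt (s : Fin r) : ((List.finRange r).filter (s < ·)).length ≤ r - 1 := by
  rcases Nat.eq_zero_or_pos r with rfl | hr
  · exact s.elim0
  · have h : ((List.finRange r).filter (s < ·)).length ≠ (List.finRange r).length := by
      intro h
      have := List.filter_eq_self.1 (List.length_filter_eq_length_iff.1 h |> List.filter_eq_self.2) s
        (by simp)
      simp at this
    have := List.length_filter_le (s < ·) (List.finRange r)
    rw [List.length_finRange] at *
    omega

theorem sum_map_le {α : Type*} (l : List α) (f : α → ℕ) (b : ℕ) (h : ∀ a ∈ l, f a ≤ b) :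
    (l.map f).sum ≤ l.length * b := by
  induction l with
  | nil => simp
  | cons a l ih =>
    have h1 := h a (by simp)
    have h2 := ih fun x hx => h x (by simp [hx])
    simp only [List.map_cons, List.sum_cons, List.length_cons]
    linarith [add_mul l.length 1 b]

theorem fits_ptrHead (ptr : Fin r → Reg K r dQ dG) {vo : List (Reg K r dQ dG × Reg K r dQ dG)}
    (neg : Bool) (hvo : vo.length ≤ dv) (hn : (vo.map Prod.snd).Nodup) (hr : 4 ≤ r) :
    (ptrHead ptr pos vo neg).qk.length ≤ 4 * r - 1 ∧ (ptrHead ptr pos vo neg).vo.length ≤ dv ∧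
      ((ptrHead ptr pos vo neg).vo.map Prod.snd).Nodup := by
  refine ⟨?_, hvo, hn⟩
  simp only [ptrHead, List.length_map, List.length_finRange]
  omega

theorem fits_of_heads {l : LayerSpec (Reg K r dQ dG)} {dk H : ℕ} (h1 : l.gates.length ≤ dff)
    (h2 : l.heads.length ≤ H) (h3 : ∀ h ∈ l.heads, h.qk.length ≤ dk ∧ h.vo.length ≤ dv ∧
      (h.vo.map Prod.snd).Nodup) : l.Fits dff dk dv H :=
  ⟨h1, h2, fun h hh => (h3 h hh).1, fun h hh => (h3 h hh).2.1, fun h hh => (h3 h hh).2.2⟩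

variable (hK : 0 < K) (hr : 4 ≤ r) (h1 : 18 * r + 2 ≤ dff) (h2 : 14 * K * r + 2 * r ≤ dff)
  (hv : r ≤ dv)

include hK hr h1 hv in
theorem fits_outpLayer :
    (TuringMachine.outpLayer : LayerSpec (Reg K r dQ dG)).Fits dff (4 * r - 1) dv (3 * K) := by
  refine fits_of_heads ?_ ?_ ?_
  · simp only [TuringMachine.outpLayer, List.length_append, length_addGates, length_copyList,
      length_predGates]
    omega
  · simp [TuringMachine.outpLayer]; omega
  · intro h hh
    simp only [TuringMachine.outpLayer, List.mem_cons, List.not_mem_nil, or_false] at hh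
    rcases hh with rfl | rfl | rfl
    · refine ⟨by simp; omega, by simpa using hv, nodup_copyList fun a b h => by simpa using h⟩
    · exact ⟨by simp; omega, by simp; omega, by simp⟩
    · exact ⟨by simp; omega, by simp; omega, by simp⟩

include hK hr h1 hv in
theorem fits_prevLayer :
    (TuringMachine.prevLayer : LayerSpec (Reg K r dQ dG)).Fits dff (4 * r - 1) dv (3 * K) := by
  refine fits_of_heads ?_ ?_ ?_
  · simp only [TuringMachine.prevLayer, List.length_append, length_addGates, length_copyList]
    omega
  · simp [TuringMachine.prevLayer]; omega
  · intro h hh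
    simp only [TuringMachine.prevLayer, List.mem_cons, List.mem_map] at hh
    rcases hh with rfl | rfl | ⟨k, _, rfl⟩
    · exact fits_ptrHead _ _ (by simpa using hv) (nodup_copyList fun a b h => by simpa using h) hr
    · exact fits_ptrHead _ _ (by simp; omega) (by simp) hr
    · exact fits_ptrHead _ _ (by simp; omega) (by simp) hr

include hK hr h2 hv in
theorem fits_gatherLayer (e : ℕ) : (TuringMachine.gatherLayer e : LayerSpec (Reg K r dQ dG)).Fits
    dff (4 * r - 1) dv (3 * K) := by
  refine fits_of_heads ?_ ?_ ?_
  · have ha : ((List.finRange K).map fun _ =>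
        (slot r (2 * e)).length + (slot r (2 * e + 1)).length).sum ≤ K * 2 := by
      have := sum_map_le (List.finRange K) (fun _ =>
        (slot r (2 * e)).length + (slot r (2 * e + 1)).length) 2 fun _ _ => by
          have := length_slot_le r (2 * e)
          have := length_slot_le r (2 * e + 1)
          omega
      simpa using this
    have hb := length_cslot_le (r + 1) (2 * e)
    have hc := length_cslot_le (r + 1) (2 * e + 1)
    have hd : K * 4 ≤ K * r := Nat.mul_le_mul_left K hr
    simp only [TuringMachine.gatherLayer, List.length_append, length_addGates, length_subGates,
      List.length_map, List.length_flatMap, List.length_cons, List.length_nil] at ha ⊢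
    rw [mul_assoc] at h2
    simp only [List.map_const', List.sum_replicate, List.length_finRange, smul_eq_mul] at ha ⊢
    omega
  · simp [TuringMachine.gatherLayer]; omega
  · intro h hh
    simp only [TuringMachine.gatherLayer, List.mem_cons, List.mem_map] at hh
    rcases hh with rfl | ⟨k, _, rfl⟩
    · exact fits_ptrHead _ _ (by simp; omega) (by simp) hr
    · exact fits_ptrHead _ _ (by simp; omega) (by simp) hr

include hK hr h2 hv in
-- There are `K(12r + 2) + 10` neurons; `r ≥ 4` and `K ≥ 1` bring this below `14Kr + 2r`.
theorem fits_chainLayer (s : Fin r) : (M.chainLayer s : LayerSpec (Reg K r dQ dG)).Fits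
    dff (4 * r - 1) dv (3 * K) := by
  refine fits_of_heads ?_ ?_ ?_
  · have hd : K * 4 ≤ K * r := Nat.mul_le_mul_left K hr
    simp only [TuringMachine.chainLayer, List.length_append, length_addGates, length_subGates,
      length_succGates, length_predGates, TuringMachine.rippleGates, length_copyList,
      List.length_flatMap, List.length_cons, List.length_nil]
    simp only [List.map_const', List.sum_replicate, List.length_finRange, smul_eq_mul]
    rw [mul_assoc] at h2
    ring_nf at h2 ⊢
    omega
  · simp [TuringMachine.chainLayer]; omega
  · intro h hh
    simp only [TuringMachine.chainLayer, List.mem_append, List.mem_map] at hh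
    rcases hh with ⟨k, _, rfl⟩ | ⟨k, _, rfl⟩ <;>
      exact fits_ptrHead _ _ (by simpa using hv) (nodup_copyList fun a b h => by simpa using h) hr

include h1 in
theorem fits_inputLayer : (M.inputLayer : LayerSpec (Reg K r dQ dG)).Fits
    dff (4 * r - 1) dv (3 * K) := by
  refine fits_of_heads ?_ (by simp [TuringMachine.inputLayer]) (by simp [TuringMachine.inputLayer])
  simp only [TuringMachine.inputLayer, length_addGates, length_copyList]
  omega

include hK hr h1 hv in
theorem fits_searchLayer (s : Fin r) : (M.searchLayer s : LayerSpec (Reg K r dQ dG)).Fits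
    dff (4 * r - 1) dv (3 * K) := by
  refine fits_of_heads ?_ ?_ ?_
  · simp only [TuringMachine.searchLayer, List.length_append, length_addGates, length_subGates,
      length_copyList]
    omega
  · simp [TuringMachine.searchLayer]; omega
  · intro h hh
    simp only [TuringMachine.searchLayer, List.mem_cons, List.mem_map] at hh
    rcases hh with rfl | ⟨k, _, rfl⟩
    · exact fits_ptrHead _ _ (by simpa using hv) (nodup_copyList fun a b h => by simpa using h) hr
    · refine ⟨?_, by simp [searchHead]; omega, by simp [searchHead]⟩
      have := length_filter_lt s
      simp only [searchHead, List.length_append, List.length_map, List.length_finRange,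
        List.length_cons, List.length_nil]
      omega

include hK hr h2 hv in
theorem fits_compareLayer (hQ : dQ ≤ dv) :
    (TuringMachine.compareLayer : LayerSpec (Reg K r dQ dG)).Fits dff (4 * r - 1) dv (3 * K) := by
  refine fits_of_heads ?_ ?_ ?_
  · simp only [TuringMachine.compareLayer, List.length_append, List.length_flatMap,
      List.length_cons, List.length_nil, List.map_const', List.sum_replicate,
      List.length_finRange, smul_eq_mul]
    rw [mul_assoc] at h2
    ring_nf at h2 ⊢
    omega
  · simp [TuringMachine.compareLayer]; omega
  · intro h hh
    simp only [TuringMachine.compareLayer, List.mem_cons, List.mem_append, List.mem_map] at hh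
    rcases hh with rfl | ⟨k, _, rfl⟩ | ⟨k, _, rfl⟩
    · exact fits_ptrHead _ _ (by simpa using hQ) (nodup_copyList fun a b h => by simpa using h) hr
    · exact fits_ptrHead _ _ (by simpa using hv) (nodup_copyList fun a b h => by simpa using h) hr
    · exact fits_ptrHead _ _ (by simpa using hv) (nodup_copyList fun a b h => by simpa using h) hr

include hr h2 in
theorem fits_redirectLayer : (TuringMachine.redirectLayer : LayerSpec (Reg K r dQ dG)).Fits
    dff (4 * r - 1) dv (3 * K) := by
  refine fits_of_heads ?_ (by simp [TuringMachine.redirectLayer])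
    (by simp [TuringMachine.redirectLayer])
  have hd : K * 4 ≤ K * r := Nat.mul_le_mul_left K hr
  simp only [TuringMachine.redirectLayer, List.length_append, List.length_flatMap,
    List.length_cons, List.length_nil, List.map_const', List.sum_replicate, length_addGates,
    length_subGates, length_copyList, List.length_finRange, smul_eq_mul]
  rw [mul_assoc] at h2
  ring_nf at h2 hd ⊢
  omega

include hr in
theorem fits_readLayer (hG : dG ≤ dv) (hG' : 2 * dG ≤ dff) :
    (M.readLayer : LayerSpec (Reg K r dQ dG)).Fits dff (4 * r - 1) dv (3 * K) := by
  refine fits_of_heads ?_ ?_ ?_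
  · simpa [TuringMachine.readLayer] using hG'
  · simp [TuringMachine.readLayer]; omega
  · intro h hh
    simp only [TuringMachine.readLayer, List.mem_map] at hh
    obtain ⟨k, _, rfl⟩ := hh
    exact fits_ptrHead _ _ (by simpa using hG) (nodup_copyList fun a b h => by simpa using h) hr

theorem fits_deltaLayer [Fintype Q] [Fintype G] {dk H : ℕ}
    (h : Fintype.card Q * Fintype.card G ^ K ≤ dff) :
    (M.deltaLayer code : LayerSpec (Reg K r dQ dG)).Fits dff dk dv H := by
  classical
  refine fits_of_heads ?_ (by simp [TuringMachine.deltaLayer]) (by simp [TuringMachine.deltaLayer])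
  simpa [TuringMachine.deltaLayer] using h

include hK hr h1 h2 hv in
theorem fits_program [Fintype Q] [Fintype G] (m : ℕ) (hQ : dQ ≤ dv) (hG : dG ≤ dv)
    (hG' : 2 * dG ≤ dff) (h3 : Fintype.card Q * Fintype.card G ^ K ≤ dff) :
    ∀ l ∈ M.program (r := r) code m, l.Fits dff (4 * r - 1) dv (3 * K) := by
  intro l hl
  simp only [TuringMachine.program, List.mem_append, List.mem_cons, List.not_mem_nil, or_false,
    List.mem_map] at hl
  rcases hl with ((((((rfl | rfl) | ⟨e, _, rfl⟩) | ⟨s, _, rfl⟩) | rfl) | ⟨s, _, rfl⟩) |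
    (rfl | rfl | rfl | rfl))
  · exact fits_outpLayer hK hr h1 hv
  · exact fits_prevLayer hK hr h1 hv
  · exact fits_gatherLayer hK hr h2 hv e
  · exact fits_chainLayer hK hr h2 hv s
  · exact fits_inputLayer h1
  · exact fits_searchLayer hK hr h1 hv _
  · exact fits_compareLayer hK hr h2 hv hQ
  · exact fits_redirectLayer hr h2
  · exact fits_readLayer hr hG hG'
  · exact fits_deltaLayer h3

end Fits

/-! ### Unembedding -/

section Readout

variable (M : TuringMachine K Q S G) (code : Codes Q G dQ dG)

open Reg

theorem tern_tokUnemb (v : CoTToken K Q S G) (c : Reg K r dQ dG) : Tern (M.tokUnemb code v c) := by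
  cases v <;> cases c <;> simp [TuringMachine.tokUnemb]

/-- The registers which are used by the unembedding. -/
def Reg.IsOutput : Reg K r dQ dG → Prop
  | oQ _ | oY _ _ | oM _ _ | oB _ | oS _ | out | oOut | oP | oPe => True
  | _ => False

theorem tokUnemb_eq_zero (v : CoTToken K Q S G) {c : Reg K r dQ dG} (hc : ¬ c.IsOutput) :
    M.tokUnemb code v c = 0 := by
  cases c <;> simp [Reg.IsOutput] at hc <;> cases v <;> simp [TuringMachine.tokUnemb]

theorem exists_ne_of_injective {A : Type*} {m : ℕ} {f : A → Fin m → ℤˣ}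
    (hf : Function.Injective f) {a a' : A} (h : a ≠ a') :
    ∃ b, ((f a b : ℤˣ) : ℤ) ≠ 0 ∧ ((f a' b : ℤˣ) : ℤ) ≠ f a b := by
  obtain ⟨b, hb⟩ := Function.ne_iff.1 (hf.ne h)
  exact ⟨b, (f a b).ne_zero, fun h' => hb (Units.ext h'.symm)⟩

/-- Tokens of different kinds are separated by a register which is nonzero only for the kind of `v`;
tokens of the same kind by injectivity of the codes. The register `out` and the digits of moves are
always present, even if the codes of symbols or states were empty. -/
theorem exists_tokUnemb_ne {v v' : CoTToken K Q S G} (h1 : v ≠ .inp) (h2 : v ≠ .inpEnd)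
    (hne : v' ≠ v) : ∃ c : Reg K r dQ dG, M.tokUnemb code v c ≠ 0 ∧
      M.tokUnemb code v' c ≠ M.tokUnemb code v c := by
  have hG := fun {a a'} => exists_ne_of_injective code.G_inj (a := a) (a' := a')
  cases v with
  | inp => exact absurd rfl h1
  | inpEnd => exact absurd rfl h2
  | outp => exact ⟨oOut, by cases v' <;> simp_all [TuringMachine.tokUnemb]⟩
  | pos => exact ⟨oP, by cases v' <;> simp_all [TuringMachine.tokUnemb]⟩
  | posEnd => exact ⟨oPe, by cases v' <;> simp_all [TuringMachine.tokUnemb]⟩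
  | outpEnd =>
    cases v' with
    | sym a =>
      obtain ⟨b, h3, h4⟩ := hG (M.blank_ne a).symm
      exact ⟨oS b, h3, h4⟩
    | outpEnd => exact absurd rfl hne
    | _ => exact ⟨out, by simp [TuringMachine.tokUnemb]⟩
  | sym a =>
    cases v' with
    | sym a' =>
      obtain ⟨b, h3, h4⟩ := hG (a := M.incl a) (a' := M.incl a') fun h => hne (by
        rw [M.incl.injective h])
      exact ⟨oS b, h3, h4⟩
    | outpEnd =>
      obtain ⟨b, h3, h4⟩ := hG (M.blank_ne a)
      exact ⟨oS b, h3, h4⟩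
    | _ => exact ⟨out, by simp [TuringMachine.tokUnemb]⟩
  | bits b =>
    cases v' with
    | bits b' =>
      obtain ⟨k, h3, h4⟩ := exists_ne_of_injective (f := id) (fun _ _ h => h) (a := b) (a' := b')
        fun h => hne (by rw [h])
      exact ⟨oB k, h3, h4⟩
    | _ => exact ⟨oB M.k0, (b M.k0).ne_zero, (b M.k0).ne_zero.symm⟩
  | run q y Δ =>
    cases v' with
    | run q' y' Δ' =>
      by_cases hq : q = q'
      · by_cases hy : y = y'
        · have hΔ : Δ ≠ Δ' := fun h => hne (by rw [hq, hy, h])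
          obtain ⟨k, hk⟩ := Function.ne_iff.1 hΔ
          obtain ⟨b, h3, h4⟩ := exists_ne_of_injective code.M_inj hk
          exact ⟨oM k b, h3, h4⟩
        · obtain ⟨k, hk⟩ := Function.ne_iff.1 hy
          obtain ⟨b, h3, h4⟩ := hG hk
          exact ⟨oY k b, h3, h4⟩
      · obtain ⟨b, h3, h4⟩ := exists_ne_of_injective code.Q_inj hq
        exact ⟨oQ b, h3, h4⟩
    | _ => exact ⟨oM M.k0 0, (code.M _ 0).ne_zero, (code.M _ 0).ne_zero.symm⟩

/-- If the output registers contain the code of a token, this token has the best score. -/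
theorem readout_lt {v v' : CoTToken K Q S G} (h1 : v ≠ .inp) (h2 : v ≠ .inpEnd)
    (hne : v' ≠ v) {y : Reg K r dQ dG → ℤ} (hy : ∀ c, c.IsOutput → y c = M.tokUnemb code v c) :
    ∑ c, M.tokUnemb code v' c * y c < ∑ c, M.tokUnemb code v c * y c := by
  have hy' : ∀ c, M.tokUnemb code v c = 0 ∨ y c = M.tokUnemb code v c := fun c => by
    by_cases hc : c.IsOutput
    · exact .inr (hy c hc)
    · exact .inl (tokUnemb_eq_zero M code v hc)
  have hy0 : ∀ c, M.tokUnemb code v c = 0 → M.tokUnemb code v' c * y c = 0 := fun c h => by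
    by_cases hc : c.IsOutput
    · rw [hy c hc, h, mul_zero]
    · rw [tokUnemb_eq_zero M code v' hc, zero_mul]
  obtain ⟨c₀, h3, h4⟩ := exists_tokUnemb_ne (r := r) M code h1 h2 hne
  -- On the support of the code of `v`, ternary entries satisfy `a' * a ≤ a * a` with equality only
  -- for `a' = a`; off the support both terms vanish.
  refine Finset.sum_lt_sum (fun c _ => ?_) ⟨c₀, Finset.mem_univ _, ?_⟩
  · rcases hy' c with h | h
    · rw [hy0 c h, h, zero_mul]
    · rw [h]
      rcases tern_tokUnemb M code v c with h5 | h5 | h5 <;>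
        rcases tern_tokUnemb M code v' c with h6 | h6 | h6 <;> rw [h5, h6] <;> norm_num
  · rcases hy' c₀ with h | h
    · exact absurd h h3
    · rw [h]
      revert h3 h4
      rcases tern_tokUnemb M code v c₀ with h5 | h5 | h5 <;>
        rcases tern_tokUnemb M code v' c₀ with h6 | h6 | h6 <;> rw [h5, h6] <;> norm_num

end Readout

/-! ## Positions in the token sequence -/

namespace TuringMachine

variable (M : TuringMachine K Q S G) (r : ℕ) (w : List S)

/-- The token of index `e` after the prompt, unless the computation has ended. -/
def traceTok (e : ℕ) : CoTToken K Q S G :=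
  if e % (2 * r + 2) < r then M.runTok w (r * (e / (2 * r + 2)) + e % (2 * r + 2)) else
    if e % (2 * r + 2) = r then .pos else
      if e % (2 * r + 2) ≤ 2 * r then .bits fun k =>
        signBit (e % (2 * r + 2) - (r + 1)) ((M.run w (r * (e / (2 * r + 2) + 1))).head k)
      else .posEnd

/-- The number of steps made up to the token of index `e` after the prompt. -/
def traceStep (e : ℕ) : ℕ :=
  if e % (2 * r + 2) < r then r * (e / (2 * r + 2)) + e % (2 * r + 2) + 1
    else r * (e / (2 * r + 2) + 1)

/-- The number of tokens for `t` steps. -/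
def traceLen (t : ℕ) : ℕ := t + t / r * (r + 2)

variable {r}

/-- The trace has period `2r + 2`: `r` run tokens, and the `r + 2` tokens of a block of head
positions. -/
theorem traceLen_add (hr : 0 < r) (t a : ℕ) (ha : t % r + a < 2 * r + 2) :
    (traceLen r t + a) / (2 * r + 2) = t / r ∧ (traceLen r t + a) % (2 * r + 2) = t % r + a := by
  have h := Nat.div_add_mod t r
  have : traceLen r t + a = (2 * r + 2) * (t / r) + (t % r + a) := by
    unfold traceLen
    generalize t / r = q at *
    generalize t % r = f at *
    subst h
    ring
  rw [this, Nat.mul_add_div (by omega), Nat.mul_add_mod, Nat.mod_eq_of_lt ha, Nat.div_eq_of_lt ha]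
  simp

/-- The block after the last step is kept here, which makes the pattern periodic and the induction
possible. -/
theorem flatMap_eq_traceTok (hr : 0 < r) (t : ℕ) :
    ((List.range t).flatMap fun i =>
      M.runTok w i :: if r ∣ i + 1 then M.posBlock r w (i + 1) else []) =
      (List.range (traceLen r t)).map (M.traceTok r w) := by
  induction t with
  | zero => simp [traceLen]
  | succ t ih =>
    have hlt := Nat.mod_lt t hr
    have hdm := Nat.div_add_mod t r
    have h0 : M.traceTok r w (traceLen r t) = M.runTok w t := by
      obtain ⟨h1, h2⟩ := traceLen_add hr t 0 (by omega)
      simp only [add_zero] at h1 h2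
      rw [traceTok, h1, h2, if_pos hlt, hdm]
    rw [List.range_succ, List.flatMap_append, ih, List.flatMap_singleton]
    by_cases hd : r ∣ t + 1
    · rw [if_pos hd]
      have h1 : (t + 1) / r = t / r + 1 := Nat.succ_div_of_dvd hd
      have h3 : t % r = r - 1 := by
        obtain ⟨c, hc⟩ := hd
        have h5 : c = t / r + 1 := by
          rw [← h1, hc, Nat.mul_div_cancel_left _ hr]
        rw [h5, mul_add, mul_one] at hc
        omega
      have h4 : r * (t / r + 1) = t + 1 := by rw [mul_add, mul_one]; omega
      have h2 : traceLen r (t + 1) = traceLen r t + (r + 1 + 1 + 1) := by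
        unfold traceLen; rw [h1]; ring
      rw [h2, List.range_add, List.map_append, List.map_map]
      congr 1
      rw [List.range_succ_eq_map, List.range_succ_eq_map, List.range_succ]
      simp only [List.map_cons, List.map_map, List.map_append, List.map_nil, Function.comp_def,
        posBlock, add_zero, h0]
      congr 1
      have ha := fun a (ha : a < r + 2) => traceLen_add hr t (a + 1) (by omega)
      congr 1
      · obtain ⟨h5, h6⟩ := ha 0 (by omega)
        simp only [traceTok, Nat.succ_eq_add_one, h6]
        rw [if_neg (by omega), if_pos (by omega)]
      congr 1
      · refine List.map_congr_left fun s hs => ?_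
        rw [List.mem_range] at hs
        obtain ⟨h5, h6⟩ := ha (s + 1) (by omega)
        simp only [traceTok, Nat.succ_eq_add_one, h6, h5]
        rw [if_neg (by omega), if_neg (by omega), if_pos (by omega), h4]
        congr 3
        funext k
        congr 1
        omega
      · obtain ⟨h5, h6⟩ := ha (r + 1) (by omega)
        simp only [traceTok, Nat.succ_eq_add_one, h6]
        rw [if_neg (by omega), if_neg (by omega), if_neg (by omega)]
    · rw [if_neg hd]
      have h2 : traceLen r (t + 1) = traceLen r t + 1 := by
        unfold traceLen; rw [Nat.succ_div_of_not_dvd hd]; ring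
      rw [h2, List.range_succ, List.map_append]
      simp [h0]

/-- Without a block after the last step, the trace ends with the run token of index `traceLen r t`.
-/
theorem traceToks_eq (hr : 0 < r) (t : ℕ) :
    M.traceToks r w (t + 1) = (List.range (traceLen r t + 1)).map (M.traceTok r w) := by
  have h0 : M.traceTok r w (traceLen r t) = M.runTok w t := by
    obtain ⟨h1, h2⟩ := traceLen_add hr t 0 (by have := Nat.mod_lt t hr; omega)
    simp only [add_zero] at h1 h2
    rw [traceTok, h1, h2, if_pos (Nat.mod_lt t hr), Nat.div_add_mod]
  rw [traceToks, List.range_succ, List.flatMap_append, List.flatMap_singleton, List.range_succ,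
    List.map_append, ← flatMap_eq_traceTok M w hr]
  simp only [ne_eq, not_true_eq_false, and_false, if_false, List.map_cons, List.map_nil, h0]
  congr 1
  rw [List.flatMap_def, List.flatMap_def]
  congr 1
  refine List.map_congr_left fun i hi => ?_
  rw [List.mem_range] at hi
  simp only [Nat.add_right_cancel_iff, hi.ne, not_false_eq_true, and_true]

end TuringMachine

/-! ### Division by the period -/

section DivMod

theorem sub_div_mod_of_le {N e δ : ℕ} (h : δ ≤ e % N) :
    (e - δ) / N = e / N ∧ (e - δ) % N = e % N - δ := by
  rcases Nat.eq_zero_or_pos N with rfl | hN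
  · simp
  have h1 := Nat.div_add_mod e N
  have h2 := Nat.mod_lt e hN
  have h3 : e - δ = N * (e / N) + (e % N - δ) := by omega
  have h4 : e % N - δ < N := by omega
  rw [h3, Nat.mul_add_div hN, Nat.mul_add_mod, Nat.div_eq_of_lt h4, Nat.mod_eq_of_lt h4]
  simp

theorem pred_div_mod_of_mod_eq_zero {N e : ℕ} (hN : 0 < N) (h : e % N = 0) (he : 0 < e) :
    (e - 1) / N + 1 = e / N ∧ (e - 1) % N = N - 1 := by
  have h1 := Nat.div_add_mod e N
  rw [h, add_zero] at h1
  obtain ⟨q, hq⟩ : ∃ q, e / N = q + 1 := Nat.exists_eq_succ_of_ne_zero fun h0 => by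
    rw [h0, mul_zero] at h1; omega
  have h3 : e - 1 = N * q + (N - 1) := by
    rw [← h1, hq, mul_add]; omega
  have h4 : N - 1 < N := by omega
  rw [h3, Nat.mul_add_div hN, Nat.mul_add_mod, Nat.div_eq_of_lt h4, Nat.mod_eq_of_lt h4]
  omega

end DivMod

/-! ### Tokens and step counts by position -/

namespace TuringMachine

variable (M : TuringMachine K Q S G)

theorem traceStep_of_lt {e : ℕ} (h : e % (2 * r + 2) < r) :
    traceStep r e = r * (e / (2 * r + 2)) + e % (2 * r + 2) + 1 := if_pos h

theorem traceStep_of_le {e : ℕ} (h : r ≤ e % (2 * r + 2)) :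
    traceStep r e = r * (e / (2 * r + 2)) + r := by
  rw [traceStep, if_neg (by omega), mul_add, mul_one]

theorem traceStep_pred_of_le {e : ℕ} (hr : 0 < r) (h : r ≤ e % (2 * r + 2)) :
    traceStep r (e - 1) = traceStep r e := by
  obtain ⟨h1, h2⟩ := sub_div_mod_of_le (N := 2 * r + 2) (e := e) (δ := 1) (by omega)
  rw [traceStep_of_le h]
  by_cases h3 : r ≤ e % (2 * r + 2) - 1
  · rw [traceStep_of_le (h2 ▸ h3), h1]
  · rw [traceStep_of_lt (by omega), h1, h2]
    omega

theorem traceStep_pred_of_lt {e : ℕ} (he : 0 < e) (h : e % (2 * r + 2) < r) :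
    traceStep r (e - 1) = r * (e / (2 * r + 2)) + e % (2 * r + 2) := by
  by_cases h0 : e % (2 * r + 2) = 0
  · obtain ⟨h1, h2⟩ := pred_div_mod_of_mod_eq_zero (by omega) h0 he
    rw [traceStep_of_le (by omega), h0, ← h1, mul_add, mul_one, add_zero]
  · obtain ⟨h1, h2⟩ := sub_div_mod_of_le (N := 2 * r + 2) (e := e) (δ := 1) (by omega)
    rw [traceStep_of_lt (by omega), h1, h2]
    omega

theorem traceStep_le (e : ℕ) : traceStep r e ≤ e + 1 := by
  have h1 := Nat.div_add_mod e (2 * r + 2)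
  have h2 : (2 * r + 2) * (e / (2 * r + 2)) = 2 * (r * (e / (2 * r + 2))) + 2 * (e / (2 * r + 2)) := by
    ring
  by_cases h : e % (2 * r + 2) < r
  · rw [traceStep_of_lt h]; omega
  · rw [traceStep_of_le (by omega)]; omega

theorem traceStep_traceLen (hr : 0 < r) (s : ℕ) : traceStep r (traceLen r s) = s + 1 := by
  have h := Nat.mod_lt s hr
  obtain ⟨h1, h2⟩ := traceLen_add hr s 0 (by omega)
  simp only [add_zero] at h1 h2
  rw [traceStep_of_lt (by omega), h1, h2, Nat.div_add_mod]

theorem head_run_le (w : List S) (s : ℕ) (k : Fin K) : (M.run w s).head k ≤ s := by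
  induction s with
  | zero => exact le_rfl
  | succ s ih =>
    change HeadMove.apply _ ((M.run w s).head k) ≤ s + 1
    cases ((M.action (M.run w s)).2.2 k) <;> simp only [HeadMove.apply] <;> omega

variable (r) (w u : List S) (s : ℕ)

/-- The position of `<outp>`, if there are `s + 1` steps. -/
def outPos : ℕ := w.length + 2 + (traceLen r s + 1)

/-- The token at position `i`. -/
def tokAt (i : ℕ) : CoTToken K Q S G := (M.toks r w (s + 1) u).getD i .outpEnd

variable {r} in
theorem toks_eq (hr : 0 < r) : M.toks r w (s + 1) u = .inp :: (w.map .sym ++ (.inpEnd ::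
    ((List.range (traceLen r s + 1)).map (M.traceTok r w) ++
      (.outp :: (u.map .sym ++ [.outpEnd]))))) := by
  simp [toks, promptToks, outputToks, traceToks_eq M w hr]

variable {r} in
theorem length_toks (hr : 0 < r) :
    (M.toks r w (s + 1) u).length = outPos r w s + u.length + 2 := by
  simp [toks_eq M w u s hr, outPos]; omega

theorem tokAt_eq {i : ℕ} (hi : i < (M.toks r w (s + 1) u).length) :
    (M.toks r w (s + 1) u)[i] = M.tokAt r w u s i := by
  simp [tokAt, hi]

variable {r} (hr : 0 < r)
include hr

theorem tokAt_zero : M.tokAt r w u s 0 = .inp := by simp [tokAt, toks_eq M w u s hr]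

theorem tokAt_inpSym {a : ℕ} (ha : a < w.length) : M.tokAt r w u s (a + 1) = .sym w[a] := by
  simp [tokAt, toks_eq M w u s hr, List.getElem?_append, ha]

theorem tokAt_inpEnd : M.tokAt r w u s (w.length + 1) = .inpEnd := by
  simp [tokAt, toks_eq M w u s hr]

theorem tokAt_trace {e : ℕ} (he : e ≤ traceLen r s) :
    M.tokAt r w u s (w.length + 2 + e) = M.traceTok r w e := by
  have h1 : ¬ w.length + 1 + e < w.length := by omega
  have h2 : w.length + 1 + e - w.length = e + 1 := by omega
  have h3 : e < traceLen r s + 1 := by omega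
  rw [tokAt, toks_eq M w u s hr, show w.length + 2 + e = w.length + 1 + e + 1 by ring]
  simp [List.getElem?_append, h1, h2, h3]

theorem tokAt_outp : M.tokAt r w u s (outPos r w s) = .outp := by
  have h1 : ¬ w.length + 1 + (traceLen r s + 1) < w.length := by omega
  have h2 : w.length + 1 + (traceLen r s + 1) - w.length = traceLen r s + 1 + 1 := by omega
  rw [tokAt, toks_eq M w u s hr, outPos,
    show w.length + 2 + (traceLen r s + 1) = w.length + 1 + (traceLen r s + 1) + 1 by ring]
  simp [List.getElem?_append, h1, h2]

theorem tokAt_out (a : ℕ) : M.tokAt r w u s (outPos r w s + (a + 1)) =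
    ((u[a]?).map .sym).getD .outpEnd := by
  have h1 : ¬ w.length + 1 + (traceLen r s + 1) + (a + 1) < w.length := by omega
  have h2 : w.length + 1 + (traceLen r s + 1) + (a + 1) - w.length
    = traceLen r s + 1 + (a + 1) + 1 := by omega
  have h3 : ¬ traceLen r s + 1 + (a + 1) < traceLen r s + 1 := by omega
  rw [tokAt, toks_eq M w u s hr, outPos, show w.length + 2 + (traceLen r s + 1) + (a + 1)
    = w.length + 1 + (traceLen r s + 1) + (a + 1) + 1 by ring]
  simp only [List.getD_eq_getElem?_getD, List.getElem?_cons_succ, List.getElem?_append,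
    List.length_map, List.length_range, h1, h2, h3, if_false, Nat.add_sub_cancel_left]
  by_cases h : a < u.length
  · simp [h]
  · rw [if_neg h]
    rw [List.getElem?_eq_none (l := u) (by omega)]
    -- Beyond the end of the sequence the default value `</outp>` keeps the formula valid.
    rcases a - u.length with _ | b <;> rfl

theorem tokAt_outSym {a : ℕ} (ha : a < u.length) :
    M.tokAt r w u s (outPos r w s + (a + 1)) = .sym u[a] := by
  rw [tokAt_out M w u s hr]; simp [ha]

theorem tokAt_outpEnd : M.tokAt r w u s (outPos r w s + (u.length + 1)) = .outpEnd := by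
  rw [tokAt_out M w u s hr]; simp

omit hr in
theorem pos_cases {i : ℕ} (hi : i < outPos r w s + u.length + 2) :
    i = 0 ∨ (∃ a < w.length, i = a + 1) ∨ i = w.length + 1 ∨
      (∃ e ≤ traceLen r s, i = w.length + 2 + e) ∨ i = outPos r w s ∨
      (∃ a < u.length, i = outPos r w s + (a + 1)) ∨ i = outPos r w s + (u.length + 1) := by
  have ho : outPos r w s = w.length + 2 + (traceLen r s + 1) := rfl
  by_cases h0 : i = 0
  · exact .inl h0
  by_cases h1 : i ≤ w.length
  · exact .inr (.inl ⟨i - 1, by omega, by omega⟩)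
  by_cases h2 : i = w.length + 1
  · exact .inr (.inr (.inl h2))
  by_cases h3 : i < outPos r w s
  · exact .inr (.inr (.inr (.inl ⟨i - (w.length + 2), by omega, by omega⟩)))
  by_cases h4 : i = outPos r w s
  · exact .inr (.inr (.inr (.inr (.inl h4))))
  by_cases h5 : i ≤ outPos r w s + u.length
  · exact .inr (.inr (.inr (.inr (.inr (.inl ⟨i - outPos r w s - 1, by omega, by omega⟩)))))
  · exact .inr (.inr (.inr (.inr (.inr (.inr (by omega))))))

/-- A property of tokens which is not shared by the tokens outside of the trace. -/
theorem exists_trace {P : CoTToken K Q S G → Prop} {i : ℕ}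
    (hi : i < outPos r w s + u.length + 2) (h : P (M.tokAt r w u s i)) (h1 : ¬ P .inp)
    (h2 : ¬ P .inpEnd) (h3 : ∀ a, ¬ P (.sym a)) (h4 : ¬ P .outp) (h5 : ¬ P .outpEnd) :
    ∃ e ≤ traceLen r s, i = w.length + 2 + e ∧ P (M.traceTok r w e) := by
  rcases pos_cases w u s hi with rfl | ⟨a, ha, rfl⟩ | rfl | ⟨e, he, rfl⟩ | rfl | ⟨a, ha, rfl⟩ | rfl
  · rw [tokAt_zero M w u s hr] at h; exact absurd h h1
  · rw [tokAt_inpSym M w u s hr ha] at h; exact absurd h (h3 _)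
  · rw [tokAt_inpEnd M w u s hr] at h; exact absurd h h2
  · rw [tokAt_trace M w u s hr he] at h; exact ⟨e, he, rfl, h⟩
  · rw [tokAt_outp M w u s hr] at h; exact absurd h h4
  · rw [tokAt_outSym M w u s hr ha] at h; exact absurd h (h3 _)
  · rw [tokAt_outpEnd M w u s hr] at h; exact absurd h h5

end TuringMachine

/-! ### Token classes, and the trace of a computation -/

namespace TuringMachine

variable (M : TuringMachine K Q S G) (w u : List S) (s : ℕ)

theorem isRun_traceTok {e : ℕ} : (M.traceTok r w e).isRun ↔ e % (2 * r + 2) < r := by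
  unfold traceTok; split_ifs <;> simp_all [CoTToken.isRun, runTok]

theorem isRelay_traceTok {e : ℕ} : (M.traceTok r w e).isRelay ↔ r ≤ e % (2 * r + 2) := by
  unfold traceTok; split_ifs <;> simp_all [CoTToken.isRelay, runTok]

theorem isAct_traceTok {e : ℕ} :
    (M.traceTok r w e).isAct ↔ e % (2 * r + 2) < r ∨ 2 * r < e % (2 * r + 2) := by
  unfold traceTok; split_ifs <;> simp_all [CoTToken.isAct, runTok]; omega

theorem traceTok_eq_pos {e : ℕ} : M.traceTok r w e = .pos ↔ e % (2 * r + 2) = r := by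
  unfold traceTok; split_ifs <;> simp_all [runTok]; omega

theorem traceTok_eq_posEnd {e : ℕ} : M.traceTok r w e = .posEnd ↔ 2 * r < e % (2 * r + 2) := by
  unfold traceTok; split_ifs <;> simp_all [runTok] <;> omega

theorem isBits_traceTok {e : ℕ} :
    (M.traceTok r w e).isBits ↔ r < e % (2 * r + 2) ∧ e % (2 * r + 2) ≤ 2 * r := by
  unfold traceTok; split_ifs <;> simp_all [CoTToken.isBits, runTok] <;> omega

theorem traceTok_ne {e : ℕ} : M.traceTok r w e ≠ .inp ∧ M.traceTok r w e ≠ .inpEnd ∧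
    M.traceTok r w e ≠ .outp ∧ M.traceTok r w e ≠ .outpEnd ∧ (M.traceTok r w e).isSym = false := by
  unfold traceTok; split_ifs <;> simp [runTok, CoTToken.isSym]

theorem traceTok_bits {e : ℕ} (h1 : r < e % (2 * r + 2)) (h2 : e % (2 * r + 2) ≤ 2 * r) :
    M.traceTok r w e = .bits fun k => signBit (e % (2 * r + 2) - (r + 1))
      ((M.run w (traceStep r e)).head k) := by
  rw [traceTok, if_neg (by omega), if_neg (by omega), if_pos h2, traceStep, if_neg (by omega)]

variable (r) in
/-- The number of steps made up to position `i`. -/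
def stepAt (i : ℕ) : ℕ :=
  if i < w.length + 2 then 0 else
    if i < outPos r w s then traceStep r (i - (w.length + 2)) else s + 1

theorem stepAt_trace {e : ℕ} (he : e ≤ traceLen r s) :
    stepAt r w s (w.length + 2 + e) = traceStep r e := by
  rw [stepAt, if_neg (by omega), if_pos (by unfold outPos; omega), Nat.add_sub_cancel_left]

theorem stepAt_inpEnd : stepAt r w s (w.length + 1) = 0 := if_pos (by omega)

theorem stepAt_out {i : ℕ} (hi : outPos r w s ≤ i) : stepAt r w s i = s + 1 := by
  rw [stepAt, if_neg (by unfold outPos at hi; omega), if_neg (by omega)]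

variable (hr : 0 < r)

theorem stepAt_pred_of_lt {e : ℕ} (he : e ≤ traceLen r s) (h : e % (2 * r + 2) < r) :
    stepAt r w s (w.length + 1 + e) = r * (e / (2 * r + 2)) + e % (2 * r + 2) := by
  rcases Nat.eq_zero_or_pos e with rfl | h0
  · simpa using stepAt_inpEnd w s
  · rw [← traceStep_pred_of_lt h0 h, ← stepAt_trace w s (by omega : e - 1 ≤ traceLen r s)]
    congr 1; omega

theorem stepAt_succ_of_lt {e : ℕ} (he : e ≤ traceLen r s) (h : e % (2 * r + 2) < r) :
    stepAt r w s (w.length + 2 + e) = stepAt r w s (w.length + 1 + e) + 1 := by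
  rw [stepAt_trace w s he, stepAt_pred_of_lt w s he h, traceStep_of_lt h]

theorem traceTok_eq_runTok {e : ℕ} (he : e ≤ traceLen r s) (h : e % (2 * r + 2) < r) :
    M.traceTok r w e = M.runTok w (stepAt r w s (w.length + 1 + e)) := by
  rw [stepAt_pred_of_lt w s he h, traceTok, if_pos h]

include hr

theorem stepAt_succ_of_le {e : ℕ} (he : e ≤ traceLen r s) (h : r ≤ e % (2 * r + 2)) :
    stepAt r w s (w.length + 2 + e) = stepAt r w s (w.length + 1 + e) := by
  have h0 : 0 < e := Nat.pos_of_ne_zero fun h0 => by subst h0; simp at h; omega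
  rw [stepAt_trace w s he, ← traceStep_pred_of_le hr h,
    ← stepAt_trace w s (by omega : e - 1 ≤ traceLen r s)]
  congr 1; omega

theorem stepAt_outPos_pred : stepAt r w s (outPos r w s - 1) = s + 1 := by
  rw [← traceStep_traceLen hr s, ← stepAt_trace w s le_rfl]; rfl

theorem stepAt_lt {i : ℕ} : stepAt r w s i ≤ i := by
  unfold stepAt
  split_ifs with h1 h2
  · exact Nat.zero_le i
  · have := traceStep_le (r := r) (i - (w.length + 2)); omega
  · have := traceStep_le (r := r) (traceLen r s)
    rw [traceStep_traceLen hr] at this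
    unfold outPos at h2
    omega

theorem act_cases {i : ℕ} (hi : i < outPos r w s + u.length + 2)
    (h : (M.tokAt r w u s i).isAct) : i = w.length + 1 ∨ ∃ e ≤ traceLen r s,
      i = w.length + 2 + e ∧ (e % (2 * r + 2) < r ∨ 2 * r < e % (2 * r + 2)) := by
  by_cases h1 : i = w.length + 1
  · exact .inl h1
  · right
    have h2 : M.tokAt r w u s i ≠ .inpEnd := by
      rcases pos_cases w u s hi with rfl | ⟨a, ha, rfl⟩ | rfl | ⟨e, he, rfl⟩ | rfl | ⟨a, ha, rfl⟩ |
        rfl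
      · simp [tokAt_zero M w u s hr]
      · simp [tokAt_inpSym M w u s hr ha]
      · exact absurd rfl h1
      · rw [tokAt_trace M w u s hr he]; exact (traceTok_ne M w).2.1
      · simp [tokAt_outp M w u s hr]
      · simp [tokAt_outSym M w u s hr ha]
      · simp [tokAt_outpEnd M w u s hr]
    obtain ⟨e, he, h3, h4⟩ := exists_trace M w u s hr (P := fun v => v.isAct ∧ v ≠ .inpEnd) hi
      ⟨h, h2⟩ (by simp [CoTToken.isAct]) (by simp) (by simp [CoTToken.isAct])
      (by simp [CoTToken.isAct]) (by simp [CoTToken.isAct])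
    exact ⟨e, he, h3, (isAct_traceTok M w).1 h4.1⟩

theorem run_cases {i : ℕ} (hi : i < outPos r w s + u.length + 2)
    (h : (M.tokAt r w u s i).isRun) : ∃ e ≤ traceLen r s,
      i = w.length + 2 + e ∧ e % (2 * r + 2) < r := by
  obtain ⟨e, he, h3, h4⟩ := exists_trace M w u s hr (P := fun v => v.isRun) hi
    h (by simp [CoTToken.isRun]) (by simp [CoTToken.isRun]) (by simp [CoTToken.isRun])
    (by simp [CoTToken.isRun]) (by simp [CoTToken.isRun])
  exact ⟨e, he, h3, (isRun_traceTok M w).1 h4⟩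

theorem relay_cases {i : ℕ} (hi : i < outPos r w s + u.length + 2)
    (h : (M.tokAt r w u s i).isRelay) : ∃ e ≤ traceLen r s,
      i = w.length + 2 + e ∧ r ≤ e % (2 * r + 2) := by
  obtain ⟨e, he, h3, h4⟩ := exists_trace M w u s hr (P := fun v => v.isRelay) hi
    h (by simp [CoTToken.isRelay]) (by simp [CoTToken.isRelay]) (by simp [CoTToken.isRelay])
    (by simp [CoTToken.isRelay]) (by simp [CoTToken.isRelay])
  exact ⟨e, he, h3, (isRelay_traceTok M w).1 h4⟩

theorem eq_pos_cases {i : ℕ} (hi : i < outPos r w s + u.length + 2)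
    (h : M.tokAt r w u s i = .pos) : ∃ e ≤ traceLen r s,
      i = w.length + 2 + e ∧ e % (2 * r + 2) = r := by
  obtain ⟨e, he, h3, h4⟩ := exists_trace M w u s hr (P := fun v => v = .pos) hi
    h (by simp) (by simp) (by simp) (by simp) (by simp)
  exact ⟨e, he, h3, (traceTok_eq_pos M w).1 h4⟩

theorem eq_posEnd_cases {i : ℕ} (hi : i < outPos r w s + u.length + 2)
    (h : M.tokAt r w u s i = .posEnd) : ∃ e ≤ traceLen r s,
      i = w.length + 2 + e ∧ 2 * r < e % (2 * r + 2) := by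
  obtain ⟨e, he, h3, h4⟩ := exists_trace M w u s hr (P := fun v => v = .posEnd) hi
    h (by simp) (by simp) (by simp) (by simp) (by simp)
  exact ⟨e, he, h3, (traceTok_eq_posEnd M w).1 h4⟩

/-- The trace given by a computation of `s + 1` steps. -/
def trace (hn : (M.toks r w (s + 1) u).length ≤ 2 ^ r) : Trace M r where
  tok := M.tokAt r w u s
  n := outPos r w s + u.length + 2
  o := outPos r w s
  hp i := (M.run w (stepAt r w s i)).head
  ci i := if i < w.length + 2 then 0 else
    if (i - (w.length + 2)) % (2 * r + 2) < r then (i - (w.length + 2)) % (2 * r + 2) + 1 else 0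
  -- The last run token of a period has offset `r - 1`, so a token of offset `f ≥ r` is `f - r + 1`
  -- positions behind it.
  dist i := if i < w.length + 2 ∨ outPos r w s ≤ i then 0 else
    if (i - (w.length + 2)) % (2 * r + 2) < r then 0
      else (i - (w.length + 2)) % (2 * r + 2) - r + 1
  n_le := by rwa [length_toks M w u s hr] at hn
  o_pos := by unfold outPos; omega
  inp_iff i hi := by
    constructor
    · intro h
      by_contra h0
      rcases pos_cases w u s hi with rfl | ⟨a, ha, rfl⟩ | rfl | ⟨e, he, rfl⟩ | rfl | ⟨a, ha, rfl⟩ |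
        rfl
      · exact h0 rfl
      · simp [tokAt_inpSym M w u s hr ha] at h
      · simp [tokAt_inpEnd M w u s hr] at h
      · rw [tokAt_trace M w u s hr he] at h; exact (traceTok_ne M w).1 h
      · simp [tokAt_outp M w u s hr] at h
      · simp [tokAt_outSym M w u s hr ha] at h
      · simp [tokAt_outpEnd M w u s hr] at h
    · rintro rfl; exact tokAt_zero M w u s hr
  outp_iff i hi := by
    constructor
    · intro h
      rcases pos_cases w u s hi with rfl | ⟨a, ha, rfl⟩ | rfl | ⟨e, he, rfl⟩ | rfl | ⟨a, ha, rfl⟩ |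
        rfl
      · simp [tokAt_zero M w u s hr] at h
      · simp [tokAt_inpSym M w u s hr ha] at h
      · simp [tokAt_inpEnd M w u s hr] at h
      · rw [tokAt_trace M w u s hr he] at h; exact absurd h (traceTok_ne M w).2.2.1
      · rfl
      · simp [tokAt_outSym M w u s hr ha] at h
      · simp [tokAt_outpEnd M w u s hr] at h
    · rintro rfl; exact tokAt_outp M w u s hr
  act_lt i hi h := by
    rcases act_cases M w u s hr hi h with rfl | ⟨e, he, rfl, -⟩ <;> unfold outPos <;> omega
  ci_base i hi h h' := by
    rcases act_cases M w u s hr hi h with rfl | ⟨e, he, rfl, h1⟩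
    · rw [if_pos (by omega)]
    · rw [tokAt_trace M w u s hr he] at h'
      have := (isRun_traceTok M w (r := r) (e := e)).not.1 (by simp [h'])
      rw [if_neg (by omega), Nat.add_sub_cancel_left, if_neg this]
  hp_inpEnd i hi h := by
    have h0 : i = w.length + 1 := by
      rcases act_cases M w u s hr hi (by rw [h]; rfl) with rfl | ⟨e, he, rfl, h1⟩
      · rfl
      · rw [tokAt_trace M w u s hr he] at h; exact absurd h (traceTok_ne M w).2.1
    rw [h0, stepAt_inpEnd]; rfl
  run_prev i hi h := by
    obtain ⟨e, he, rfl, h1⟩ := run_cases M w u s hr hi h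
    rw [if_neg (by omega), Nat.add_sub_cancel_left, if_pos h1]
    rcases Nat.eq_zero_or_pos e with rfl | h0
    · have h2 : w.length + 2 + 0 - 1 = w.length + 1 := by omega
      rw [h2, tokAt_inpEnd M w u s hr, if_pos (by omega)]
      simp [CoTToken.isAct]; omega
    · have h2 : w.length + 2 + e - 1 = w.length + 2 + (e - 1) := by omega
      rw [h2, tokAt_trace M w u s hr (by omega), if_neg (by omega), Nat.add_sub_cancel_left,
        isAct_traceTok]
      by_cases h3 : e % (2 * r + 2) = 0
      · obtain ⟨h4, h5⟩ := pred_div_mod_of_mod_eq_zero (by omega) h3 h0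
        rw [h5, if_neg (by omega)]
        omega
      · obtain ⟨h4, h5⟩ := sub_div_mod_of_le (N := 2 * r + 2) (e := e) (δ := 1) (by omega)
        rw [h5, if_pos (by omega)]
        omega
  run_hp i hi k m h := by
    obtain ⟨e, he, rfl, h1⟩ := run_cases M w u s hr hi (by
      by_contra h0
      rw [CoTToken.move_eq_none (by simpa using h0)] at h
      simp at h)
    rw [tokAt_trace M w u s hr he, traceTok_eq_runTok M w s he h1] at h
    simp only [runTok, CoTToken.move, Option.some.injEq] at h
    rw [stepAt_succ_of_lt w s he h1, ← h, show w.length + 2 + e - 1 = w.length + 1 + e by omega]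
    rfl
  hp_posEnd i hi h δ h1 h2 k := by
    obtain ⟨e, he, rfl, h3⟩ := eq_posEnd_cases M w u s hr hi h
    have h4 := Nat.mod_lt e (show 0 < 2 * r + 2 by omega)
    have h7 := Nat.mod_le e (2 * r + 2)
    obtain ⟨h5, h6⟩ := sub_div_mod_of_le (N := 2 * r + 2) (e := e) (δ := δ) (by omega)
    rw [show w.length + 2 + e - δ = w.length + 2 + (e - δ) by omega,
      tokAt_trace M w u s hr (by omega), traceTok_bits M w (by omega) (by omega), stepAt_trace w s he,
      traceStep_of_le (e := e) (by omega), traceStep_of_le (by omega), h5, h6]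
    simp only [CoTToken.bitVal, bitSign]
    rw [show e % (2 * r + 2) - δ - (r + 1) = r - δ by omega]
  hp_lt i hi h k := by
    -- A head moves by at most one cell per step, and no position is preceded by more steps than its
    -- number.
    have h1 := M.head_run_le w (stepAt r w s i) k
    have h2 := stepAt_lt w s hr (i := i)
    rw [length_toks M w u s hr] at hn
    omega
  dist_relay i hi h := by
    obtain ⟨e, he, rfl, h1⟩ := relay_cases M w u s hr hi h
    have h7 := Nat.mod_le e (2 * r + 2)
    obtain ⟨h5, h6⟩ := sub_div_mod_of_le (N := 2 * r + 2) (e := e) (δ := 1) (by omega)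
    rw [show w.length + 2 + e - 1 = w.length + 2 + (e - 1) by omega,
      if_neg (by unfold outPos; omega), Nat.add_sub_cancel_left, if_neg (by omega),
      if_neg (by unfold outPos; omega), Nat.add_sub_cancel_left, h6]
    split_ifs <;> omega
  dist_nonrelay i hi h := by
    split_ifs with h1 h2
    · rfl
    · rfl
    · exfalso
      have h3 : ¬ (M.tokAt r w u s i).isRelay := by simp [h]
      push Not at h1
      apply h3
      have h4 : i = w.length + 2 + (i - (w.length + 2)) := by omega
      rw [h4, tokAt_trace M w u s hr (by unfold outPos at h1; omega), isRelay_traceTok]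
      omega
  dist_le i hi := by
    have := Nat.mod_le (i - (w.length + 2)) (2 * r + 2)
    split_ifs <;> omega
  pos_unique i hi e he e' he' h h' := by
    obtain ⟨a, ha, h1, h2⟩ := eq_pos_cases M w u s hr (by omega) h
    obtain ⟨b, hb, h3, h4⟩ := eq_pos_cases M w u s hr (by omega) h'
    have h5 := Nat.div_add_mod a (2 * r + 2)
    have h6 := Nat.div_add_mod b (2 * r + 2)
    -- Occurrences of `<p>` in different periods are at least `2r + 2` apart, too far for a window
    -- of length `r`.
    have h7 : a / (2 * r + 2) = b / (2 * r + 2) := by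
      rcases lt_trichotomy (a / (2 * r + 2)) (b / (2 * r + 2)) with h8 | h8 | h8
      · have := Nat.mul_le_mul_left (2 * r + 2) (Nat.succ_le_of_lt h8)
        rw [Nat.mul_succ] at this
        omega
      · exact h8
      · have := Nat.mul_le_mul_left (2 * r + 2) (Nat.succ_le_of_lt h8)
        rw [Nat.mul_succ] at this
        omega
    rw [h7] at h5
    omega

end TuringMachine

/-! ### Results of the search, and final register contents -/

namespace Trace

variable {M : TuringMachine K Q S G} (T : Trace M r) (code : Codes Q G dQ dG)

open Reg

theorem wc_lt {j : ℕ} (hj : j < T.n) {k : Fin K} {p : ℕ} (h : T.wc j k = some p) : p < 2 ^ r := by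
  unfold wc at h
  split_ifs at h with h1 h2
  · obtain ⟨h3, h4, -⟩ := T.run_prev j hj h1
    cases h
    exact T.hp_lt (j - 1) (by omega) h4 k
  · cases h
    have := T.n_le
    omega

theorem qc_lt {i : ℕ} (hi : i < T.n) {k : Fin K} {p : ℕ} (h : T.qc i k = some p) : p < 2 ^ r := by
  unfold qc at h
  split_ifs at h with h1 h2
  · cases h
    exact T.hp_lt i hi h1 k
  · cases h
    have := T.n_le
    omega

/-- A write to the queried cell has score `r`, a write to another cell less, and no write `0`. So
the best matches are exactly the writes to this cell. -/
theorem jst_eq {i j : ℕ} (hi : i < T.n) {k : Fin K} {p : ℕ} (hr : 0 < r) (hq : T.qc i k = some p)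
    (hj : j ≤ i) (hw : T.wc j k = some p) (hl : ∀ l, j < l → l ≤ i → T.wc l k ≠ some p) :
    T.jst code i k = j := by
  have hscore : ∀ l, (contentHead (H k) (W k)).score (T.stInput code) i l =
      ∑ a : Fin r, bitSign a p * optBit a (T.wc l k) := by
    intro l
    rw [contentHead_score]
    simp only [stInput, hq, optBit_some]
  have hself : (contentHead (H k) (W k)).score (T.stInput code) i j = r := by
    rw [hscore, hw]; simp
  have hlt : ∀ l ≤ i, T.wc l k ≠ some p →
      (contentHead (H k) (W k)).score (T.stInput code) i l < r := by
    intro l hl h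
    rw [hscore]
    cases hwl : T.wc l k with
    | none => simpa using hr
    | some p' =>
      exact sum_bitSign_mul_lt (T.qc_lt hi hq) (T.wc_lt (by omega) hwl) fun h' => h (by rw [hwl, h'])
  refine HeadSpec.IsLastMax.att_eq ⟨hj, fun l hl' => ?_, fun l hl' h => ?_⟩
  · rw [hself]
    by_cases h : T.wc l k = some p
    · rw [hscore, h]; simp
    · exact (hlt l hl' h).le
  · rw [hself]
    exact hlt l hl' (hl l h hl')

theorem ptr_eq {i j : ℕ} (hi : i < T.n) {k : Fin K} {p : ℕ} (hr : 0 < r) (hq : T.qc i k = some p)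
    (hj : j ≤ i) (hw : T.wc j k = some p) (hl : ∀ l, j < l → l ≤ i → T.wc l k ≠ some p) :
    T.ptr code i k = j := by
  have h := T.jst_eq code hi hr hq hj hw hl
  rw [ptr, h, if_pos]
  intro s
  rw [hq, hw, optBit_some, eqBit]
  rcases bitSign_cases s p with h | h <;> rw [h] <;> simp

/-- The best match then differs from the query in some digit, or wrote nothing; empty digits never
pass the comparison by `eqBit`. -/
theorem ptr_eq_zero {i : ℕ} (hi : i < T.n) {k : Fin K} {p : ℕ} (hr : 0 < r) (hq : T.qc i k = some p)
    (hl : ∀ l ≤ i, T.wc l k ≠ some p) : T.ptr code i k = 0 := by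
  rw [ptr, if_neg]
  intro h
  have hj := T.jst_le code i k
  have hne := hl _ hj
  cases hw : T.wc (T.jst code i k) k with
  | none =>
    have := h ⟨0, hr⟩
    rw [hw, hq] at this
    simp only [optBit_some, optBit_none, eqBit] at this
    split_ifs at this <;> simp_all
  | some p' =>
    refine hne (hw.trans (congrArg some (Eq.symm ?_)))
    refine eq_of_bitSign_eq (T.qc_lt hi hq) (T.wc_lt (by omega) hw) fun s hs => ?_
    have := h ⟨s, hs⟩
    rw [hw, hq] at this
    simp only [optBit_some, eqBit] at this
    rcases bitSign_cases s p with h1 | h1 <;> rcases bitSign_cases s p' with h2 | h2 <;>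
      simp [h1, h2] at this ⊢

theorem oB_eq_zero {i : ℕ} (h : ∀ e < r, T.tok (i - e) ≠ .pos) (k : Fin K) :
    T.stRead code i (oB k : Reg K r dQ dG) = 0 := by
  change (∑ e : Fin r, if T.st0 code (i - e) (.d0 none) = 1 then optBit e (T.qc (T.last i) k)
      else 0) = _
  exact Finset.sum_eq_zero fun (e : Fin r) _ => if_neg fun h' => h e e.2 ((T.st0_delim_eq_one code _).1 h')

theorem oB_eq {i e : ℕ} (hi : i < T.n) (he : e < r) (h : T.tok (i - e) = .pos) (k : Fin K) :
    T.stRead code i (oB k : Reg K r dQ dG) = optBit e (T.qc (T.last i) k) := by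
  change (∑ e : Fin r, if T.st0 code (i - e) (.d0 none) = 1 then optBit e (T.qc (T.last i) k)
      else 0) = _
  rw [Finset.sum_eq_single ⟨e, he⟩]
  · exact if_pos ((T.st0_delim_eq_one code _).2 h)
  · intro e' _ hne
    rw [if_neg]
    exact fun h' => hne (Fin.ext (T.pos_unique i hi e' e'.2 e he
      ((T.st0_delim_eq_one code _).1 h') h))
  · simp

theorem oP_eq (i : ℕ) : T.stRead code i (oP : Reg K r dQ dG) =
    open Classical in if (T.tok i).notHalt M ∧ (T.tok (i - r)).delim = -1 then 1 else 0 := by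
  classical
  change (if (if (T.tok i).notHalt M then (1 : ℤ) else 0) = 1 ∧ (T.tok (i - r)).delim = -1 then
    (1 : ℤ) else 0) = _
  by_cases h : (T.tok i).notHalt M <;> simp [h]

theorem go_eq (i : ℕ) : T.stRead code i (go : Reg K r dQ dG) =
    open Classical in if (T.tok i).isAct ∧ ¬ ((T.tok i).notHalt M ∧ (T.tok (i - r)).delim = -1)
      then 1 else 0 := by
  classical
  change (if (if (T.tok i).notHalt M then (1 : ℤ) else 0) = 1 ∧ (T.tok (i - r)).delim = -1 then
    (0 : ℤ) else if (T.tok i).isAct then 1 else 0) = _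
  by_cases h : (T.tok i).notHalt M <;> by_cases h' : (T.tok (i - r)).delim = -1 <;> simp [h, h']

theorem oPe_eq (i : ℕ) : T.stRead code i (oPe : Reg K r dQ dG) =
    if (T.tok i).isBits ∧ (T.tok (i - r)).delim = 1 then 1 else 0 := by
  classical
  change (if (if (T.tok i).isBits then (1 : ℤ) else 0) = 1 ∧ (T.tok (i - r)).delim = 1 then
    (1 : ℤ) else 0) = _
  by_cases h : (T.tok i).isBits <;> simp [h]

theorem out_eq (i : ℕ) : T.stRead code i (out : Reg K r dQ dG) = if T.o ≤ i then 1 else 0 := rfl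

theorem oS_eq (i : ℕ) (b : Fin dG) : T.stRead code i (oS b : Reg K r dQ dG) =
    if T.o ≤ i then T.st0 code (T.ptr code i M.k0) (.Y M.k0 b : Reg K r dQ dG) else 0 := rfl

theorem QC_eq (i : ℕ) (b : Fin dQ) : T.stRead code i (QC b : Reg K r dQ dG) =
    ((T.tok (T.last i)).state? M).elim 0 fun q => (code.Q q b : ℤ) := rfl

theorem st0_Y (j : ℕ) (k : Fin K) (b : Fin dG) : T.st0 code j (Y k b : Reg K r dQ dG) =
    ((T.tok j).symbol? M k).elim 0 fun g => (code.G g b : ℤ) := rfl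

theorem oQ_eq (i : ℕ) (b : Fin dQ) : T.stRead code i (oQ b : Reg K r dQ dG) = 0 := rfl
theorem oY_eq (i : ℕ) (k : Fin K) (b : Fin dG) :
    T.stRead code i (oY k b : Reg K r dQ dG) = 0 := rfl
theorem oM_eq (i : ℕ) (k : Fin K) (b : Fin 2) :
    T.stRead code i (oM k b : Reg K r dQ dG) = 0 := rfl
theorem oOut_eq (i : ℕ) : T.stRead code i (oOut : Reg K r dQ dG) = 0 := rfl

variable [Fintype Q] [Fintype G]

/-- After the last step, the output is `<outp>`. Otherwise it is the token of the next step. -/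
theorem stFinal_of_act {i : ℕ} (hA : (T.tok i).isAct) (hi : i < T.o)
    (hd : ¬ ((T.tok i).notHalt M ∧ (T.tok (i - r)).delim = -1)) {q : Q} {y : Fin K → G}
    (hq : (T.tok (T.last i)).state? M = some q)
    (hy : ∀ k b, T.st0 code (T.ptr code i k) (Y k b : Reg K r dQ dG) = code.G (y k) b)
    (hp : ∀ e < r, T.tok (i - e) ≠ .pos) {v : CoTToken K Q S G}
    (hv : (q = M.qhalt ∧ v = .outp) ∨
      (q ≠ M.qhalt ∧ v = .run (M.δ q y).1 (M.δ q y).2.1 (M.δ q y).2.2))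
    (c : Reg K r dQ dG) (hc : c.IsOutput) : T.stFinal code i c = M.tokUnemb code v c := by
  classical
  have hgo : T.stRead code i (go : Reg K r dQ dG) = 1 := by rw [go_eq, if_pos ⟨hA, hd⟩]
  have hfire : (M.deltaGate code (q, y)).Fires (T.stRead code i) :=
    deltaGate_fires.2 ⟨hgo, fun b => by rw [QC_eq, hq]; rfl, fun k b => hy k b⟩
  have hB : (T.tok i).isBits = false := by
    revert hA; cases T.tok i <;> simp [CoTToken.isAct, CoTToken.isBits]
  rw [stFinal, gateSum_deltaLayer_of_fires hfire, deltaGate_effect]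
  rcases hv with ⟨h1, rfl⟩ | ⟨h1, rfl⟩ <;> cases c <;> simp only [Reg.IsOutput] at hc <;>
    simp [h1, TuringMachine.tokUnemb, T.oB_eq_zero code hp, oP_eq, oPe_eq, out_eq, oS_eq, oQ_eq,
      oY_eq, oM_eq, oOut_eq, hd, hB, hi.not_ge]

theorem stFinal_of_not_go {i : ℕ}
    (h : ¬ ((T.tok i).isAct ∧ ¬ ((T.tok i).notHalt M ∧ (T.tok (i - r)).delim = -1)))
    (c : Reg K r dQ dG) : T.stFinal code i c = T.stRead code i c := by
  rw [stFinal, gateSum_deltaLayer_of_go, add_zero]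
  rw [go_eq, if_neg h]; simp

theorem stFinal_of_delim {i : ℕ} (h : (T.tok i).notHalt M) (h' : (T.tok (i - r)).delim = -1)
    (hi : i < T.o) (hp : ∀ e < r, T.tok (i - e) ≠ .pos)
    (c : Reg K r dQ dG) (hc : c.IsOutput) : T.stFinal code i c = M.tokUnemb code .pos c := by
  have hB : (T.tok i).isBits = false := by
    revert h; cases T.tok i <;> simp [CoTToken.notHalt, CoTToken.isBits]
  rw [stFinal_of_not_go _ _ (by tauto)]
  cases c <;> simp only [Reg.IsOutput] at hc <;>
    simp [TuringMachine.tokUnemb, T.oB_eq_zero code hp, oP_eq, oPe_eq, out_eq, oS_eq, oQ_eq,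
      oY_eq, oM_eq, oOut_eq, h, h', hB, hi.not_ge]

theorem stFinal_of_relay {i : ℕ} (h : (T.tok i).isAct = false) (hi : i < T.n) (hio : i < T.o)
    {e : ℕ} (he : e < r)
    (hp : T.tok (i - e) = .pos) (hpe : ¬ ((T.tok i).isBits ∧ (T.tok (i - r)).delim = 1))
    {n : Fin K → ℕ} (hn : ∀ k, T.qc (T.last i) k = some (n k))
    (c : Reg K r dQ dG) (hc : c.IsOutput) :
    T.stFinal code i c = M.tokUnemb code (.bits fun k => signBit e (n k)) c := by
  have hN : ¬ (T.tok i).notHalt M := by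
    revert h; cases T.tok i <;> simp [CoTToken.notHalt, CoTToken.isAct]
  rw [stFinal_of_not_go _ _ (by simp [h])]
  cases c <;> simp only [Reg.IsOutput] at hc <;>
    simp [TuringMachine.tokUnemb, T.oB_eq code hi he hp, oP_eq, oPe_eq, out_eq, oS_eq, oQ_eq,
      oY_eq, oM_eq, oOut_eq, hN, hpe, hio.not_ge, hn, bitSign]

theorem stFinal_of_last_bit {i : ℕ} (h : (T.tok i).isBits) (hio : i < T.o)
    (hp : ∀ e < r, T.tok (i - e) ≠ .pos) (hpe : T.tok (i - r) = .pos)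
    (c : Reg K r dQ dG) (hc : c.IsOutput) :
    T.stFinal code i c = M.tokUnemb code .posEnd c := by
  have hN : ¬ (T.tok i).notHalt M := by
    revert h; cases T.tok i <;> simp [CoTToken.notHalt, CoTToken.isBits]
  have hA : (T.tok i).isAct = false := by
    revert h; cases T.tok i <;> simp [CoTToken.isAct, CoTToken.isBits]
  rw [stFinal_of_not_go _ _ (by simp [hA])]
  cases c <;> simp only [Reg.IsOutput] at hc <;>
    simp [TuringMachine.tokUnemb, T.oB_eq_zero code hp, oP_eq, oPe_eq, out_eq, oS_eq, oQ_eq,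
      oY_eq, oM_eq, oOut_eq, hN, hpe, h, hio.not_ge, CoTToken.delim]

theorem stFinal_of_out {i : ℕ} (hi : i < T.n) (hio : T.o ≤ i) (hB : (T.tok i).isBits = false)
    (hp : ∀ e < r, T.tok (i - e) ≠ .pos) {g : G}
    (hy : ∀ b, T.st0 code (T.ptr code i M.k0) (Y M.k0 b : Reg K r dQ dG) = code.G g b)
    {v : CoTToken K Q S G}
    (hv : (g = M.blank ∧ v = .outpEnd) ∨ ∃ a, g = M.incl a ∧ v = .sym a)
    (c : Reg K r dQ dG) (hc : c.IsOutput) :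
    T.stFinal code i c = M.tokUnemb code v c := by
  have hA : (T.tok i).isAct = false := by
    by_contra h
    have := T.act_lt i hi (by simpa using h)
    omega
  have hN : ¬ (T.tok i).notHalt M := by
    revert hA; cases T.tok i <;> simp [CoTToken.notHalt, CoTToken.isAct]
  rw [stFinal_of_not_go _ _ (by simp [hA])]
  rcases hv with ⟨rfl, rfl⟩ | ⟨a, rfl, rfl⟩ <;> cases c <;> simp only [Reg.IsOutput] at hc <;>
    simp [TuringMachine.tokUnemb, T.oB_eq_zero code hp, oP_eq, oPe_eq, out_eq, oS_eq, oQ_eq,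
      oY_eq, oM_eq, oOut_eq, hN, hB, hio, hy]

end Trace

/-! ### Tape contents from the last write access -/

namespace TuringMachine

variable (M : TuringMachine K Q S G) (w u : List S) (s : ℕ) (hr : 0 < r)
  (hn : (M.toks r w (s + 1) u).length ≤ 2 ^ r)

theorem div_traceLen (hr : 0 < r) (s : ℕ) : traceLen r s / (2 * r + 2) = s / r ∧
    traceLen r s % (2 * r + 2) = s % r := by
  have h := traceLen_add hr s 0 (by have := Nat.mod_lt s hr; omega)
  simpa using h

theorem le_of_le_traceLen (hr : 0 < r) {e : ℕ} (he : e ≤ traceLen r s) (h : e % (2 * r + 2) < r) :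
    r * (e / (2 * r + 2)) + e % (2 * r + 2) ≤ s := by
  obtain ⟨h1, h2⟩ := div_traceLen hr s
  have h3 := Nat.div_add_mod s r
  have h4 := Nat.div_add_mod e (2 * r + 2)
  have h5 := Nat.div_add_mod (traceLen r s) (2 * r + 2)
  have h6 : e / (2 * r + 2) ≤ s / r := h1 ▸ Nat.div_le_div_right he
  rw [h1, h2] at h5
  rcases h6.lt_or_eq with h7 | h7
  · have := Nat.mul_le_mul_left r (Nat.succ_le_of_lt h7)
    rw [Nat.mul_succ] at this
    omega
  · rw [h7] at h4 ⊢
    omega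

/-- No block stands after the last step, so a block that has begun is complete and followed by
another run token. -/
theorem lt_of_le_traceLen (hr : 0 < r) {e : ℕ} (he : e ≤ traceLen r s) (h : r ≤ e % (2 * r + 2)) :
    r * (e / (2 * r + 2)) + r ≤ s ∧ e + (2 * r + 2) - e % (2 * r + 2) ≤ traceLen r s := by
  obtain ⟨h1, h2⟩ := div_traceLen hr s
  have h0 := Nat.mod_lt s hr
  have h3 := Nat.div_add_mod s r
  have h4 := Nat.div_add_mod e (2 * r + 2)
  have h5 := Nat.div_add_mod (traceLen r s) (2 * r + 2)
  have h6 : e / (2 * r + 2) ≤ s / r := h1 ▸ Nat.div_le_div_right he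
  rw [h1, h2] at h5
  rcases h6.lt_or_eq with h7 | h7
  · have h8 := Nat.mul_le_mul_left r (Nat.succ_le_of_lt h7)
    have h9 := Nat.mul_le_mul_left (2 * r + 2) (Nat.succ_le_of_lt h7)
    rw [Nat.mul_succ] at h8 h9
    omega
  · rw [h7] at h4
    omega

theorem wc_zero (k : Fin K) : (M.trace w u s hr hn).wc 0 k = none := by
  simp [Trace.wc, trace, tokAt_zero M w u s hr, CoTToken.isRun, CoTToken.isSym]

theorem wc_inpSym {a : ℕ} (ha : a < w.length) (k : Fin K) :
    (M.trace w u s hr hn).wc (a + 1) k = if k = M.k0 then some a else none := by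
  have : a + 1 < outPos r w s := by unfold outPos; omega
  simp [Trace.wc, trace, tokAt_inpSym M w u s hr ha, CoTToken.isRun, CoTToken.isSym, this]

theorem wc_inpEnd (k : Fin K) : (M.trace w u s hr hn).wc (w.length + 1) k = none := by
  simp [Trace.wc, trace, tokAt_inpEnd M w u s hr, CoTToken.isRun, CoTToken.isSym]

theorem wc_of_lt {e : ℕ} (he : e ≤ traceLen r s) (h : e % (2 * r + 2) < r) (k : Fin K) :
    (M.trace w u s hr hn).wc (w.length + 2 + e) k
      = some ((M.run w (stepAt r w s (w.length + 1 + e))).head k) := by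
  have h1 : (M.traceTok r w e).isRun := (isRun_traceTok M w).2 h
  have h2 : w.length + 2 + e - 1 = w.length + 1 + e := by omega
  simp [Trace.wc, trace, tokAt_trace M w u s hr he, h1, h2]

theorem wc_of_le {e : ℕ} (he : e ≤ traceLen r s) (h : r ≤ e % (2 * r + 2)) (k : Fin K) :
    (M.trace w u s hr hn).wc (w.length + 2 + e) k = none := by
  have h1 : ¬ (M.traceTok r w e).isRun := fun h' => by
    have := (isRun_traceTok M w).1 h'; omega
  have h2 := (traceTok_ne M w (r := r) (e := e)).2.2.2.2
  simp [Trace.wc, trace, tokAt_trace M w u s hr he, h1, h2]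

theorem wc_out {i : ℕ} (hi : i < outPos r w s + u.length + 2) (hio : outPos r w s ≤ i) (k : Fin K) :
    (M.trace w u s hr hn).wc i k = none := by
  have h1 : ¬ (M.tokAt r w u s i).isRun := fun h => by
    obtain ⟨e, he, rfl, -⟩ := run_cases M w u s hr hi h
    unfold outPos at hio
    omega
  simp [Trace.wc, trace, h1, hio.not_gt]

/-- Symbols on the tapes are determined by the last write access. -/
theorem tape_spec {i : ℕ} (h0 : w.length + 1 ≤ i) (hi : i < outPos r w s + u.length + 2) (k : Fin K)
    (p : ℕ) : (∀ j ≤ i, (M.trace w u s hr hn).wc j k = some p →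
      (∀ l, j < l → l ≤ i → (M.trace w u s hr hn).wc l k ≠ some p) →
      (M.tokAt r w u s j).symbol? M k = some ((M.run w (stepAt r w s i)).tape k p)) ∧
    ((∀ j ≤ i, (M.trace w u s hr hn).wc j k ≠ some p) →
      (M.run w (stepAt r w s i)).tape k p = M.blank) := by
  have hk0 : (k : ℕ) = 0 ↔ k = M.k0 := by simp [Fin.ext_iff, k0]
  induction i, h0 using Nat.le_induction with
  | base =>
    rw [stepAt_inpEnd]
    refine ⟨fun j hj hw _ => ?_, fun h => ?_⟩
    · rcases Nat.eq_zero_or_pos j with rfl | hj0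
      · simp [wc_zero] at hw
      rcases hj.lt_or_eq with hj | rfl
      · obtain ⟨a, rfl⟩ : ∃ a, j = a + 1 := ⟨j - 1, by omega⟩
        have ha : a < w.length := by omega
        rw [wc_inpSym M w u s hr hn ha] at hw
        split_ifs at hw with hk
        cases hw
        rw [tokAt_inpSym M w u s hr ha]
        simp [CoTToken.symbol?, run, initConfig, hk0.2 hk, wordTape, ha]
      · simp [wc_inpEnd] at hw
    · simp only [run, initConfig]
      split_ifs with hk
      · have : ¬ p < w.length := fun hp => by
          refine h (p + 1) (by omega) ?_
          rw [wc_inpSym M w u s hr hn hp, if_pos (hk0.1 hk)]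
        rw [wordTape, List.getElem?_eq_none (by omega)]
        rfl
      · rfl
  | succ i h0 ih =>
    obtain ⟨ih1, ih2⟩ := ih (by omega)
    -- Tokens which neither write nor advance the step count leave both assertions unchanged.
    have hskip : (M.trace w u s hr hn).wc (i + 1) k = none →
        stepAt r w s (i + 1) = stepAt r w s i → _ := fun hwn hst =>
      show ((∀ j ≤ i + 1, (M.trace w u s hr hn).wc j k = some p →
        (∀ l, j < l → l ≤ i + 1 → (M.trace w u s hr hn).wc l k ≠ some p) →
        (M.tokAt r w u s j).symbol? M k = some ((M.run w (stepAt r w s (i + 1))).tape k p)) ∧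
      ((∀ j ≤ i + 1, (M.trace w u s hr hn).wc j k ≠ some p) →
        (M.run w (stepAt r w s (i + 1))).tape k p = M.blank)) by
      rw [hst]
      refine ⟨fun j hj hw hl => ?_, fun h => ih2 fun j hj => h j (by omega)⟩
      rcases hj.lt_or_eq with hj | rfl
      · exact ih1 j (by omega) hw fun l h1 h2 => hl l h1 (by omega)
      · rw [hwn] at hw; cases hw
    by_cases hio : outPos r w s ≤ i + 1
    · refine hskip (wc_out M w u s hr hn hi hio k) ?_
      rw [stepAt_out w s hio]
      rcases hio.lt_or_eq with hio | hio
      · rw [stepAt_out w s (by omega)]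
      · rw [← stepAt_outPos_pred w s hr, hio]; rfl
    · obtain ⟨e, rfl⟩ : ∃ e, i = w.length + 1 + e := ⟨i - (w.length + 1), by omega⟩
      have he : e ≤ traceLen r s := by unfold outPos at hio; omega
      have hie : w.length + 1 + e + 1 = w.length + 2 + e := by omega
      by_cases hf : e % (2 * r + 2) < r
      · rw [hie] at hskip ⊢
        have hw1 := wc_of_lt M w u s hr hn he hf k
        rw [stepAt_succ_of_lt w s he hf]
        have htape : ∀ c, c = M.run w (stepAt r w s (w.length + 1 + e)) →
            (M.run w (stepAt r w s (w.length + 1 + e) + 1)).tape k p =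
              if p = c.head k then (M.action c).2.1 k else c.tape k p := by
          rintro c rfl
          change Function.update _ _ _ p = _
          rw [Function.update_apply]
        rw [htape _ rfl]
        refine ⟨fun j hj hw hl => ?_, fun h => ?_⟩
        · rcases hj.lt_or_eq with hj | rfl
          · rw [if_neg]
            · exact ih1 j (by omega) hw fun l h1 h2 => hl l h1 (by omega)
            · intro hp
              exact hl _ hj le_rfl (by rw [hw1, hp])
          · rw [hw1] at hw
            simp only [Option.some.injEq] at hw
            rw [if_pos hw.symm, tokAt_trace M w u s hr he, traceTok_eq_runTok M w s he hf]
            rfl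
        · rw [if_neg]
          · exact ih2 fun j hj => h j (by omega)
          · intro hp
            exact h _ le_rfl (by rw [hw1, hp])
      · rw [hie] at hskip ⊢
        exact hskip (wc_of_le M w u s hr hn he (by omega) k)
          (stepAt_succ_of_le w s hr he (by omega))

/-- Both outcomes of the search give the right symbol: that of the last writer, or the blank at
`<inp>` for a cell never written. -/
theorem st0_ptr (code : Codes Q G dQ dG) {i : ℕ} (h0 : w.length + 1 ≤ i)
    (hi : i < outPos r w s + u.length + 2) {k : Fin K} {p : ℕ}
    (hq : (M.trace w u s hr hn).qc i k = some p) (b : Fin dG) :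
    (M.trace w u s hr hn).st0 code ((M.trace w u s hr hn).ptr code i k)
      (.Y k b : Reg K r dQ dG) = code.G ((M.run w (stepAt r w s i)).tape k p) b := by
  classical
  obtain ⟨h1, h2⟩ := tape_spec M w u s hr hn h0 hi k p
  by_cases h : ∃ j ≤ i, (M.trace w u s hr hn).wc j k = some p
  · obtain ⟨j₀, hj₀, hw₀⟩ := h
    have h3 := Nat.findGreatest_le (P := fun j => (M.trace w u s hr hn).wc j k = some p) i
    have h4 := Nat.findGreatest_spec (P := fun j => (M.trace w u s hr hn).wc j k = some p) hj₀ hw₀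
    have h5 := fun l (hl : Nat.findGreatest _ i < l) (hli : l ≤ i) =>
      Nat.findGreatest_is_greatest (P := fun j => (M.trace w u s hr hn).wc j k = some p) hl hli
    rw [Trace.ptr_eq _ code hi hr hq h3 h4 h5, Trace.st0_Y]
    change (((M.tokAt r w u s _).symbol? M k).elim 0 _ : ℤ) = _
    rw [h1 _ h3 h4 h5]
    rfl
  · push Not at h
    rw [Trace.ptr_eq_zero _ code hi hr hq h, Trace.st0_Y, h2 h]
    change (((M.tokAt r w u s 0).symbol? M k).elim 0 _ : ℤ) = _
    rw [tokAt_zero M w u s hr]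
    rfl

end TuringMachine

theorem add_mod_of_add_lt {N e δ : ℕ} (h : e % N + δ < N) : (e + δ) % N = e % N + δ := by
  conv_lhs => rw [← Nat.div_add_mod e N, add_assoc, Nat.mul_add_mod, Nat.mod_eq_of_lt h]

/-! ### The next token -/

namespace TuringMachine

variable (M : TuringMachine K Q S G) (w u : List S) (s : ℕ) (hr : 0 < r)

-- Seeing `<p>` at distance `δ ≤ r` determines the offset within the period; in particular, no
-- action token sees one.
include hr in
theorem pos_window {i δ : ℕ} (hi : i < outPos r w s + u.length + 2) (hδ : δ ≤ r)
    (h : M.tokAt r w u s (i - δ) = .pos) :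
    ∃ e ≤ traceLen r s, i = w.length + 2 + e ∧ e % (2 * r + 2) = r + δ := by
  obtain ⟨e, he, h1, h2⟩ := eq_pos_cases M w u s hr (by omega) h
  obtain ⟨h3, h4⟩ := lt_of_le_traceLen s hr he (by omega)
  refine ⟨e + δ, by omega, by omega, ?_⟩
  rw [add_mod_of_add_lt (by omega), h2]

-- Going back `r` positions from a run token of offset `r - 1` leads to the delimiter in front of
-- its period. From smaller offsets it leads to a digit of the preceding block or, in the first
-- period, to `<inp>` or an input symbol.
include hr in
theorem delim_window {e : ℕ} (he : e ≤ traceLen r s) (h : e % (2 * r + 2) < r) :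
    (M.tokAt r w u s (w.length + 2 + e - r)).delim = -1 ↔ e % (2 * r + 2) = r - 1 := by
  have hdm := Nat.div_add_mod e (2 * r + 2)
  by_cases hq : e / (2 * r + 2) = 0
  · rw [hq, mul_zero, zero_add] at hdm
    by_cases h1 : e % (2 * r + 2) = r - 1
    · rw [show w.length + 2 + e - r = w.length + 1 by omega, tokAt_inpEnd M w u s hr]
      simp [CoTToken.delim, h1]
    · simp only [h1, iff_false]
      rcases Nat.eq_zero_or_pos (w.length + 2 + e - r) with h2 | h2
      · rw [h2, tokAt_zero M w u s hr]; simp [CoTToken.delim]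
      · obtain ⟨a, ha⟩ : ∃ a, w.length + 2 + e - r = a + 1 := ⟨_, (Nat.succ_pred_eq_of_pos h2).symm⟩
        rw [ha, tokAt_inpSym M w u s hr (by omega : a < w.length)]
        simp [CoTToken.delim]
  · have hN : 2 * r + 2 ≤ (2 * r + 2) * (e / (2 * r + 2)) := Nat.le_mul_of_pos_right _ (Nat.pos_of_ne_zero hq)
    obtain ⟨h1, h2⟩ := sub_div_mod_of_le (N := 2 * r + 2) (e := e) (δ := e % (2 * r + 2)) le_rfl
    rw [Nat.sub_self] at h2
    obtain ⟨h3, h4⟩ := pred_div_mod_of_mod_eq_zero (by omega) h2 (by omega)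
    obtain ⟨h5, h6⟩ := sub_div_mod_of_le (N := 2 * r + 2) (e := e - e % (2 * r + 2) - 1)
      (δ := r - 1 - e % (2 * r + 2)) (by omega)
    have h7 : e - e % (2 * r + 2) - 1 - (r - 1 - e % (2 * r + 2)) = e - r := by omega
    rw [h7, h4] at h6
    rw [show w.length + 2 + e - r = w.length + 2 + (e - r) by omega,
      tokAt_trace M w u s hr (by omega)]
    by_cases h8 : e % (2 * r + 2) = r - 1
    · rw [(traceTok_eq_posEnd M w).2 (by omega)]
      simp [CoTToken.delim, h8]
    · rw [traceTok_bits M w (by omega) (by omega)]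
      simp [CoTToken.delim, h8]

variable (hn : (M.toks r w (s + 1) u).length ≤ 2 ^ r)

theorem last_of_le {e : ℕ} (he : e ≤ traceLen r s) (h : r ≤ e % (2 * r + 2)) :
    ∃ e' ≤ traceLen r s, (M.trace w u s hr hn).last (w.length + 2 + e) = w.length + 2 + e' ∧
      e' % (2 * r + 2) < r ∧ traceStep r e' = traceStep r e := by
  have h0 := Nat.mod_le e (2 * r + 2)
  obtain ⟨h1, h2⟩ := sub_div_mod_of_le (N := 2 * r + 2) (e := e) (δ := e % (2 * r + 2) - r + 1)
    (by omega)
  refine ⟨e - (e % (2 * r + 2) - r + 1), by omega, ?_, by omega, ?_⟩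
  · simp only [Trace.last, trace]
    rw [if_neg (by unfold outPos; omega), Nat.add_sub_cancel_left, if_neg (by omega)]
    omega
  · rw [traceStep_of_le h, traceStep_of_lt (by omega), h1, h2]
    omega

theorem last_of_lt {e : ℕ} (h : e % (2 * r + 2) < r) :
    (M.trace w u s hr hn).last (w.length + 2 + e) = w.length + 2 + e := by
  simp only [Trace.last, trace, Nat.add_sub_cancel_left, if_pos h, ite_self, Nat.sub_zero]

include hr in
theorem state?_of_lt {e : ℕ} (he : e ≤ traceLen r s) (h : e % (2 * r + 2) < r) :
    (M.tokAt r w u s (w.length + 2 + e)).state? M = some (M.run w (traceStep r e)).state := by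
  rw [tokAt_trace M w u s hr he, traceTok_eq_runTok M w s he h, ← stepAt_trace w s he,
    stepAt_succ_of_lt w s he h]
  rfl

theorem state?_last {i : ℕ} (hi : i < outPos r w s + u.length + 2)
    (h : (M.tokAt r w u s i).isAct) : ((M.trace w u s hr hn).tok
      ((M.trace w u s hr hn).last i)).state? M = some (M.run w (stepAt r w s i)).state := by
  change (M.tokAt r w u s _).state? M = _
  rcases act_cases M w u s hr hi h with rfl | ⟨e, he, rfl, h1 | h1⟩
  · have : (M.trace w u s hr hn).last (w.length + 1) = w.length + 1 := by
      simp [Trace.last, trace]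
    rw [this, tokAt_inpEnd M w u s hr, stepAt_inpEnd]
    rfl
  · rw [last_of_lt M w u s hr hn h1, state?_of_lt M w u s hr he h1, stepAt_trace w s he]
  · obtain ⟨e', he', h2, h3, h4⟩ := last_of_le M w u s hr hn he (by omega)
    rw [h2, state?_of_lt M w u s hr he' h3, h4, stepAt_trace w s he]

theorem qc_of_isAct {i : ℕ} (h : (M.tokAt r w u s i).isAct) (k : Fin K) :
    (M.trace w u s hr hn).qc i k = some ((M.run w (stepAt r w s i)).head k) := if_pos h

theorem qc_last {e : ℕ} (he : e ≤ traceLen r s) (h : r ≤ e % (2 * r + 2)) (k : Fin K) :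
    (M.trace w u s hr hn).qc ((M.trace w u s hr hn).last (w.length + 2 + e)) k
      = some ((M.run w (traceStep r e)).head k) := by
  obtain ⟨e', he', h2, h3, h4⟩ := last_of_le M w u s hr hn he h
  rw [h2, qc_of_isAct, stepAt_trace w s he', h4]
  rw [tokAt_trace M w u s hr he', isAct_traceTok]
  exact .inl h3

/-- The output registers contain the code of the next token. -/
theorem stFinal_eq [Fintype Q] [Fintype G] (code : Codes Q G dQ dG)
    (hc : M.Computes w (s + 1) u) {i : ℕ} (h0 : w.length + 1 ≤ i)
    (hi : i + 1 < outPos r w s + u.length + 2) (c : Reg K r dQ dG) (hcO : c.IsOutput) :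
    (M.trace w u s hr hn).stFinal code i c = M.tokUnemb code (M.tokAt r w u s (i + 1)) c := by
  set T := M.trace w u s hr hn with hT
  -- The running time is the first time in the halting state, so `<outp>` cannot come earlier.
  have hne : ∀ s' ≤ s, (M.run w s').state ≠ M.qhalt := fun s' hs' h => by
    have := hc.1.2 h; omega
  have hoL : outPos r w s = w.length + 2 + (traceLen r s + 1) := rfl
  have hy : ∀ i, w.length + 1 ≤ i → i < outPos r w s + u.length + 2 → (M.tokAt r w u s i).isAct →
      ∀ k b, T.st0 code (T.ptr code i k) (.Y k b : Reg K r dQ dG) = code.G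
        ((M.run w (stepAt r w s i)).tape k ((M.run w (stepAt r w s i)).head k)) b :=
    fun i h1 h2 h3 k b => st0_ptr M w u s hr hn code h1 h2 (qc_of_isAct M w u s hr hn h3 k) b
  by_cases hio : outPos r w s ≤ i
  · obtain ⟨a, rfl⟩ : ∃ a, i = outPos r w s + a := ⟨i - outPos r w s, by omega⟩
    have hnt : ∀ e ≤ traceLen r s, outPos r w s + a ≠ w.length + 2 + e := by omega
    have hA : ¬ (M.tokAt r w u s (outPos r w s + a)).isAct := fun h => by
      rcases act_cases M w u s hr (by omega) h with h | ⟨e, he, h, -⟩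
      · omega
      · exact hnt e he h
    have hq : T.qc (outPos r w s + a) M.k0 = some a := by
      change (if (M.tokAt r w u s (outPos r w s + a)).isAct then _ else
        if M.k0 = M.k0 ∧ outPos r w s ≤ outPos r w s + a then some (outPos r w s + a - outPos r w s)
          else none) = _
      rw [if_neg hA, if_pos ⟨rfl, hio⟩, Nat.add_sub_cancel_left]
    have hg : ∀ b, _ := fun b => st0_ptr M w u s hr hn code h0 (by omega) hq b
    rw [stepAt_out w s hio] at hg
    have htape : (M.run w (s + 1)).tape M.k0 = M.wordTape u := hc.2
    rw [htape] at hg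
    refine T.stFinal_of_out code (show _ < outPos r w s + u.length + 2 by omega) hio ?_ ?_ hg ?_ c hcO
    · by_contra h
      obtain ⟨e, he, h1, -⟩ := exists_trace M w u s hr (P := fun v => v.isBits)
        (i := outPos r w s + a) (by omega) ((Bool.not_eq_false _).mp h) (by simp [CoTToken.isBits]) (by simp [CoTToken.isBits])
        (by simp [CoTToken.isBits]) (by simp [CoTToken.isBits]) (by simp [CoTToken.isBits])
      exact hnt e he h1
    · intro δ hδ h
      obtain ⟨e, he, h1, -⟩ := pos_window M w u s hr (by omega) hδ.le h
      exact hnt e he h1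
    · rw [add_assoc, tokAt_out M w u s hr, wordTape]
      cases u[a]? with
      | none => exact .inl ⟨rfl, rfl⟩
      | some x => exact .inr ⟨x, rfl, rfl⟩
  · obtain ⟨e, rfl⟩ : ∃ e, i = w.length + 1 + e := ⟨i - (w.length + 1), by omega⟩
    have he : e ≤ traceLen r s + 1 := by omega
    have hie : w.length + 1 + e + 1 = w.length + 2 + e := by omega
    have hpred : 0 < e → w.length + 1 + e = w.length + 2 + (e - 1) := by omega
    have hio' : w.length + 1 + e < T.o := by change _ < outPos r w s; omega
    rw [hie]
    by_cases heL : e = traceLen r s + 1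
    · -- the last step has been made
      subst heL
      have h1 := hpred (by omega)
      rw [Nat.add_sub_cancel] at h1
      have hmod : traceLen r s % (2 * r + 2) < r := by
        rw [(div_traceLen hr s).2]; exact Nat.mod_lt s hr
      have hst : stepAt r w s (w.length + 1 + (traceLen r s + 1)) = s + 1 := by
        rw [h1, stepAt_trace w s le_rfl, traceStep_traceLen hr]
      have hact : (M.tokAt r w u s (w.length + 1 + (traceLen r s + 1))).isAct := by
        rw [h1, tokAt_trace M w u s hr le_rfl, isAct_traceTok]; exact .inl hmod
      have hhalt : (M.run w (s + 1)).state = M.qhalt := hc.1.1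
      refine T.stFinal_of_act code hact hio' ?_ (state?_last M w u s hr hn (by omega) hact)
        (hy _ h0 (by omega) hact) ?_ (.inl ⟨by rw [hst, hhalt], tokAt_outp M w u s hr⟩) c hcO
      · rintro ⟨h2, -⟩
        change (M.tokAt r w u s _).notHalt M at h2
        rw [h1, tokAt_trace M w u s hr le_rfl, traceTok_eq_runTok M w s le_rfl hmod] at h2
        refine h2 ?_
        have h3 := stepAt_succ_of_lt w s le_rfl hmod
        rw [← h1, hst] at h3
        rw [show stepAt r w s (w.length + 1 + traceLen r s) = s by omega]
        exact hhalt
      · intro δ hδ h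
        obtain ⟨e, he, h2, h3⟩ := pos_window M w u s hr (by omega) hδ.le h
        have : e = traceLen r s := by omega
        subst this
        omega
    have he : e ≤ traceLen r s := by omega
    rw [tokAt_trace M w u s hr he]
    have hNlt := Nat.mod_lt e (show 0 < 2 * r + 2 by omega)
    by_cases hf : e % (2 * r + 2) < r
    · -- a run token follows
      have hle := le_of_le_traceLen s hr he hf
      have hst := stepAt_pred_of_lt w s he hf
      have hact : (M.tokAt r w u s (w.length + 1 + e)).isAct := by
        rcases Nat.eq_zero_or_pos e with rfl | h1
        · rw [add_zero, tokAt_inpEnd M w u s hr]; rfl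
        · rw [hpred h1, tokAt_trace M w u s hr (by omega), isAct_traceTok]
          by_cases h2 : e % (2 * r + 2) = 0
          · obtain ⟨h3, h4⟩ := pred_div_mod_of_mod_eq_zero (by omega) h2 h1
            omega
          · obtain ⟨h3, h4⟩ := sub_div_mod_of_le (N := 2 * r + 2) (e := e) (δ := 1) (by omega)
            omega
      refine T.stFinal_of_act code hact hio' ?_ (state?_last M w u s hr hn (by omega) hact)
        (hy _ h0 (by omega) hact) ?_ (.inr ⟨hne _ (by omega), ?_⟩) c hcO
      -- If a block were due, the current run token would have offset `r - 1`, and the next offset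
      -- would be `r`.
      · rintro ⟨h2, h3⟩
        change (M.tokAt r w u s _).notHalt M at h2
        change (M.tokAt r w u s (_ - r)).delim = -1 at h3
        have h4 : (M.tokAt r w u s (w.length + 1 + e)).isRun := by
          revert h2; cases M.tokAt r w u s (w.length + 1 + e) <;>
            simp [CoTToken.notHalt, CoTToken.isRun]
        obtain ⟨e', he', h5, h6⟩ := run_cases M w u s hr (by omega) h4
        obtain rfl : e = e' + 1 := by omega
        rw [h5, delim_window M w u s hr he' h6] at h3
        rw [add_mod_of_add_lt (by omega)] at hf
        omega
      · intro δ hδ h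
        obtain ⟨e', he', h2, h3⟩ := pos_window M w u s hr (by omega) hδ.le h
        rw [h2, tokAt_trace M w u s hr he', isAct_traceTok] at hact
        omega
      · rw [traceTok_eq_runTok M w s he hf]; rfl
    have h1 : 0 < e := Nat.pos_of_ne_zero fun h => by subst h; simp at hf; omega
    have he1 : e - 1 ≤ traceLen r s := by omega
    have hstep := traceStep_pred_of_le (e := e) hr (by omega)
    obtain ⟨h3, h4⟩ := sub_div_mod_of_le (N := 2 * r + 2) (e := e) (δ := 1) (by omega)
    obtain ⟨h5, -⟩ := lt_of_le_traceLen s hr he (by omega)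
    rw [hpred h1] at hio' ⊢
    by_cases hfr : e % (2 * r + 2) = r
    · -- the head positions follow
      rw [(traceTok_eq_pos M w).2 hfr]
      refine T.stFinal_of_delim code ?_ ((delim_window M w u s hr he1 (by omega)).2 (by omega)) hio' ?_
        c hcO
      · change (M.tokAt r w u s _).notHalt M
        have h6 := stepAt_succ_of_lt w s he1 (by omega)
        rw [tokAt_trace M w u s hr he1, traceTok_eq_runTok M w s he1 (by omega)]
        change (M.run w (stepAt r w s (w.length + 1 + (e - 1)) + 1)).state ≠ M.qhalt
        rw [← h6, stepAt_trace w s he1, hstep, traceStep_of_le (by omega)]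
        exact hne _ h5
      · intro δ hδ h
        obtain ⟨e', he', h6, h7⟩ := pos_window M w u s hr (by omega) hδ.le h
        obtain rfl : e' = e - 1 := by omega
        omega
    by_cases hf2 : e % (2 * r + 2) ≤ 2 * r
    · -- bits follow
      have h7 : e % (2 * r + 2) - 1 - r ≤ (e - 1) % (2 * r + 2) := by omega
      have h6 := sub_div_mod_of_le h7
      have h8 := Nat.mod_le e (2 * r + 2)
      have hrel : ¬ (M.traceTok r w (e - 1)).isAct := by rw [isAct_traceTok]; omega
      rw [traceTok_bits M w (by omega) hf2, show e % (2 * r + 2) - (r + 1) =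
        e % (2 * r + 2) - 1 - r by omega]
      refine T.stFinal_of_relay code ?_ (show _ < outPos r w s + u.length + 2 by omega) hio'
        (by omega) ?_ ?_ (fun k => ?_) c hcO
      · change (M.tokAt r w u s _).isAct = false
        rw [tokAt_trace M w u s hr he1]; simpa using hrel
      · change M.tokAt r w u s _ = _
        rw [show w.length + 2 + (e - 1) - (e % (2 * r + 2) - 1 - r)
          = w.length + 2 + (e - 1 - (e % (2 * r + 2) - 1 - r)) by omega,
          tokAt_trace M w u s hr (by omega), traceTok_eq_pos]
        omega
      · rintro ⟨-, h9⟩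
        have h10 : M.tokAt r w u s (w.length + 2 + (e - 1) - r) = .pos := by
          change (M.tokAt r w u s (w.length + 2 + (e - 1) - r)).delim = 1 at h9
          revert h9; cases M.tokAt r w u s (w.length + 2 + (e - 1) - r) <;> simp [CoTToken.delim]
        obtain ⟨e', he', h11, h12⟩ := pos_window M w u s hr (by omega) le_rfl h10
        obtain rfl : e' = e - 1 := by omega
        omega
      · rw [← hstep]
        exact qc_last M w u s hr hn he1 (by omega) k
    · -- the end of the head positions
      obtain ⟨h6, h7⟩ := sub_div_mod_of_le (N := 2 * r + 2) (e := e - 1) (δ := r) (by omega)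
      have h8 := Nat.mod_le e (2 * r + 2)
      rw [(traceTok_eq_posEnd M w).2 (by omega)]
      refine T.stFinal_of_last_bit code ?_ hio' ?_ ?_ c hcO
      · change (M.tokAt r w u s _).isBits
        rw [tokAt_trace M w u s hr he1, isBits_traceTok]; omega
      · intro δ hδ h
        obtain ⟨e', he', h6, h7⟩ := pos_window M w u s hr (by omega) hδ.le h
        obtain rfl : e' = e - 1 := by omega
        omega
      · change M.tokAt r w u s _ = _
        rw [show w.length + 2 + (e - 1) - r = w.length + 2 + (e - 1 - r) by omega,
          tokAt_trace M w u s hr (by omega), traceTok_eq_pos]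
        omega

end TuringMachine

/-! ### Assembling the simulator -/

namespace Codes

theorem exists_code (A : Type*) [Fintype A] :
    ∃ f : A → Fin (Nat.clog 2 (Fintype.card A)) → ℤˣ, Function.Injective f := by
  obtain ⟨f⟩ := Function.Embedding.nonempty_of_card_le
    (α := A) (β := Fin (Nat.clog 2 (Fintype.card A)) → ℤˣ) (by
      rw [Fintype.card_fun, Fintype.card_units_int, Fintype.card_fin]
      exact Nat.le_pow_clog one_lt_two _)
  exact ⟨f, f.injective⟩

def moveCode : HeadMove → Fin 2 → ℤˣ
  | .left => ![1, 1]
  | .stay => ![1, -1]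
  | .right => ![-1, 1]

theorem moveCode_injective : Function.Injective moveCode := by
  intro a b h
  have h0 := congrFun h 0
  have h1 := congrFun h 1
  cases a <;> cases b <;> simp [moveCode] at h0 h1 ⊢

theorem nonempty (Q G : Type*) [Fintype Q] [Fintype G] :
    Nonempty (Codes Q G (Nat.clog 2 (Fintype.card Q)) (Nat.clog 2 (Fintype.card G))) := by
  obtain ⟨f, hf⟩ := exists_code Q
  obtain ⟨g, hg⟩ := exists_code G
  exact ⟨⟨f, g, moveCode, hf, hg, moveCode_injective⟩⟩

end Codes

theorem length_promptToks (w : List S) :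
    (promptToks w : List (CoTToken K Q S G)).length = w.length + 2 := by
  simp [promptToks]

namespace TuringMachine

variable (M : TuringMachine K Q S G)

theorem Computes.exists_succ {M : TuringMachine K Q S G} {w u : List S} {t : ℕ}
    (h : M.Computes w t u) : ∃ s, t = s + 1 := by
  refine Nat.exists_eq_succ_of_ne_zero ?_
  rintro rfl
  exact M.qhalt_ne h.1.1.symm

/-- The transformer which simulates `M`. -/
noncomputable def simulator [Fintype Q] [Fintype G] (code : Codes Q G dQ dG) (h : ℕ)
    {d dff dk dv H L : ℕ} (e : Reg K r dQ dG ↪ Fin d) :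
    Transformer d dff dk dv H L r (CoTToken K Q S G) :=
  compileTransformer e ⟨Reg.pos, Reg.pos_injective⟩ (M.program code h) (M.tokEmb code)
    (M.tokUnemb code)

theorem length_prompt_lt_length_toks (w u : List S) (s : ℕ) (hr : 0 < r) :
    w.length + 2 < (M.toks r w (s + 1) u).length := by
  rw [length_toks M w u s hr, outPos]; omega

section Simulator

variable [Fintype Q] [Fintype G] (code : Codes Q G dQ dG) {h : ℕ} {d dff dv : ℕ}
  (e : Reg K r dQ dG ↪ Fin d)

theorem emb_add_posemb {dk H L : ℕ} (w u : List S) (s : ℕ) (hr : 0 < r)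
    (hn : (M.toks r w (s + 1) u).length ≤ 2 ^ r) (i : ℕ) :
    toVec e (M.tokEmb code (M.tokAt r w u s i)) +
      (M.simulator code h e : Transformer d dff dk dv H L r (CoTToken K Q S G)).posemb i
      = toVec e ((M.trace w u s hr hn).st0 code i) := by
  rw [simulator, posemb_compileTransformer (y := fun c => match c with
    | .pos s => bitSign s i | _ => 0), toVec_add]
  · congr 1
    funext c
    cases c with
    | pos s => exact zero_add _
    | _ => exact add_zero _
  · intro s; rfl
  · intro c hc
    cases c with
    | pos s => exact absurd ⟨s, rfl⟩ hc
    | _ => rfl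

variable (hK : 0 < K) (hr4 : 4 ≤ r) (hrh : r = 2 * h) (h1 : 18 * r + 2 ≤ dff)
  (h2 : 14 * K * r + 2 * r ≤ dff) (hv : r ≤ dv) (hQ : dQ ≤ dv) (hG : dG ≤ dv)
  (hG' : 2 * dG ≤ dff) (h3 : Fintype.card Q * Fintype.card G ^ K ≤ dff)

include hK hr4 hrh h1 h2 hv hQ hG hG' h3

/-- The program is run once, on the complete sequence. Its final state at position `k - 1` is also
that of the prefix of length `k`, and it contains the code of token `k`. -/
theorem simulator_spec {w u : List S} {t : ℕ} (hc : M.Computes w t u)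
    (hn : (M.toks r w t u).length ≤ 2 ^ r) :
    (M.simulator code h e : Transformer d dff (4 * r - 1) dv (3 * K) (2 * r + h + 8) r
      (CoTToken K Q S G)).ComputesCoT w u (M.toks r w t u) ∧
    (M.simulator code h e : Transformer d dff (4 * r - 1) dv (3 * K) (2 * r + h + 8) r
      (CoTToken K Q S G)).TernaryDuring (promptToks w) (M.toks r w t u) := by
  obtain ⟨s, rfl⟩ := hc.exists_succ
  have hr : 0 < r := by omega
  have hlen := length_toks M w u s hr
  set T := M.trace w u s hr hn with hT
  obtain ⟨X, hX0, hXL, hstep⟩ := (T.runs_program code hrh).exists_states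
  have hL := M.length_program (r := r) code h
  rw [hL] at hXL
  have hfit := fits_program (M := M) (code := code) hK hr4 h1 h2 hv h hQ hG hG' h3
  have hTn : T.n = (M.toks r w (s + 1) u).length := hlen.symm
  have hXe : ∀ (k : ℕ) (i : Fin ((M.toks r w (s + 1) u).take k).length),
      toVec e (M.tokEmb code (((M.toks r w (s + 1) u).take k).get i)) +
        (M.simulator code h e : Transformer d dff (4 * r - 1) dv (3 * K) (2 * r + h + 8) r
          (CoTToken K Q S G)).posemb i = toVec e (X 0 i) := by
    intro k i
    rw [hX0, ← emb_add_posemb M code e w u s hr hn i, List.get_eq_getElem, List.getElem_take,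
      tokAt_eq]
  have hle : ∀ k, ((M.toks r w (s + 1) u).take k).length ≤ T.n := fun k => by
    rw [hTn]; exact List.length_take_le' _ _
  have hinp : ∀ k, w.length + 2 ≤ k → k < T.n → M.tokAt r w u s k ≠ .inp ∧
      M.tokAt r w u s k ≠ .inpEnd := by
    intro k hk hkn
    refine ⟨fun h => ?_, fun h => ?_⟩
    · have := (T.inp_iff k hkn).1 h; omega
    · rcases act_cases M w u s hr hkn (by rw [h]; rfl) with rfl | ⟨a, ha, rfl, -⟩
      · omega
      · rw [tokAt_trace M w u s hr ha] at h; exact (traceTok_ne M w).2.1 h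
  have hend : ∀ k < T.n, M.tokAt r w u s k = .outpEnd ↔ k + 1 = T.n := by
    intro k hkn
    constructor
    · intro h
      rcases pos_cases w u s hkn with rfl | ⟨a, ha, rfl⟩ | rfl | ⟨a, ha, rfl⟩ | rfl | ⟨a, ha, rfl⟩ |
        rfl
      · simp [tokAt_zero M w u s hr] at h
      · simp [tokAt_inpSym M w u s hr ha] at h
      · simp [tokAt_inpEnd M w u s hr] at h
      · rw [tokAt_trace M w u s hr ha] at h; exact absurd h (traceTok_ne M w).2.2.2.1
      · simp [tokAt_outp M w u s hr] at h
      · simp [tokAt_outSym M w u s hr ha] at h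
      · rfl
    · intro h
      obtain rfl : k = outPos r w s + (u.length + 1) := by
        have : T.n = outPos r w s + u.length + 2 := rfl
        omega
      exact tokAt_outpEnd M w u s hr
  refine ⟨⟨⟨⟨M.traceToks r w (s + 1) ++ outputToks u, by simp [toks]⟩, ?_, fun k hk hpk => ⟨?_, ?_⟩⟩,
    ⟨_, rfl⟩, outPos r w s, ?_, ?_⟩, fun k hpk hk => ?_⟩
  · rw [length_promptToks]; exact length_prompt_lt_length_toks M w u s hr
  · rw [length_promptToks] at hpk
    have hlk : ((M.toks r w (s + 1) u).take k).length = k := by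
      rw [List.length_take]; omega
    have hne : (M.toks r w (s + 1) u).take k ≠ [] := fun h => by
      rw [h] at hlk; simp at hlk; omega
    refine ⟨hne, fun v' hv' => ?_⟩
    rw [tokAt_eq] at hv' ⊢
    have hscore : ∀ v, (M.simulator code h e : Transformer d dff (4 * r - 1) dv (3 * K)
        (2 * r + h + 8) r (CoTToken K Q S G)).score _ hne v =
          ((∑ c, M.tokUnemb code v c * T.stFinal code (k - 1) c : ℤ) : ℝ) := by
      intro v
      rw [Transformer.score, simulator, rep_compileTransformer e _ _ hL (by omega) hfit hstep _
        (hle k) (hXe k) _ le_rfl, hXL]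
      simp only [hlk]
      exact toVec_dotProduct e _ _
    rw [hscore, hscore, Int.cast_lt]
    refine readout_lt M code (hinp k hpk (hTn ▸ hk)).1 (hinp k hpk (hTn ▸ hk)).2 hv'
      fun c hcO => ?_
    have := stFinal_eq M w u s hr hn code hc (i := k - 1) (by omega) (by omega) c hcO
    rwa [show k - 1 + 1 = k by omega] at this
  · rw [tokAt_eq, Set.mem_singleton_iff, hend k (hTn ▸ hk), hTn]
  · have hlt : outPos r w s < (M.toks r w (s + 1) u).length := by omega
    simp only [List.getElem?_eq_getElem hlt, tokAt_eq, tokAt_outp M w u s hr]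
  · intro k hk
    obtain ⟨hlt, hk⟩ := List.getElem?_eq_some_iff.1 hk
    rw [tokAt_eq] at hk
    exact (T.outp_iff k (hTn ▸ hlt)).1 hk
  · exact ternaryActivations_compileTransformer e _ _ hL (by omega) hfit hstep
      (fun i _ c => hX0 ▸ T.tern_st0 code i c) _ (hle k) (hXe k)

end Simulator

theorem simulator_ternaryWeights [Fintype Q] [Fintype G] (code : Codes Q G dQ dG) (h : ℕ)
    {d dff dk dv H L : ℕ} (e : Reg K r dQ dG ↪ Fin d) :
    (M.simulator code h e : Transformer d dff dk dv H L r (CoTToken K Q S G)).TernaryWeights :=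
  compileTransformer_ternaryWeights _ _ _ _ _ (Trace.tern_tokEmb code) (tern_tokUnemb M code)

/-- A Turing machine with output has at least two states. -/
theorem two_le_card (M : TuringMachine K Q S G) [Fintype Q] : 2 ≤ Fintype.card Q :=
  Fintype.one_lt_card_iff.2 ⟨_, _, M.qhalt_ne⟩

/-- This makes room for the neurons of `readLayer`; the factor `2` is supplied by the two distinct
states. -/
theorem two_mul_clog_le (M : TuringMachine K Q S G) [Fintype Q] [Fintype G] :
    2 * Nat.clog 2 (Fintype.card G) ≤ Fintype.card Q * Fintype.card G ^ K := by
  have hG : 0 < Fintype.card G := Fintype.card_pos_iff.2 ⟨M.blank⟩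
  have h1 : Nat.clog 2 (Fintype.card G) ≤ Fintype.card G :=
    Nat.clog_le_of_le_pow Nat.lt_two_pow_self.le
  have h2 : Fintype.card G ≤ Fintype.card G ^ K := Nat.le_self_pow M.K_pos.ne' _
  exact Nat.mul_le_mul M.two_le_card (h1.trans h2)

theorem tape_run_of_le (w : List S) (s : ℕ) (k : Fin K) {p : ℕ} (hw : w.length ≤ p) (hs : s ≤ p) :
    (M.run w s).tape k p = M.blank := by
  induction s with
  | zero =>
    simp only [run, initConfig]
    split_ifs
    · rw [wordTape, List.getElem?_eq_none hw]; rfl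
    · rfl
  | succ s ih =>
    have := M.head_run_le w s k
    change Function.update _ _ _ p = _
    rw [Function.update_of_ne (by omega), ih (by omega)]

/-- A cell beyond the input which no head could have written within `t` steps is blank, and output
symbols are not. -/
theorem Computes.length_le {M : TuringMachine K Q S G} {w u : List S} {t : ℕ}
    (h : M.Computes w t u) : u.length ≤ max w.length t := by
  by_contra hc
  have h1 := M.tape_run_of_le w t ⟨0, M.K_pos⟩ (le_max_left w.length t) (le_max_right w.length t)
  rw [h.2, wordTape, List.getElem?_eq_getElem (by omega)] at h1
  exact M.blank_ne _ h1

/-- Every full `r` steps cost a block of `r + 2 ≤ 2r` further tokens, so the trace is linear in `t`;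
the output is bounded by `Computes.length_le`. -/
theorem length_toks_le {r : ℕ} (hr : 4 ≤ r) {w u : List S} {t : ℕ} (h : M.Computes w t u) :
    (M.toks r w t u).length ≤ 8 * (t + w.length) := by
  obtain ⟨s, rfl⟩ := h.exists_succ
  have hu := h.length_le
  rw [length_toks M w u s (by omega), outPos, traceLen, mul_add]
  have h1 := Nat.div_mul_le_self s r
  have h2 : s / r * 2 ≤ s / r * r := Nat.mul_le_mul_left _ (by omega)
  have h3 := max_le_add_of_nonneg (Nat.zero_le w.length) (Nat.zero_le (s + 1))
  omega

theorem exists_simulator [Fintype Q] [Fintype G] {d dff dv L : ℕ} (hr4 : 4 ≤ r)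
    (hrh : Even r) (hL : L = 5 * r / 2 + 8)
    (hd : 6 * K * r + 6 * r + 3 * Nat.clog 2 (Fintype.card Q)
      + (3 * K + 1) * Nat.clog 2 (Fintype.card G) + 10 * K + 21 ≤ d) (h1 : 18 * r + 2 ≤ dff)
    (h2 : 14 * K * r + 2 * r ≤ dff) (hv : r ≤ dv) (hQ : Nat.clog 2 (Fintype.card Q) ≤ dv)
    (hG : Nat.clog 2 (Fintype.card G) ≤ dv) (h3 : Fintype.card Q * Fintype.card G ^ K ≤ dff) :
    ∃ T : Transformer d dff (4 * r - 1) dv (3 * K) L r (CoTToken K Q S G), T.TernaryWeights ∧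
      ∀ (w u : List S) (t : ℕ), M.Computes w t u → (M.toks r w t u).length ≤ 2 ^ r →
        T.ComputesCoT w u (M.toks r w t u) ∧ T.TernaryDuring (promptToks w) (M.toks r w t u) := by
  obtain ⟨code⟩ := Codes.nonempty Q G
  obtain ⟨h, hh⟩ := hrh.two_dvd
  obtain ⟨e⟩ := Function.Embedding.nonempty_of_card_le
    (α := Reg K r (Nat.clog 2 (Fintype.card Q)) (Nat.clog 2 (Fintype.card G))) (β := Fin d)
    ((Reg.card_le M.K_pos).trans (by simpa using hd))
  obtain rfl : L = 2 * r + h + 8 := by omega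
  exact ⟨M.simulator code h e, M.simulator_ternaryWeights code h e, fun w u t hc hn =>
    M.simulator_spec code e M.K_pos hr4 hh h1 h2 hv hQ hG (M.two_mul_clog_le.trans h3) h3 hc hn⟩

end TuringMachine

/-- Needed only for `r = 2`, where the bound on the length cannot be satisfied and any transformer
will do. -/
theorem Transformer.exists_ternaryWeights {d dff dk dv H L dpos : ℕ} (V : Type*) (h : dpos ≤ d) :
    ∃ T : Transformer d dff dk dv H L dpos V, T.TernaryWeights :=
  ⟨⟨fun _ => ⟨fun _ => ⟨0, 0, 0, 0⟩, ⟨0, 0, 0⟩⟩, 0, 0, Fin.castLEEmb h⟩, by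
    simp [Transformer.TernaryWeights, IsTernary]⟩

theorem one_le_two_mul_log {n : ℕ} (hn : 1 ≤ n) : 1 ≤ 2 * Real.log (n + 1) := by
  have h1 : Real.log 2 ≤ Real.log (n + 1) := Real.log_le_log (by norm_num) (by
    have : (1 : ℝ) ≤ n := by exact_mod_cast hn
    linarith)
  have := Real.log_two_gt_d9
  linarith

/-- With `c + 1` the rounded logarithm, the left side is `2c + 6`, where `c * log 2 ≤ log (n + 1)`
and `log 2 ≤ log (n + 1)`; `8 / log 2` is less than `12`. -/
theorem clog_le_log {n : ℕ} (hn : 1 ≤ n) :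
    ((2 * (Nat.clog 2 (n + 1) + 2) : ℕ) : ℝ) ≤ 12 * Real.log (n + 1) := by
  have h0 := Real.log_two_gt_d9
  have h1 : Real.log 2 ≤ Real.log (n + 1) := Real.log_le_log (by norm_num) (by
    have : (1 : ℝ) ≤ n := by exact_mod_cast hn
    linarith)
  have h2 := Nat.pow_pred_clog_lt_self one_lt_two (show 1 < n + 1 by omega)
  have h3 : 0 < Nat.clog 2 (n + 1) := Nat.clog_pos one_lt_two (by omega)
  obtain ⟨c, hc⟩ := Nat.exists_eq_succ_of_ne_zero h3.ne'
  rw [hc] at h2 ⊢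
  have h4 : (c : ℝ) * Real.log 2 ≤ Real.log (n + 1) := by
    rw [← Real.log_pow]
    refine Real.log_le_log (by positivity) ?_
    exact_mod_cast h2.le
  push_cast
  have h5 : (c : ℝ) * (693 / 1000) ≤ (c : ℝ) * Real.log 2 := by
    have : (0 : ℝ) ≤ c := Nat.cast_nonneg c
    exact mul_le_mul_of_nonneg_left (by linarith) this
  linarith

end Simulation

theorem theorem3p2 :
    -- explicit form
    (∀ (K : ℕ) (Q S G : Type*) [Fintype Q] [Fintype S] [Fintype G] (M : TuringMachine K Q S G)
      (r : ℕ), Even r → 2 ≤ r →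
      ∃ T : Transformer
          (6 * K * r + 6 * r + 3 * Nat.clog 2 (Fintype.card Q)
            + (3 * K + 1) * Nat.clog 2 (Fintype.card G) + 10 * K + 21)
          (max (18 * r + 2) (max (14 * K * r + 2 * r) (Fintype.card Q * Fintype.card G ^ K + 1)))
          (4 * r - 1)
          (max r (max (Nat.clog 2 (Fintype.card Q)) (Nat.clog 2 (Fintype.card G))))
          (3 * K) (5 * r / 2 + 8) r (CoTToken K Q S G),
        T.TernaryWeights ∧
        ∀ (w u : List S) (t : ℕ), M.Computes w t u → (M.toks r w t u).length ≤ 2 ^ r →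
          T.ComputesCoT w u (M.toks r w t u) ∧
          T.TernaryDuring (promptToks w) (M.toks r w t u)) ∧
    -- asymptotic form
    (∃ C : ℝ, ∀ (K : ℕ) (Q S G : Type*) [Fintype Q] [Fintype S] [Fintype G]
      (M : TuringMachine K Q S G), ∃ CM : ℝ, ∀ tmax : ℕ, 1 ≤ tmax →
      ∃ (d dff dk dv H L dpos : ℕ) (T : Transformer d dff dk dv H L dpos (CoTToken K Q S G)),
        T.TernaryWeights ∧
        (H : ℝ) ≤ CM ∧
        (L : ℝ) ≤ C * Real.log (tmax + 1) ∧
        (d : ℝ) ≤ CM * Real.log (tmax + 1) ∧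
        (dv : ℝ) ≤ CM * Real.log (tmax + 1) ∧
        (dff : ℝ) ≤ CM * Real.log (tmax + 1) ∧
        (dk : ℝ) ≤ C * Real.log (tmax + 1) ∧
        ∀ (w u : List S) (t : ℕ), M.Computes w t u → t ≤ tmax → w.length ≤ tmax →
          ∃ τ : List (CoTToken K Q S G), T.ComputesCoT w u τ ∧
            (τ.length : ℝ) ≤ C * ((t : ℝ) + w.length) ∧
            T.TernaryDuring (promptToks w) τ) := by
  -- As `r ≤ 12 log`, the key dimension is at most `48 log` and the depth at most `46 log`; the
  -- length needs only the constant `8`.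
  refine ⟨fun K Q S G _ _ _ M r hr h2 => ?_, 50, fun K Q S G _ _ _ M => ?_⟩
  · by_cases h4 : 4 ≤ r
    · exact M.exists_simulator h4 hr rfl le_rfl (by omega) (by omega) (by omega) (by omega) (by omega)
        (by omega)
    · obtain ⟨c, hc⟩ := hr.two_dvd
      obtain rfl : r = 2 := by omega
      obtain ⟨T, hT⟩ := Transformer.exists_ternaryWeights (d := 6 * K * 2 + 6 * 2
        + 3 * Nat.clog 2 (Fintype.card Q) + (3 * K + 1) * Nat.clog 2 (Fintype.card G) + 10 * K + 21)
        (dpos := 2) (CoTToken K Q S G) (by omega)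
      refine ⟨T, hT, fun w u t hc hn => ?_⟩
      obtain ⟨s, rfl⟩ := hc.exists_succ
      -- Already five tokens are unavoidable, which exceeds `2 ^ 2`.
      rw [M.length_toks w u s two_pos, TuringMachine.outPos] at hn
      omega
  -- `A * r + B` dominates the model, value and feed-forward dimensions required by
  -- `exists_simulator`, and `12 * A + 2 * B` also dominates `3 * K`.
  · set A : ℕ := 20 * K + 30 with hA
    set B : ℕ := 3 * Nat.clog 2 (Fintype.card Q) + (3 * K + 1) * Nat.clog 2 (Fintype.card G)
      + 10 * K + 21 + Fintype.card Q * Fintype.card G ^ K with hB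
    refine ⟨12 * A + 2 * B, fun tmax ht => ?_⟩
    -- This is even and at least `4`, and the summand `2` gives `2 ^ r ≥ 16 * (tmax + 1) ≥ 8 * (t +
    -- |w|)`.
    set r := 2 * (Nat.clog 2 (tmax + 1) + 2) with hr
    have hlog := one_le_two_mul_log ht
    have hrlog := clog_le_log ht
    rw [← hr] at hrlog
    set l := Real.log (tmax + 1) with hl
    have hbound : ∀ x : ℕ, x ≤ A * r + B → (x : ℝ) ≤ (12 * A + 2 * B) * l := by
      intro x hx
      have h1 : (x : ℝ) ≤ A * r + B := by exact_mod_cast hx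
      have h2 : (A : ℝ) * r ≤ A * (12 * l) := mul_le_mul_of_nonneg_left hrlog (Nat.cast_nonneg A)
      have h3 : (B : ℝ) * 1 ≤ B * (2 * l) := mul_le_mul_of_nonneg_left hlog (Nat.cast_nonneg B)
      linarith
    have hAr : A * r = 20 * (K * r) + 30 * r := by rw [hA]; ring
    have hKr : 6 * K * r = 6 * (K * r) ∧ 14 * K * r = 14 * (K * r) := ⟨by ring, by ring⟩
    have hGB : Nat.clog 2 (Fintype.card G) ≤ (3 * K + 1) * Nat.clog 2 (Fintype.card G) :=
      Nat.le_mul_of_pos_left _ (by omega)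
    obtain ⟨T, hT, hspec⟩ := M.exists_simulator (r := r) (d := A * r + B) (dff := A * r + B)
      (dv := A * r + B) (by omega) (even_two_mul _) rfl (by omega) (by omega) (by omega) (by omega)
      (by omega) (by omega) (by omega)
    refine ⟨_, _, _, _, _, _, _, T, hT, ?_, ?_, hbound _ le_rfl, hbound _ le_rfl, hbound _ le_rfl, ?_,
      fun w u t hc htt hw => ?_⟩
    · have h1 : 3 * K ≤ 12 * A + 2 * B := by omega
      exact_mod_cast h1
    · have h1 : 2 * (5 * r / 2 + 8) ≤ 5 * r + 16 := by omega
      have h2 : 2 * ((5 * r / 2 + 8 : ℕ) : ℝ) ≤ 5 * r + 16 := by exact_mod_cast h1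
      linarith
    · have h1 : 4 * r - 1 ≤ 4 * r := by omega
      have h2 : ((4 * r - 1 : ℕ) : ℝ) ≤ 4 * r := by exact_mod_cast h1
      linarith
    · have hlen := M.length_toks_le (r := r) (by omega) hc
      have hpow : 8 * (t + w.length) ≤ 2 ^ r := by
        have h1 := Nat.le_pow_clog one_lt_two (tmax + 1)
        have h2 : 2 ^ r = (2 ^ Nat.clog 2 (tmax + 1)) ^ 2 * 16 := by
          rw [hr, mul_add, pow_add, pow_mul']; norm_num
        have h3 : tmax + 1 ≤ (2 ^ Nat.clog 2 (tmax + 1)) ^ 2 := h1.trans (Nat.le_self_pow two_ne_zero _)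
        omega
      obtain ⟨h1, h2⟩ := hspec w u t hc (hlen.trans hpow)
      refine ⟨_, h1, ?_, h2⟩
      have h3 : ((M.toks r w t u).length : ℝ) ≤ 8 * (t + w.length) := by exact_mod_cast hlen
      have h4 : (0 : ℝ) ≤ t + w.length := by positivity
      linarith
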